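/- Theorem 4. A nondeterministic braidlike Turing machine with $N$ states and $S$ symbols (one of them the blank) works on a half-infinite tape with cells $0,1,2,\dots$. Its program is a finite list of instructions; an instruction says that in a given state, scanning a given symbol, the machine may write a symbol or write nothing, then move its head one cell to the left, one cell to the right, or not at all (a head that tries to move left from cell $0$ stays there), and enter a given state. Whenever a symbol is written, all cells to the right of the head become blank; when nothing is written the tape does not change. The computation starts in the start state, on cell $0$ of a blank tape, and at each step any applicable instruction may be chosen. Consider the decision problem: given a nondeterministic braidlike Turing machine with $N$ states and $S$ symbols, described by its list of instructions with states and symbols written as binary numbers, and given a target state $T$, can the machine reach $T$? This problem is decidable in space $2^{\mathrm{poly}(N)}\log^2(S)$. That is, there are a single deterministic Turing machine $M$, with a read-only two-way input tape and finitely many work tapes, and a polynomial $p$ with natural-number coefficients, such that for all $N$ and $S$ and for every such instance, $M$ halts on the instance, accepts it if and only if some computation of the given braidlike machine enters $T$, and scans in total at most $$2^{p(N)}\cdot\max\bigl(1,\lfloor\log_2 S\rfloor\bigr)^2$$ cells of its work tapes. -/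

import Mathlib

namespace Braid

/-- Head movements, used both by the machines under study and by the deciding machine. -/
inductive Move where
  | left
  | stay
  | right

/-- Position after a move on a half-infinite tape with cells `0, 1, 2, …`; a head that tries to
leave cell `0` to the left stays there. -/
def Move.apply : Move → ℕ → ℕ
  | .left, n => n - 1
  | .stay, n => n
  | .right, n => n + 1

/-! ### Nondeterministic braidlike Turing machines -/

/-- An instruction: in state `state`, scanning the symbol `read`, the machine may
optionally write a symbol (`none`: nothing is written), then move, and enter state `next`. -/
structure Instr (N S : ℕ) where
  state : Fin N
  read : Fin S
  write : Option (Fin S)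
  move : Move
  next : Fin N

/-- A nondeterministic machine with states `Fin N` and symbols `Fin S`. In each configuration any
applicable instruction of the program may be executed; there may be none, one or several. -/
structure BraidTM (N S : ℕ) where
  start : Fin N
  blank : Fin S
  program : List (Instr N S)

/-- Configurations, on a half-infinite tape. -/
structure BraidTM.Cfg (N S : ℕ) where
  state : Fin N
  tape : ℕ → Fin S
  head : ℕ

namespace BraidTM

variable {N S : ℕ}

/-- Tape after an optional write at cell `h`. Writing erases everything to the right of `h`;
not writing leaves the whole tape unchanged. -/
def writeTape (B : BraidTM N S) (tape : ℕ → Fin S) (h : ℕ) : Option (Fin S) → ℕ → Fin S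
  | none => tape
  | some b => fun j => if j < h then tape j else if j = h then b else B.blank

/-- Initial configuration: blank tape, head on the leftmost cell. -/
def init (B : BraidTM N S) : Cfg N S where
  state := B.start
  tape := fun _ => B.blank
  head := 0

/-- One nondeterministic computation step. -/
def Step (B : BraidTM N S) (c c' : Cfg N S) : Prop :=
  ∃ i ∈ B.program, i.state = c.state ∧ i.read = c.tape c.head ∧
    c' = { state := i.next
           tape := B.writeTape c.tape c.head i.write
           head := i.move.apply c.head }

/-- Some computation from the blank tape enters the state `T`. -/
def CanReach (B : BraidTM N S) (T : Fin N) : Prop :=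
  ∃ c : Cfg N S, Relation.ReflTransGen B.Step B.init c ∧ c.state = T

end BraidTM

/-! ### Encoding of instances as words over a four-letter alphabet -/

/-- The input alphabet. -/
inductive Sym where
  | zero
  | one
  | comma
  | semicolon

/-- A natural number in binary, least significant digit first, followed by a comma. -/
def encodeNat (n : ℕ) : List Sym :=
  n.bits.map (fun b => if b then Sym.one else Sym.zero) ++ [Sym.comma]

/-- Numerical code of a move. -/
def Move.code : Move → ℕ
  | .left => 0
  | .stay => 1
  | .right => 2

/-- Numerical code of an optional write: `0` for "nothing is written", `b + 1` for "write `b`". -/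
def writeCode {S : ℕ} : Option (Fin S) → ℕ
  | none => 0
  | some b => (b : ℕ) + 1

/-- An instruction is encoded by its five components, followed by a semicolon. -/
def Instr.encode {N S : ℕ} (i : Instr N S) : List Sym :=
  encodeNat i.state ++ encodeNat i.read ++ encodeNat (writeCode i.write) ++
    encodeNat i.move.code ++ encodeNat i.next ++ [Sym.semicolon]

/-- Encoding of an instance: the numbers of states and symbols, the start state, the blank symbol
and the target state, a semicolon, and then the instructions. -/
def encodeInstance {N S : ℕ} (B : BraidTM N S) (T : Fin N) : List Sym :=
  encodeNat N ++ encodeNat S ++ encodeNat B.start ++ encodeNat B.blank ++ encodeNat T ++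
    [Sym.semicolon] ++ B.program.flatMap Instr.encode

/-! ### Deterministic space-bounded computation

The usual model for space bounds that may be sublinear: a deterministic Turing machine with a
two-way read-only input tape, whose space is not counted, and finitely many work tapes. -/

/-- What the input head sees: an end marker or an input letter. -/
inductive InputCell (A : Type) where
  | leftEnd
  | letter (a : A)
  | rightEnd

/-- The input tape holds the word `x` in cells `1, …, |x|`, between end markers in cells `0` and
`|x| + 1`. -/
def readInput {A : Type} (x : List A) (p : ℕ) : InputCell A :=
  if p = 0 then .leftEnd
  else match x[p - 1]? with
    | some a => .letter a
    | none => .rightEnd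

/-- A deterministic Turing machine with a read-only input tape over the alphabet `A` and
`tapes` half-infinite work tapes. A state `q` with `verdict q = some b` is a halting state, which
accepts if `b = true` and rejects if `b = false`. -/
structure SpaceTM (A : Type) where
  State : Type
  finite_state : Finite State
  WorkSym : Type
  finite_workSym : Finite WorkSym
  tapes : ℕ
  start : State
  blank : WorkSym
  verdict : State → Option Bool
  /-- The new state, the movement of the input head, and for each work tape the symbol written
  and the movement of the head. -/
  trans : State → InputCell A → (Fin tapes → WorkSym) →
    State × Move × (Fin tapes → WorkSym × Move)

namespace SpaceTM

variable {A : Type}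

/-- Configurations of the machine (the input word, which never changes, is kept apart). -/
structure Cfg (M : SpaceTM A) where
  state : M.State
  inputHead : ℕ
  work : Fin M.tapes → ℕ → M.WorkSym
  workHead : Fin M.tapes → ℕ

/-- Initial configuration: blank work tapes, work heads on cell `0`, and the input head on the
left end marker. -/
def init (M : SpaceTM A) : M.Cfg where
  state := M.start
  inputHead := 0
  work := fun _ _ => M.blank
  workHead := fun _ => 0

/-- One step on the input `x`; halting configurations do not change. The input head never moves
beyond the end markers. -/
def step (M : SpaceTM A) (x : List A) (c : M.Cfg) : M.Cfg :=
  match M.verdict c.state with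
  | some _ => c
  | none =>
    let r := M.trans c.state (readInput x c.inputHead) (fun i => c.work i (c.workHead i))
    { state := r.1
      inputHead := min (r.2.1.apply c.inputHead) (x.length + 1)
      work := fun i => Function.update (c.work i) (c.workHead i) (r.2.2 i).1
      workHead := fun i => (r.2.2 i).2.apply (c.workHead i) }

/-- The configuration after `t` steps on the input `x`. -/
def run (M : SpaceTM A) (x : List A) (t : ℕ) : M.Cfg :=
  (M.step x)^[t] M.init

/-- On the input `x` the machine halts with the answer `b`. -/
def Answers (M : SpaceTM A) (x : List A) (b : Bool) : Prop :=
  ∃ t, M.verdict (M.run x t).state = some b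

/-- The space used on the input `x`: the number of work tape cells, on all work tapes together,
that are ever scanned. -/
noncomputable def space (M : SpaceTM A) (x : List A) : ℕ∞ :=
  {p : Fin M.tapes × ℕ | ∃ t, (M.run x t).workHead p.1 = p.2}.encard

/-- On the input `x` the machine halts, accepts if and only if `P` holds, and uses at most `s`
cells of work space. -/
def DecidesWithin (M : SpaceTM A) (x : List A) (P : Prop) (s : ℕ) : Prop :=
  (∃ b : Bool, M.Answers x b ∧ (b = true ↔ P)) ∧ M.space x ≤ (s : ℕ∞)

end SpaceTM

end Braid

/-! Writing blanks everything to the right of the head. So as long as the cells left of some cell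
are not written, they influence the computation only through a relation on states: if the head
leaves the cell to the left in state `q`, in which states can it come back? This relation is the
table of the prefix. The table of a prefix with one more symbol depends only on the table of the
prefix and on the symbol (`extend`), and there are only `2 ^ (N * N)` tables, however long the
prefix is.

Let `E X p q` say that behind a prefix with table `X`, started in state `p` on the first cell of a
blank half-tape, the head can leave this half-tape to the left in state `q`. It suffices to watch
that first cell. Its situations form a graph with `6 * S * N` nodes; the edges are instructions
executed on the cell, returns from the left according to `X`, and an excursion into the blank cells
on the right, described by `E` at the extended table. `Closed` says that `E` contains all exits
derivable in this way. After an excursion no second one is needed before the cell is written again: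
seen from the cells on the right, the intermediate visit is itself just a return from the left,
which the table of the longer prefix describes.

If the target `T` gets extra instructions that run left, reaching `T` amounts to an exit behind the
empty prefix, whose table is equality. The criterion `canReach_iff` says that `T` is reachable iff
every closed `E` contains this exit. The real exits form a closed `E` (`exits_closed`); conversely,
derivations from any closed `E` follow every computation (`Covered.step`).

A table is a number of `N * N` bits, and `E` is one of `2 ^ (N * N) * N * N` bits. The decision
procedure runs through all `E` and tests closedness by Savitch's algorithm, whose whole recursion
stack is one number with about the square of `log (S * N)` bits. The tables of extended prefixes are
tested by an inner search of the same kind. The bounds are `functions_lt` and `savitch_lt`.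

The procedure is written as a register program, with numbers kept as counters on work tapes. `Comp`
and `Dec` express computability by one program that is fixed before the instance; they are closed
under composition, loops and bounded quantifiers. Instructions are never stored but looked up by
rescanning the input, so the length of the program under study costs no space.
`decidesWithin_of_run` turns the register program into a machine. -/

namespace Braid

open Relation

/-! ### Reachability for braidlike machines through behaviour tables -/

/-- What a machine that stays on one cell and to its right looks like from that cell: the
head is on the cell (`stay`), or has just left it; `dirty` says that the tape to the right of the
cell may be nonblank. -/
structure Node (N S : ℕ) where
  place : Move
  dirty : Bool
  sym : Fin S
  state : Fin N

abbrev Table (N : ℕ) := Fin N → Fin N → Prop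

namespace BraidTM

variable {N S : ℕ}

/-- The instructions of `B`, together with instructions that let the head run left in state `T`. -/
def Can (B : BraidTM N S) (T p : Fin N) (a : Fin S) (w : Option (Fin S)) (m : Move)
    (q : Fin N) : Prop :=
  (⟨p, a, w, m, q⟩ : Instr N S) ∈ B.program ∨ (p = T ∧ w = none ∧ m = .left ∧ q = T)

/-- One step as seen from a cell, where `X` relates states in which the head leaves to the left
to states in which it returns, and `Y a` does the same on the right if the cell contains `a`. -/
inductive Edge (B : BraidTM N S) (T : Fin N) (X : Table N) (Y : Fin S → Table N) :
    Node N S → Node N S → Prop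
  -- A write makes the cells on the right blank and so clears the flag; without a write the flag is
  -- kept.
  | instr {p a w m q} (d : Bool) : B.Can T p a w m q →
      Edge B T X Y ⟨.stay, d, a, p⟩ ⟨m, d && w.isNone, w.getD a, q⟩
  | back {q q'} (d : Bool) (a : Fin S) : X q q' → Edge B T X Y ⟨.left, d, a, q⟩ ⟨.stay, d, a, q'⟩
  -- Only blank cells may be entered in this way. A node that went right with the flag set is a dead
  -- end: such a trip is accounted for at the cells on the right, as a `back` edge there.
  | excursion {a q q'} : Y a q q' → Edge B T X Y ⟨.right, false, a, q⟩ ⟨.stay, true, a, q'⟩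

/-- The table of a prefix extended by the symbol `a`. -/
def extend (B : BraidTM N S) (T : Fin N) (X : Table N) (a : Fin S) : Table N := fun q q' =>
  -- Only an excursion can set the flag. Without excursions, a path that starts and ends with the
  -- flag set contains no write, so the symbol `a` and the tape are unchanged.
  ReflTransGen (B.Edge T X fun _ _ _ => False) ⟨.stay, true, a, q⟩ ⟨.right, true, a, q'⟩

/-- `E` is closed under the derivation of new exits from the blank half-tape. -/
def Closed (B : BraidTM N S) (T : Fin N) (E : Table N → Table N) : Prop :=
  ∀ X p q d a, ReflTransGen (B.Edge T X fun a => E (B.extend T X a))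
    ⟨.stay, false, B.blank, p⟩ ⟨.left, d, a, q⟩ → E X p q

/-- The table of a prefix, given as a list with the rightmost symbol first. -/
def table (B : BraidTM N S) (T : Fin N) : List (Fin S) → Table N
  -- A head that tries to leave cell `0` to the left stays there, in the state it has entered.
  | [] => Eq
  | a :: w => B.extend T (B.table T w) a

/-- The first `k` cells of a tape, rightmost first. -/
def cells (t : ℕ → Fin S) : ℕ → List (Fin S)
  | 0 => []
  | k + 1 => t k :: cells t k

theorem cells_congr {t t' : ℕ → Fin S} : ∀ {k : ℕ}, (∀ j < k, t j = t' j) → cells t k = cells t' k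
  | 0, _ => rfl
  | k + 1, h => by
    simp only [cells, h k (Nat.lt_succ_self k)]
    rw [cells_congr fun j hj => h j (Nat.lt_succ_of_lt hj)]

/-- Steps of the machine with the additional instructions. -/
def StepCan (B : BraidTM N S) (T : Fin N) (c c' : Cfg N S) : Prop :=
  ∃ w m q, B.Can T c.state (c.tape c.head) w m q ∧
    c' = ⟨q, B.writeTape c.tape c.head w, m.apply c.head⟩

/-- The additional instructions apply only in state `T`, so a computation that uses one of them has
already reached `T` by genuine steps. -/
theorem canReach_of_stepCan {B : BraidTM N S} {T : Fin N} {c : Cfg N S}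
    (h : ReflTransGen (B.StepCan T) B.init c) (hc : c.state = T) : B.CanReach T := by
  have key : ReflTransGen B.Step B.init c ∨ B.CanReach T := by
    clear hc
    induction h with
    | refl => exact Or.inl .refl
    | @tail b c _ hbc ih =>
      rcases ih with ih | ih
      · obtain ⟨w, m, q, hcan, rfl⟩ := hbc
        rcases hcan with hi | ⟨hp, -⟩
        · exact Or.inl (ih.tail ⟨_, hi, rfl, rfl, rfl⟩)
        · exact Or.inr ⟨b, ih, hp⟩
      · exact Or.inr ih
  rcases key with h | h
  · exact ⟨c, h, hc⟩
  · exact h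

theorem Edge.mono {B : BraidTM N S} {T : Fin N} {X : Table N} {Y Y' : Fin S → Table N}
    (h : ∀ a q q', Y a q q' → Y' a q q') {u v : Node N S} (huv : B.Edge T X Y u v) :
    B.Edge T X Y' u v := by
  cases huv with
  | instr d h' => exact .instr d h'
  | back d a h' => exact .back d a h'
  | excursion h' => exact .excursion (h _ _ _ h')

/-! #### Derivations from a closed relation cover all computations -/

/-- The situations at the cell after the prefix `w` that are derivable from `E`. -/
inductive Derivable (B : BraidTM N S) (T : Fin N) (E : Table N → Table N) :
    List (Fin S) → Node N S → Prop
  | start : Derivable B T E [] ⟨.stay, false, B.blank, B.start⟩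
  | enter {w a q} : Derivable B T E w ⟨.right, false, a, q⟩ →
      Derivable B T E (a :: w) ⟨.stay, false, B.blank, q⟩
  | edge {w u v} : Derivable B T E w u →
      B.Edge T (B.table T w) (fun a => E (B.extend T (B.table T w) a)) u v → Derivable B T E w v

theorem Derivable.trans {B : BraidTM N S} {T : Fin N} {E : Table N → Table N} {w : List (Fin S)}
    {u v : Node N S} (hu : B.Derivable T E w u)
    (h : ReflTransGen (B.Edge T (B.table T w) fun _ _ _ => False) u v) : B.Derivable T E w v := by
  induction h with
  | refl => exact hu
  | tail _ h ih => exact ih.edge (h.mono fun _ _ _ h => h.elim)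

theorem Derivable.nil {B : BraidTM N S} {T : Fin N} {E : Table N → Table N} {u : Node N S}
    (h : B.Derivable T E [] u) :
    ReflTransGen (B.Edge T Eq fun a => E (B.extend T Eq a)) ⟨.stay, false, B.blank, B.start⟩ u := by
  generalize hw : ([] : List (Fin S)) = w at h
  induction h with
  | start => exact .refl
  | enter => cases hw
  | edge _ h ih => subst hw; exact (ih rfl).tail h

/-- Only the rule `enter` lengthens the prefix. A derivation behind `a :: w` therefore splits at the
entry, and its second half is a path from a blank cell, as in the definition of `Closed`. -/
theorem Derivable.cons {B : BraidTM N S} {T : Fin N} {E : Table N → Table N} {w : List (Fin S)}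
    {a : Fin S} {u : Node N S} (h : B.Derivable T E (a :: w) u) :
    ∃ p, B.Derivable T E w ⟨.right, false, a, p⟩ ∧
      ReflTransGen (B.Edge T (B.table T (a :: w)) fun b => E (B.extend T (B.table T (a :: w)) b))
        ⟨.stay, false, B.blank, p⟩ u := by
  generalize hw : a :: w = w' at h
  induction h with
  | start => cases hw
  | enter h => cases hw; exact ⟨_, h, .refl⟩
  | edge _ h ih =>
    subst hw
    obtain ⟨p, hp, hr⟩ := ih rfl
    exact ⟨p, hp, hr.tail h⟩

/-- Closedness puts the whole stay behind `a :: w`, from the entry to the exit on the left, into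
`E`; one level below it becomes a single `excursion` edge. -/
theorem Derivable.exit {B : BraidTM N S} {T : Fin N} {E : Table N → Table N} (hE : B.Closed T E)
    {w : List (Fin S)} {a b : Fin S} {d : Bool} {q : Fin N}
    (h : B.Derivable T E (a :: w) ⟨.left, d, b, q⟩) : B.Derivable T E w ⟨.stay, true, a, q⟩ := by
  obtain ⟨p, hp, hr⟩ := h.cons
  exact hp.edge (.excursion (hE _ _ _ _ _ hr))

/-- The additional instructions carry `T` to the left cell by cell, with one application of
`Derivable.exit` per cell, until the head leaves the empty prefix. -/
theorem Derivable.closed_target {B : BraidTM N S} {T : Fin N} {E : Table N → Table N}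
    (hE : B.Closed T E) : ∀ {w : List (Fin S)} {a : Fin S} {d : Bool},
    B.Derivable T E w ⟨.stay, d, a, T⟩ → E Eq B.start T
  | [], a, d, h => by
    have h' := h.edge (.instr (w := none) d (Or.inr ⟨rfl, rfl, rfl, rfl⟩))
    exact hE _ _ _ _ _ h'.nil
  | b :: w, a, d, h => by
    have h' := h.edge (.instr (w := none) d (Or.inr ⟨rfl, rfl, rfl, rfl⟩))
    exact Derivable.closed_target hE (Derivable.exit hE h')

/-- Where the head went from cell `k` when it is now on cell `h ≤ k`. -/
def placeAt (h k : ℕ) : Move := if k = h then .stay else .left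

theorem placeAt_self (h : ℕ) : placeAt h h = .stay := if_pos rfl

theorem placeAt_of_ne {h k : ℕ} (hk : k ≠ h) : placeAt h k = .left := if_neg hk

/-- The invariant of computations: `H` is the last cell visited since the last write, and `f k`
is the state in which the head last left cell `k` (for `k` right of the head). -/
def Covered (B : BraidTM N S) (T : Fin N) (E : Table N → Table N) (p : Fin N) (t : ℕ → Fin S)
    (h : ℕ) : Prop :=
  ∃ (H : ℕ) (f : ℕ → Fin N), h ≤ H ∧ (∀ j, H < j → t j = B.blank) ∧
    B.Derivable T E (cells t H) ⟨placeAt h H, false, t H, f H⟩ ∧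
    (∀ k, h ≤ k → k < H →
      ReflTransGen (B.Edge T (B.table T (cells t k)) fun _ _ _ => False)
        ⟨.stay, true, t k, f (k + 1)⟩ ⟨placeAt h k, true, t k, f k⟩) ∧
    f h = p

/-- Descend from `H` to the head: at each cell the exit from the right neighbour becomes an
excursion, and the recorded path without writes continues it to the next exit. This is where the
guessed last exits `f k` become final. -/
theorem Covered.derivable {B : BraidTM N S} {T : Fin N} {E : Table N → Table N}
    (hE : B.Closed T E) {p : Fin N} {t : ℕ → Fin S} {h : ℕ} (hc : B.Covered T E p t h) :
    ∃ d, B.Derivable T E (cells t h) ⟨.stay, d, t h, p⟩ := by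
  obtain ⟨H, f, hH, -, hder, hchain, hf⟩ := hc
  have key : ∀ i, ∀ k, h ≤ k → k + i = H →
      ∃ d, B.Derivable T E (cells t k) ⟨placeAt h k, d, t k, f k⟩ := by
    intro i
    induction i with
    | zero => intro k _ hk; obtain rfl : k = H := by omega
              exact ⟨_, hder⟩
    | succ i ih =>
      intro k hk hki
      obtain ⟨d, hd⟩ := ih (k + 1) (by omega) (by omega)
      rw [placeAt_of_ne (by omega)] at hd
      exact ⟨true, (Derivable.exit hE hd).trans (hchain k hk (by omega))⟩
  obtain ⟨d, hd⟩ := key (H - h) h le_rfl (by omega)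
  rw [placeAt_self, hf] at hd
  exact ⟨d, hd⟩

theorem Covered.of_derivable {B : BraidTM N S} {T : Fin N} {E : Table N → Table N}
    {t : ℕ → Fin S} {h : ℕ} {q : Fin N} (ht : ∀ j, h < j → t j = B.blank)
    (hd : B.Derivable T E (cells t h) ⟨.stay, false, t h, q⟩) : B.Covered T E q t h :=
  ⟨h, fun _ => q, le_rfl, ht, by rwa [placeAt_self], fun k h₁ h₂ => absurd h₁ (not_le.2 h₂), rfl⟩

/-- With a blank tape beyond the cell, the invariant restarts with `H` at the cell or, after a move
to the right, at its blank neighbour. -/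
theorem Covered.write {B : BraidTM N S} {T : Fin N} {E : Table N → Table N}
    {t : ℕ → Fin S} {h : ℕ} {q : Fin N} {m : Move} (ht : ∀ j, h < j → t j = B.blank)
    (hd : B.Derivable T E (cells t h) ⟨m, false, t h, q⟩) : B.Covered T E q t (m.apply h) := by
  cases m with
  | stay => exact .of_derivable ht hd
  | right =>
    refine .of_derivable (fun j hj => ht j (by simp only [Move.apply] at hj; omega)) ?_
    simp only [Move.apply, cells]
    rw [ht (h + 1) (Nat.lt_succ_self h)]
    exact hd.enter
  | left =>
    rcases Nat.eq_zero_or_pos h with rfl | hpos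
    · exact .of_derivable ht (hd.edge (.back _ _ rfl))
    · refine ⟨h, fun _ => q, Nat.sub_le h 1, ht, ?_, ?_, rfl⟩
      · rwa [Move.apply, placeAt_of_ne (by omega)]
      · intro k h₁ h₂
        simp only [Move.apply] at h₁ ⊢
        obtain rfl : k = h - 1 := by omega
        rw [placeAt_self]

/-- A write makes the last exits on the right definitive. Without a write, the last exits can still
be revised: a return to a cell on the right replaces the exit recorded there by a longer path. -/
theorem Covered.step {B : BraidTM N S} {T : Fin N} {E : Table N → Table N}
    (hE : B.Closed T E) {p q : Fin N} {t : ℕ → Fin S} {n : ℕ} {w : Option (Fin S)} {m : Move}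
    (h : B.Covered T E p t n) (hcan : B.Can T p (t n) w m q) :
    B.Covered T E q (B.writeTape t n w) (m.apply n) := by
  cases w with
  | some b =>
    obtain ⟨d, hd⟩ := h.derivable hE
    have hd' := hd.edge (.instr d hcan)
    refine Covered.write ?_ ?_
    · intro j hj
      simp [writeTape, show ¬ j < n by omega, show j ≠ n by omega]
    · rw [cells_congr (t' := t) (fun j hj => by simp [writeTape, hj])]
      simpa [writeTape] using hd'
  | none =>
    obtain ⟨H, f, hH, hblank, hder, hchain, hf⟩ := h
    -- Nothing is written. On the cell `H` the right side is blank, as after a write; left of `H`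
    -- the recorded path on the current cell is prolonged.
    simp only [writeTape] at *
    by_cases hnH : n = H
    · subst hnH
      refine Covered.write hblank ?_
      rw [placeAt_self, hf] at hder
      simpa using hder.edge (.instr false hcan)
    have hnH' : n < H := by omega
    have hn := hchain n le_rfl hnH'
    rw [placeAt_self, hf] at hn
    have hn' := hn.tail (.instr true hcan)
    simp only [Option.isNone_none, Bool.and_self, Option.getD_none] at hn'
    rw [placeAt_of_ne (by omega)] at hder
    have upd : ∀ r : Fin N,
        ReflTransGen (B.Edge T (B.table T (cells t n)) fun _ _ _ => False)
          ⟨.stay, true, t n, f (n + 1)⟩ ⟨.stay, true, t n, r⟩ → B.Covered T E r t n := by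
      intro r hr
      refine ⟨H, Function.update f n r, hH, hblank, ?_, ?_, by simp⟩
      · rwa [placeAt_of_ne (by omega), Function.update_of_ne (by omega)]
      · intro k h₁ h₂
        rw [Function.update_of_ne (show k + 1 ≠ n by omega)]
        by_cases hk : k = n
        · subst hk; rwa [Function.update_self, placeAt_self]
        · rw [Function.update_of_ne hk]
          exact hchain k h₁ h₂
    cases m with
    | stay => exact upd q hn'
    | right =>
      -- The head left cell `n + 1` in state `f (n + 1)` and now returns in state `q`, with no write
      -- in between: this is precisely an entry of the table of the prefix, and it serves as a
      -- `back` edge on cell `n + 1`.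
      have htab : B.table T (cells t (n + 1)) (f (n + 1)) q := hn'
      refine ⟨H, Function.update f (n + 1) q, hnH', hblank, ?_, ?_, by simp [Move.apply]⟩
      · simp only [Move.apply]
        by_cases hk : H = n + 1
        · subst hk
          rw [placeAt_self, Function.update_self]
          exact hder.edge (.back _ _ htab)
        · rwa [placeAt_of_ne hk, Function.update_of_ne hk]
      · intro k h₁ h₂
        simp only [Move.apply] at h₁ ⊢
        have hc := hchain k (by omega) h₂
        rw [placeAt_of_ne (by omega)] at hc
        rw [Function.update_of_ne (show k + 1 ≠ n + 1 by omega)]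
        by_cases hk : k = n + 1
        · subst hk
          rw [placeAt_self, Function.update_self]
          exact hc.tail (.back _ _ htab)
        · rwa [placeAt_of_ne hk, Function.update_of_ne hk]
    | left =>
      rcases Nat.eq_zero_or_pos n with rfl | hpos
      -- On cell `0` the attempted move to the left is undone by the reflexive table of the empty
      -- prefix.
      · exact upd q (hn'.tail (.back _ _ (show (B.table T (cells t 0)) q q from rfl)))
      · refine ⟨H, Function.update (Function.update f n q) (n - 1) q,
          by simp only [Move.apply]; omega, hblank, ?_, ?_, by simp [Move.apply]⟩
        · simp only [Move.apply]
          rwa [placeAt_of_ne (by omega), Function.update_of_ne (by omega),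
            Function.update_of_ne (by omega)]
        · intro k h₁ h₂
          simp only [Move.apply] at h₁ ⊢
          rw [Function.update_of_ne (show k + 1 ≠ n - 1 by omega)]
          by_cases hk : k = n - 1
          · subst hk
            rw [Function.update_self, placeAt_self, Nat.sub_add_cancel hpos, Function.update_self]
          · rw [placeAt_of_ne hk, Function.update_of_ne hk,
              Function.update_of_ne (show k + 1 ≠ n by omega)]
            by_cases hk' : k = n
            · subst hk'
              rwa [Function.update_self]
            · rw [Function.update_of_ne hk']
              have := hchain k (by omega) h₂
              rwa [placeAt_of_ne hk'] at this

/-! #### The behaviour of the machine itself is closed -/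

theorem StepCan.of_can {B : BraidTM N S} {T p q : Fin N} {t : ℕ → Fin S} {h : ℕ}
    {w : Option (Fin S)} {m : Move} (hc : B.Can T p (t h) w m q) :
    B.StepCan T ⟨p, t, h⟩ ⟨q, B.writeTape t h w, m.apply h⟩ :=
  ⟨w, m, q, hc, rfl⟩

/-- A path in `extend` that keeps the flag set executes only instructions without a write, hence it
is a computation on the fixed tape `t`. For `k = 0` the truncated `k - 1` is the cell where a move
to the left really ends. -/
theorem table_sound {B : BraidTM N S} {T : Fin N} (t : ℕ → Fin S) : ∀ (k : ℕ) {q q' : Fin N},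
    B.table T (cells t k) q q' → ReflTransGen (B.StepCan T) ⟨q, t, k - 1⟩ ⟨q', t, k⟩
  | 0, q, q', h => by
    obtain rfl : q = q' := h
    exact .refl
  | k + 1, q, q', h => by
    have key : ∀ v : Node N S, ReflTransGen (B.Edge T (B.table T (cells t k)) fun _ _ _ => False)
        ⟨.stay, true, t k, q⟩ v → v.dirty = true →
        v.sym = t k ∧ ReflTransGen (B.StepCan T) ⟨q, t, k⟩ ⟨v.state, t, v.place.apply k⟩ := by
      intro v hv
      induction hv with
      | refl => exact fun _ => ⟨rfl, .refl⟩
      | tail _ he ih =>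
        intro hd
        cases he with
        | @instr p a w m q d hcan =>
          simp only [Bool.and_eq_true] at hd
          obtain ⟨rfl, hw⟩ := hd
          obtain rfl : w = none := by simpa using hw
          obtain ⟨rfl, hr⟩ := ih rfl
          exact ⟨rfl, hr.tail (.of_can hcan)⟩
        | back d a hX =>
          obtain ⟨h₁, hr⟩ := ih hd
          exact ⟨h₁, hr.trans (table_sound t k hX)⟩
        | excursion h => exact h.elim
    exact (key _ h rfl).2

/-- The exits of the machine from a blank half-tape, after any prefix with the given table. -/
def Exits (B : BraidTM N S) (T : Fin N) (X : Table N) (p q : Fin N) : Prop :=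
  ∀ (t : ℕ → Fin S) (k : ℕ), B.table T (cells t k) = X → (∀ j, k ≤ j → t j = B.blank) →
    ∃ t' : ℕ → Fin S, (∀ j < k, t' j = t j) ∧
      ReflTransGen (B.StepCan T) ⟨p, t, k⟩ ⟨q, t', k - 1⟩

/-- Every edge is realised by a computation: `back` by `table_sound`, and `excursion` by the
definition of `Exits` one cell further, which applies because an unset flag guarantees blanks there.
`Exits` quantifies over all prefixes with the given table, so the actual prefix can be inserted. -/
theorem exits_closed (B : BraidTM N S) (T : Fin N) : B.Closed T (B.Exits T) := by
  intro X p q d a h t k hX hblank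
  have key : ∀ v : Node N S,
      ReflTransGen (B.Edge T X fun a => B.Exits T (B.extend T X a)) ⟨.stay, false, B.blank, p⟩ v →
      ∃ t' : ℕ → Fin S, (∀ j < k, t' j = t j) ∧ t' k = v.sym ∧
        (v.dirty = false → ∀ j, k < j → t' j = B.blank) ∧
        ReflTransGen (B.StepCan T) ⟨p, t, k⟩ ⟨v.state, t', v.place.apply k⟩ := by
    intro v hv
    induction hv with
    | refl => exact ⟨t, fun _ _ => rfl, hblank k le_rfl, fun _ j hj => hblank j hj.le, .refl⟩
    | tail _ he ih =>
      obtain ⟨t', hpre, hsym, hclean, hr⟩ := ih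
      cases he with
      | @instr p a w m q d hcan =>
        simp only at hsym
        subst hsym
        refine ⟨B.writeTape t' k w, ?_, ?_, ?_, hr.tail (.of_can hcan)⟩
        · intro j hj
          cases w <;> simp [writeTape, hj, hpre j hj]
        · cases w <;> simp [writeTape]
        · intro hd j hj
          cases w with
          | none => exact hclean (by simpa using hd) j hj
          | some b => simp [writeTape, show ¬ j < k by omega, show j ≠ k by omega]
      | back d a h =>
        refine ⟨t', hpre, hsym, hclean, hr.trans ?_⟩
        refine table_sound t' k ?_
        rwa [cells_congr hpre, hX]
      | @excursion a q q' h =>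
        simp only at hsym
        obtain ⟨t'', hpre', hr'⟩ := h t' (k + 1)
          (by simp only [cells, table]; rw [cells_congr hpre, hX, hsym])
          (fun j hj => hclean rfl j hj)
        refine ⟨t'', fun j hj => (hpre' j (by omega)).trans (hpre j hj),
          (hpre' k (by omega)).trans hsym, by simp, hr.trans hr'⟩
  obtain ⟨t', hpre, -, -, hr⟩ := key _ h
  exact ⟨t', hpre, hr⟩

/-- From left to right, the computation is covered by derivations from `E`, and `T` is carried out
at the left end. From right to left, the hypothesis is applied to the real exits of the machine. -/
theorem canReach_iff (B : BraidTM N S) (T : Fin N) :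
    B.CanReach T ↔ ∀ E : Table N → Table N, B.Closed T E → E Eq B.start T := by
  constructor
  · rintro ⟨c, hc, hT⟩ E hE
    have hcov : B.Covered T E c.state c.tape c.head := by
      clear hT
      induction hc with
      | refl => exact .of_derivable (fun _ _ => rfl) .start
      | tail _ hs ih =>
        obtain ⟨⟨p, a, w, m, q⟩, hi, rfl, rfl, rfl⟩ := hs
        exact ih.step hE (Or.inl hi)
    obtain ⟨d, hd⟩ := hcov.derivable hE
    rw [hT] at hd
    exact hd.closed_target hE
  · intro h
    obtain ⟨t', -, hr⟩ := h _ (B.exits_closed T) (fun _ => B.blank) 0 rfl fun _ _ => rfl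
    exact canReach_of_stepCan hr rfl

end BraidTM

end Braid

namespace Braid

open Relation

/-! ### Structured programs for machines with a read-only input tape -/

/-- Work symbols: blanks and the digits of bijective binary notation. -/
inductive Digit where
  | blank
  | one
  | two
  deriving DecidableEq

instance : Finite Digit :=
  Finite.of_injective (fun d => match d with
    | .blank => (0 : Fin 3)
    | .one => 1
    | .two => 2) (by intro a b; cases a <;> cases b <;> simp)

/-- The contents and heads of the tapes (work tapes are numbered by all natural numbers). -/
@[ext] structure Store where
  pos : ℕ
  work : ℕ → ℕ → Digit
  head : ℕ → ℕ

/-- An action on one work tape and the input head. -/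
structure Action where
  tape : ℕ
  write : Digit → Digit
  move : Move
  input : Move

def Action.idle : Action := ⟨0, id, .stay, .stay⟩

/-- The effect of an action, on an input of length `n`. -/
def Store.act (c : Store) (n : ℕ) (e : Action) : Store where
  pos := min (e.input.apply c.pos) (n + 1)
  work := Function.update c.work e.tape
    (Function.update (c.work e.tape) (c.head e.tape) (e.write (c.work e.tape (c.head e.tape))))
  head := Function.update c.head e.tape (e.move.apply (c.head e.tape))

/-- The scanned symbol of a work tape. -/
def Store.scan (c : Store) (i : ℕ) : Digit := c.work i (c.head i)

/-- Structured programs. Tests look at one work tape and at the input. -/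
inductive Prog where
  | act (e : Action)
  | seq (p q : Prog)
  | ite (i : ℕ) (b : InputCell Sym → Digit → Bool) (p q : Prog)
  | loop (i : ℕ) (b : InputCell Sym → Digit → Bool) (p : Prog)

/-- Big-step semantics on the input `x`, with all work heads staying in the cells `0, …, L`. -/
inductive Run (x : List Sym) (L : ℕ) : Prog → Store → Store → Prop
  | act {e c} : e.move.apply (c.head e.tape) ≤ L → Run x L (.act e) c (c.act x.length e)
  | seq {p q c c' c''} : Run x L p c c' → Run x L q c' c'' → Run x L (.seq p q) c c''
  | ite_true {i b p q c c'} : b (readInput x c.pos) (c.scan i) = true → Run x L p c c' →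
      Run x L (.ite i b p q) c c'
  | ite_false {i b p q c c'} : b (readInput x c.pos) (c.scan i) = false → Run x L q c c' →
      Run x L (.ite i b p q) c c'
  | loop_false {i b p c} : b (readInput x c.pos) (c.scan i) = false → Run x L (.loop i b p) c c
  | loop_true {i b p c c' c''} : b (readInput x c.pos) (c.scan i) = true → Run x L p c c' →
      Run x L (.loop i b p) c' c'' → Run x L (.loop i b p) c c''

namespace Prog

/-- Control points of a program. -/
def Loc : Prog → Type
  | act _ => Unit
  | seq p q => p.Loc ⊕ q.Loc
  | ite _ _ p q => Option (p.Loc ⊕ q.Loc)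
  | loop _ _ p => Option p.Loc

instance finite_loc : ∀ P : Prog, Finite P.Loc
  | act _ => inferInstanceAs (Finite Unit)
  | seq p q => have := finite_loc p; have := finite_loc q; inferInstanceAs (Finite (p.Loc ⊕ q.Loc))
  | ite _ _ p q =>
    have := finite_loc p; have := finite_loc q; inferInstanceAs (Finite (Option (p.Loc ⊕ q.Loc)))
  | loop _ _ p => have := finite_loc p; inferInstanceAs (Finite (Option p.Loc))

def entry : ∀ P : Prog, P.Loc
  | act _ => ()
  | seq p _ => .inl p.entry
  | ite _ _ _ _ => none
  | loop _ _ _ => none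

/-- The next control point (`none`: the program ends) and the action, depending on the scanned
symbols. -/
def next : ∀ P : Prog, P.Loc → InputCell Sym → (ℕ → Digit) → Option P.Loc × Action
  | act e, _, _, _ => (none, e)
  | seq p q, .inl l, y, v => (some (((p.next l y v).1.map .inl).getD (.inr q.entry)), (p.next l y v).2)
  | seq _ q, .inr l, y, v => ((q.next l y v).1.map .inr, (q.next l y v).2)
  | ite i b p q, none, y, v =>
    (some (some (if b y (v i) then .inl p.entry else .inr q.entry)), .idle)
  | ite _ _ p _, some (.inl l), y, v => ((p.next l y v).1.map (some ∘ .inl), (p.next l y v).2)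
  | ite _ _ _ q, some (.inr l), y, v => ((q.next l y v).1.map (some ∘ .inr), (q.next l y v).2)
  | loop i b p, none, y, v => (if b y (v i) then some (some p.entry) else none, .idle)
  | loop _ _ p, some l, y, v => (some (p.next l y v).1, (p.next l y v).2)

/-- All work tapes used have numbers below `K`. -/
def Below (K : ℕ) : Prog → Prop
  | act e => e.tape < K
  | seq p q => p.Below K ∧ q.Below K
  | ite i _ p q => i < K ∧ p.Below K ∧ q.Below K
  | loop i _ p => i < K ∧ p.Below K

theorem Below.mono {K K' : ℕ} (h : K ≤ K') : ∀ {P : Prog}, P.Below K → P.Below K'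
  | act _, hP => lt_of_lt_of_le hP h
  | seq _ _, hP => ⟨hP.1.mono h, hP.2.mono h⟩
  | ite _ _ _ _, hP => ⟨lt_of_lt_of_le hP.1 h, hP.2.1.mono h, hP.2.2.mono h⟩
  | loop _ _ _, hP => ⟨lt_of_lt_of_le hP.1 h, hP.2.mono h⟩

theorem exists_below : ∀ P : Prog, ∃ K, 0 < K ∧ P.Below K
  | act e => ⟨e.tape + 1, Nat.succ_pos _, Nat.lt_succ_self _⟩
  | seq p q =>
    have ⟨K, h, hp⟩ := p.exists_below
    have ⟨K', _, hq⟩ := q.exists_below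
    ⟨max K K', by omega, hp.mono (le_max_left _ _), hq.mono (le_max_right _ _)⟩
  | ite i _ p q =>
    have ⟨K, h, hp⟩ := p.exists_below
    have ⟨K', _, hq⟩ := q.exists_below
    ⟨max (i + 1) (max K K'), by omega, by omega, hp.mono (by omega), hq.mono (by omega)⟩
  | loop i _ p =>
    have ⟨K, h, hp⟩ := p.exists_below
    ⟨max (i + 1) K, by omega, by omega, hp.mono (by omega)⟩

/-- Configurations of a program: control point and store. -/
abbrev Config (P : Prog) := Option P.Loc × Store

/-- One step of a program, with the work heads staying in the cells `0, …, L`. -/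
def Steps (x : List Sym) (L : ℕ) (P : Prog) (s s' : P.Config) : Prop :=
  ∃ l, s.1 = some l ∧
    let r := P.next l (readInput x s.2.pos) s.2.scan
    s' = (r.1, s.2.act x.length r.2) ∧
      -- Tests perform the idle action, for which `Run` provides no bound; it moves no work head, so
      -- an existing bound persists.
      (r.2.move.apply (s.2.head r.2.tape) ≤ L ∨ r.2 = .idle)

theorem Steps.mk {x : List Sym} {L : ℕ} {P : Prog} {l : P.Loc} {c : Store} {o : Option P.Loc}
    {e : Action} (h : P.next l (readInput x c.pos) c.scan = (o, e))
    (hL : e.move.apply (c.head e.tape) ≤ L ∨ e = .idle) :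
    P.Steps x L (some l, c) (o, c.act x.length e) :=
  ⟨l, rfl, by simp only [h], by simpa only [h] using hL⟩

theorem _root_.Braid.Store.act_idle {c : Store} {n : ℕ} (h : c.pos ≤ n + 1) :
    c.act n .idle = c := by
  ext <;> simp [Store.act, Action.idle, Move.apply, h]

theorem _root_.Braid.Run.pos_le {x : List Sym} {L : ℕ} {P : Prog} {c c' : Store}
    (h : Run x L P c c') (hc : c.pos ≤ x.length + 1) : c'.pos ≤ x.length + 1 := by
  induction h with
  | act => exact min_le_right _ _
  | seq _ _ ih₁ ih₂ => exact ih₂ (ih₁ hc)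
  | ite_true _ _ ih => exact ih hc
  | ite_false _ _ ih => exact ih hc
  | loop_false => exact hc
  | loop_true _ _ _ ih₁ ih₂ => exact ih₂ (ih₁ hc)

/-- Transport of computations of a part of a program. -/
theorem steps_lift {x : List Sym} {L : ℕ} {p P : Prog} (g : Option p.Loc → Option P.Loc)
    (hg : ∀ l y v, ∃ l', g (some l) = some l' ∧
      P.next l' y v = (g (p.next l y v).1, (p.next l y v).2)) {s s' : p.Config}
    (h : ReflTransGen (p.Steps x L) s s') :
    ReflTransGen (P.Steps x L) (g s.1, s.2) (g s'.1, s'.2) := by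
  refine ReflTransGen.lift (r := p.Steps x L) (fun s : p.Config => ((g s.1, s.2) : P.Config)) ?_ _ _ h
  rintro ⟨_, c⟩ _ ⟨l, rfl, rfl, hL⟩
  obtain ⟨l', h₁, h₂⟩ := hg l (readInput x c.pos) c.scan
  simp only at hL
  simp only [Function.onFun, h₁]
  exact Steps.mk h₂ hL

/-- Structural induction: the steps of a part are transported by `steps_lift`, which redirects the
end of the part to the control point that follows it. -/
theorem _root_.Braid.Run.steps {x : List Sym} {L : ℕ} {P : Prog} {c c' : Store}
    (h : Run x L P c c') (hc : c.pos ≤ x.length + 1) :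
    ReflTransGen (P.Steps x L) (some P.entry, c) (none, c') := by
  induction h with
  | act h => exact .single (Steps.mk rfl (Or.inl h))
  | @seq p q c c' c'' h₁ _ ih₁ ih₂ =>
    have h₁' := steps_lift (P := seq p q)
      (fun o => some ((o.map Sum.inl).getD (Sum.inr q.entry)))
      (fun l y v => ⟨.inl l, rfl, rfl⟩) (ih₁ hc)
    have h₂' := steps_lift (P := seq p q) (fun o => o.map Sum.inr)
      (fun l y v => ⟨.inr l, rfl, rfl⟩) (ih₂ (h₁.pos_le hc))
    exact h₁'.trans h₂'
  | @ite_true i b p q c c' hb _ ih =>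
    have h₁ := Steps.mk (L := L) (P := ite i b p q) (l := none) (c := c) (x := x)
      (o := some (some (.inl p.entry))) (e := .idle) (by simp [next, hb]) (Or.inr rfl)
    rw [Store.act_idle hc] at h₁
    exact .head h₁ (steps_lift (P := ite i b p q) (fun o => o.map (some ∘ Sum.inl))
      (fun l y v => ⟨some (.inl l), rfl, rfl⟩) (ih hc))
  | @ite_false i b p q c c' hb _ ih =>
    have h₁ := Steps.mk (L := L) (P := ite i b p q) (l := none) (c := c) (x := x)
      (o := some (some (.inr q.entry))) (e := .idle) (by simp [next, hb]) (Or.inr rfl)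
    rw [Store.act_idle hc] at h₁
    exact .head h₁ (steps_lift (P := ite i b p q) (fun o => o.map (some ∘ Sum.inr))
      (fun l y v => ⟨some (.inr l), rfl, rfl⟩) (ih hc))
  | @loop_false i b p c hb =>
    have h₁ := Steps.mk (L := L) (P := loop i b p) (l := none) (c := c) (x := x)
      (o := none) (e := .idle) (by simp [next, hb]) (Or.inr rfl)
    rw [Store.act_idle hc] at h₁
    exact .single h₁
  | @loop_true i b p c c' c'' hb h _ ih₁ ih₂ =>
    have h₁ := Steps.mk (L := L) (P := loop i b p) (l := none) (c := c) (x := x)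
      (o := some (some p.entry)) (e := .idle) (by simp [next, hb]) (Or.inr rfl)
    rw [Store.act_idle hc] at h₁
    exact .head h₁ ((steps_lift (P := loop i b p) some
      (fun l y v => ⟨some l, rfl, rfl⟩) (ih₁ hc)).trans (ih₂ (h.pos_le hc)))

/-- The machine that runs `P` on `K` work tapes and then accepts if the scanned cell of tape `0`
is not blank. -/
def toSpaceTM (P : Prog) (K : ℕ) : SpaceTM Sym where
  State := Option P.Loc ⊕ Bool
  finite_state := inferInstance
  WorkSym := Digit
  finite_workSym := inferInstance
  tapes := K
  start := .inl (some P.entry)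
  blank := .blank
  verdict
    | .inl _ => none
    | .inr b => some b
  trans
    | .inl (some l), y, v =>
      let r := P.next l y fun i => if h : i < K then v ⟨i, h⟩ else .blank
      (.inl r.1, r.2.input, fun i => if (i : ℕ) = r.2.tape then (r.2.write (v i), r.2.move)
        else (v i, .stay))
    | .inl none, _, v => (.inr (if h : 0 < K then v ⟨0, h⟩ ≠ .blank else false), .stay,
        fun i => (v i, .stay))
    | .inr b, _, v => (.inr b, .stay, fun i => (v i, .stay))

def toCfg (P : Prog) (K : ℕ) (o : Option P.Loc ⊕ Bool) (c : Store) : (P.toSpaceTM K).Cfg where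
  state := o
  inputHead := c.pos
  work := fun i => c.work i
  workHead := fun i => c.head i

theorem next_congr {K : ℕ} {y : InputCell Sym} {v v' : ℕ → Digit} (h : ∀ i < K, v i = v' i) :
    ∀ {P : Prog}, P.Below K → ∀ l : P.Loc, P.next l y v = P.next l y v'
  | act _, _, _ => rfl
  | seq _ _, hP, .inl l => by simp only [next, next_congr h hP.1 l]
  | seq _ _, hP, .inr l => by simp only [next, next_congr h hP.2 l]
  | ite i _ _ _, hP, none => by simp only [next, h i hP.1]
  | ite _ _ _ _, hP, some (.inl l) => by simp only [next, next_congr h hP.2.1 l]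
  | ite _ _ _ _, hP, some (.inr l) => by simp only [next, next_congr h hP.2.2 l]
  | loop i _ _, hP, none => by simp only [next, h i hP.1]
  | loop _ _ _, hP, some l => by simp only [next, next_congr h hP.2 l]

theorem step_toCfg {x : List Sym} {L K : ℕ} {P : Prog} (hP : P.Below K) {s s' : P.Config}
    (h : P.Steps x L s s') :
    (P.toSpaceTM K).step x (P.toCfg K (.inl s.1) s.2) = P.toCfg K (.inl s'.1) s'.2 := by
  obtain ⟨o, c⟩ := s
  obtain ⟨l, rfl, rfl, -⟩ := h
  have hn : P.next l (readInput x c.pos) (fun i => if i < K then c.work i (c.head i) else .blank) =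
      P.next l (readInput x c.pos) c.scan :=
    next_congr (fun i hi => by simp [hi, Store.scan]) hP l
  simp only [SpaceTM.step, toCfg, toSpaceTM, dite_eq_ite, hn, SpaceTM.Cfg.mk.injEq, true_and]
  refine ⟨rfl, ?_, ?_⟩
  · funext i
    by_cases hi : (i : ℕ) = (P.next l (readInput x c.pos) c.scan).2.tape
    · simp [Store.act, ← hi]
    · simp [Store.act, hi]
  · funext i
    by_cases hi : (i : ℕ) = (P.next l (readInput x c.pos) c.scan).2.tape
    · simp [Store.act, ← hi]
    · simp [Store.act, hi, Move.apply]

theorem steps_head_le {x : List Sym} {L : ℕ} {P : Prog} {s s' : P.Config}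
    (h : P.Steps x L s s') (hL : ∀ i, s.2.head i ≤ L) : ∀ i, s'.2.head i ≤ L := by
  obtain ⟨l, -, rfl, h⟩ := h
  intro i
  simp only [Store.act]
  by_cases hi : i = (P.next l (readInput x s.2.pos) s.2.scan).2.tape
  · subst hi
    rw [Function.update_self]
    rcases h with h | h
    · exact h
    · rw [h]; exact hL _
  · rw [Function.update_of_ne hi]; exact hL i

/-- The initial store. -/
def _root_.Braid.Store.empty : Store := ⟨0, fun _ _ => .blank, fun _ => 0⟩

theorem _root_.Braid.SpaceTM.run_add {A : Type} (M : SpaceTM A) (x : List A) (s t : ℕ) :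
    M.run x (s + t) = (M.step x)^[s] (M.run x t) := Function.iterate_add_apply _ _ _ _

/-- The heads stay in the cells `0, …, L` during the run, the final step to the verdict moves no
work head, and afterwards nothing changes. So the scanned cells lie in a `K` by `L + 1` rectangle.
-/
theorem decidesWithin_of_run {x : List Sym} {L K : ℕ} {P : Prog} (hK : 0 < K) (hP : P.Below K)
    {c : Store} (h : Run x L P .empty c) :
    (P.toSpaceTM K).DecidesWithin x (c.scan 0 ≠ .blank) (K * (L + 1)) := by
  classical
  have hinit : (P.toSpaceTM K).run x 0 = P.toCfg K (.inl (some P.entry)) .empty := rfl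
  have key : ∃ t, (P.toSpaceTM K).run x t = P.toCfg K (.inl none) c ∧
      ∀ s ≤ t, ∀ i, ((P.toSpaceTM K).run x s).workHead i ≤ L := by
    have hst := h.steps (Nat.zero_le _)
    have : ∀ s : P.Config, ReflTransGen (P.Steps x L) (some P.entry, .empty) s →
        (∀ i, s.2.head i ≤ L) ∧ ∃ t, (P.toSpaceTM K).run x t = P.toCfg K (.inl s.1) s.2 ∧
        ∀ s ≤ t, ∀ i, ((P.toSpaceTM K).run x s).workHead i ≤ L := by
      intro s hs
      induction hs with
      | refl =>
        refine ⟨fun i => Nat.zero_le _, 0, hinit, fun s hs i => ?_⟩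
        obtain rfl : s = 0 := by omega
        exact Nat.zero_le _
      | tail _ hs ih =>
        obtain ⟨hL, t, ht, hle⟩ := ih
        have hL' := steps_head_le hs hL
        have ht' := step_toCfg hP hs
        rw [← ht, ← Function.iterate_one ((P.toSpaceTM K).step x), ← SpaceTM.run_add] at ht'
        refine ⟨hL', 1 + t, ht', fun s hst i => ?_⟩
        by_cases hs' : s ≤ t
        · exact hle s hs' i
        · obtain rfl : s = 1 + t := by omega
          rw [ht']; exact hL' i
    exact (this _ hst).2
  obtain ⟨t, ht, hle⟩ := key
  have hstep : (P.toSpaceTM K).run x (1 + t) = P.toCfg K (.inr (decide (c.scan 0 ≠ .blank)))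
      ⟨min c.pos (x.length + 1), c.work, c.head⟩ := by
    rw [SpaceTM.run_add, ht]
    simp [SpaceTM.step, toCfg, toSpaceTM, hK, Move.apply, Store.scan]
    by_cases hb : c.work 0 (c.head 0) = .blank <;> simp [hb]
  have hfix : ∀ s, (P.toSpaceTM K).run x (s + (1 + t)) = (P.toSpaceTM K).run x (1 + t) := by
    intro s
    rw [SpaceTM.run_add]
    apply Function.iterate_fixed
    rw [hstep]
    rfl
  have hall : ∀ s i, ((P.toSpaceTM K).run x s).workHead i ≤ L := by
    intro s i
    by_cases hs : s ≤ t
    · exact hle s hs i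
    · obtain ⟨r, rfl⟩ := Nat.exists_eq_add_of_le (show 1 + t ≤ s by omega)
      rw [add_comm (1 + t), hfix, hstep]
      have := hle t le_rfl i
      rwa [ht] at this
  refine ⟨⟨decide (c.scan 0 ≠ .blank), ⟨1 + t, by rw [hstep]; rfl⟩, by simp⟩, ?_⟩
  have hsub : ∀ A : Set (Fin K × ℕ), (∀ p ∈ A, p.2 ≤ L) → A.encard ≤ (K * (L + 1) : ℕ) := by
    intro A hA
    have : A ⊆ ((Finset.univ ×ˢ Finset.range (L + 1) : Finset (Fin K × ℕ)) : Set (Fin K × ℕ)) :=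
      fun p hp => by simpa [Nat.lt_succ_iff] using hA p hp
    refine (Set.encard_le_encard this).trans ?_
    rw [Set.encard_coe_eq_coe_finsetCard, Finset.card_product]
    simp
  refine hsub _ ?_
  rintro ⟨i, n⟩ ⟨s, hs⟩
  exact hs ▸ hall s i

end Prog

end Braid

namespace Braid

open Relation

/-! ### Counters -/

/-- The digits of `n` in bijective binary notation, least significant first, then blanks. -/
def digit : ℕ → ℕ → Digit
  | n, 0 => if n = 0 then .blank else if n % 2 = 1 then .one else .two
  | n, i + 1 => digit ((n - 1) / 2) i

/-- The tape that represents `n`: the digits start in cell `1`. -/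
def counter (n : ℕ) : ℕ → Digit
  | 0 => .blank
  | i + 1 => digit n i

theorem digit_zero_left : ∀ i, digit 0 i = .blank
  | 0 => rfl
  | i + 1 => digit_zero_left i

theorem counter_zero : counter 0 = fun _ => .blank := by
  funext i
  cases i with
  | zero => rfl
  | succ i => exact digit_zero_left i

theorem digit_ne_blank : ∀ {n i j : ℕ}, digit n i ≠ .blank → j ≤ i → digit n j ≠ .blank
  | n, i, 0, h, _ => by
    by_cases hn : n = 0
    · subst hn; exact absurd (digit_zero_left i) h
    · simp only [digit, hn, if_false]
      split <;> simp
  | n, 0, j + 1, _, hj => by omega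
  | n, i + 1, j + 1, h, hj => by
    simp only [digit] at h ⊢
    exact digit_ne_blank h (by omega)

/-- Replace the contents and the head position of one tape. -/
def Store.setTape (c : Store) (r : ℕ) (t : ℕ → Digit) (h : ℕ) : Store :=
  ⟨c.pos, Function.update c.work r t, Function.update c.head r h⟩

namespace Run

variable {x : List Sym} {L : ℕ} {c : Store} {r : ℕ} {t : ℕ → Digit} {h : ℕ}

theorem act_setTape {f : Digit → Digit} {m : Move} (hc : c.pos ≤ x.length + 1)
    (hL : m.apply h ≤ L) :
    Run x L (.act ⟨r, f, m, .stay⟩) (c.setTape r t h)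
      (c.setTape r (Function.update t h (f (t h))) (m.apply h)) := by
  have := Run.act (x := x) (L := L) (e := ⟨r, f, m, .stay⟩) (c := c.setTape r t h)
    (by simpa [Store.setTape] using hL)
  convert this using 1
  simp [Store.setTape, Store.act, Move.apply, hc]

end Run

/-- The symbol under the head satisfies `b`. -/
abbrev onTape (b : Digit → Bool) : InputCell Sym → Digit → Bool := fun _ d => b d

namespace Prog

/-- Move the head of tape `r` to the left, onto the first blank. -/
def rewind (r : ℕ) : Prog := .loop r (onTape (· ≠ .blank)) (.act ⟨r, id, .left, .stay⟩)

/-- Add one to the counter on tape `r`. -/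
def inc (r : ℕ) : Prog :=
  .seq (.act ⟨r, id, .right, .stay⟩) <|
  .seq (.loop r (onTape (· = .two)) (.act ⟨r, fun _ => .one, .right, .stay⟩)) <|
  .seq (.act ⟨r, fun d => if d = .one then .two else .one, .stay, .stay⟩) (rewind r)

/-- Subtract one from the counter on tape `r`, if it is positive. -/
def dec (r : ℕ) : Prog :=
  .seq (.act ⟨r, id, .right, .stay⟩) <|
  .seq (.loop r (onTape (· = .one)) (.act ⟨r, fun _ => .two, .right, .stay⟩)) <|
  .seq (.ite r (onTape (· = .two)) (.act ⟨r, fun _ => .one, .left, .stay⟩)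
    (.seq (.act ⟨r, id, .left, .stay⟩) (.act ⟨r, fun _ => .blank, .left, .stay⟩))) (rewind r)

end Prog

namespace Run

variable {x : List Sym} {L : ℕ} {c : Store} {r : ℕ}

/-- Bijective notation has no digit zero that could be confused with a blank, so the permanently
blank cell `0` serves as the left end marker. -/
theorem rewind (hc : c.pos ≤ x.length + 1) {t : ℕ → Digit} (h₀ : t 0 = .blank) :
    ∀ {h : ℕ}, h ≤ L → (∀ i, 0 < i → i ≤ h → t i ≠ .blank) →
      Run x L (.rewind r) (c.setTape r t h) (c.setTape r t 0)
  | 0, _, _ => .loop_false (by simp [Store.setTape, Store.scan, h₀])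
  | h + 1, hL, ht => by
    refine .loop_true (c' := c.setTape r t h) ?_ ?_
      (rewind hc h₀ (by omega) fun i h₁ h₂ => ht i h₁ (by omega))
    · simpa [Store.setTape, Store.scan] using ht (h + 1) (by omega) le_rfl
    · have := act_setTape (r := r) (t := t) (h := h + 1) (f := id) (m := .left) hc
        (show h ≤ L by omega)
      simpa [Move.apply] using this

theorem le_of_two_pow_mul_le {j n L : ℕ} (h : 2 ^ j * (n + 1) ≤ 2 ^ L) : j ≤ L :=
  (Nat.pow_le_pow_iff_right (by omega)).1 ((Nat.le_mul_of_pos_right _ (Nat.succ_pos n)).trans h)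

/-- A carry turns a digit two into one and passes to the number `(n - 1) / 2` formed by the higher
digits. The quantity `2 ^ j * (n + 1)` does not grow on the way, which bounds the last cell reached.
-/
theorem carry (hc : c.pos ≤ x.length + 1) : ∀ (n j : ℕ) (t : ℕ → Digit),
    (∀ i, t (j + i) = digit n i) → 2 ^ j * (n + 1) ≤ 2 ^ L →
    ∃ j' t', Run x L (.seq (.loop r (onTape (· = .two)) (.act ⟨r, fun _ => .one, .right, .stay⟩))
        (.act ⟨r, fun d => if d = .one then .two else .one, .stay, .stay⟩))
        (c.setTape r t j) (c.setTape r t' j') ∧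
      (∀ i < j, t' i = t i) ∧ (∀ i, t' (j + i) = digit (n + 1) i) ∧ j ≤ j' ∧ j' ≤ L ∧
      t' j' ≠ .blank := by
  intro n
  induction n using Nat.strong_induction_on with
  | _ n ih =>
  intro j t ht hb
  have hj : j ≤ L := le_of_two_pow_mul_le hb
  have ht0 : t j = digit n 0 := ht 0
  by_cases hn : n ≠ 0 ∧ n % 2 = 0
  · obtain ⟨hn0, hn2⟩ := hn
    have h2 : t j = .two := by simp [ht0, digit, hn0, hn2]
    have hb' : 2 ^ (j + 1) * ((n - 1) / 2 + 1) ≤ 2 ^ L := by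
      refine le_trans ?_ hb
      rw [pow_succ, mul_assoc]
      exact Nat.mul_le_mul_left _ (by omega)
    have hj' : j + 1 ≤ L := le_of_two_pow_mul_le hb'
    obtain ⟨j', t', hrun, hpre, hpost, hle, hleL, hne⟩ := ih ((n - 1) / 2) (by omega) (j + 1)
      (Function.update t j .one) (fun i => by
        rw [Function.update_of_ne (by omega), add_assoc, add_comm 1 i, ht]; rfl) hb'
    refine ⟨j', t', ?_, ?_, ?_, by omega, hleL, hne⟩
    · cases hrun with
      | seq h₁ h₂ =>
        refine .seq (.loop_true ?_ ?_ h₁) h₂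
        · simp [Store.setTape, Store.scan, h2]
        · exact act_setTape (f := fun _ => .one) (m := .right) hc hj'
    · intro i hi
      rw [hpre i (by omega), Function.update_of_ne (by omega)]
    · intro i
      cases i with
      | zero =>
        rw [add_zero, hpre j (by omega), Function.update_self]
        simp only [digit]
        rw [if_neg (by omega), if_pos (by omega)]
      | succ i =>
        rw [show j + (i + 1) = j + 1 + i by omega, hpost i]
        simp only [digit]
        congr 1
        omega
  · have h2 : t j ≠ .two := by
      rw [ht0]
      simp only [digit]
      split
      · simp
      · rw [if_pos (by omega)]; simp
    refine ⟨j, Function.update t j (if t j = .one then .two else .one),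
      .seq (.loop_false (by simp [Store.setTape, Store.scan, h2]))
        (act_setTape (f := fun d => if d = .one then .two else .one) (m := .stay) hc hj),
      fun i hi => Function.update_of_ne (by omega) _ _, ?_, le_rfl, hj, ?_⟩
    · intro i
      cases i with
      | zero =>
        rw [add_zero, Function.update_self, ht0]
        by_cases hn0 : n = 0
        · subst hn0; rfl
        · have h1 : digit n 0 = .one := by
            simp only [digit]
            rw [if_neg hn0, if_pos (by omega)]
          rw [h1, if_pos rfl]
          simp only [digit]
          rw [if_neg (by omega), if_neg (by omega)]
      | succ i =>
        rw [Function.update_of_ne (by omega), ht]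
        simp only [digit]
        congr 1
        omega
    · rw [Function.update_self]
      split <;> simp

theorem setTape_counter_nonblank {n j : ℕ} {t : ℕ → Digit} (ht : ∀ i, t (1 + i) = digit n i)
    (hj : t j ≠ .blank) (i : ℕ) (hi : 0 < i) (hij : i ≤ j) : t i ≠ .blank := by
  obtain ⟨i, rfl⟩ := Nat.exists_eq_add_of_le hi
  obtain ⟨j, rfl⟩ := Nat.exists_eq_add_of_le (hi.trans_le hij)
  simp only [Nat.succ_eq_add_one, zero_add] at *
  rw [ht] at hj ⊢
  exact digit_ne_blank hj (by omega)

theorem eq_counter {n : ℕ} {t : ℕ → Digit} (h₀ : t 0 = .blank) (ht : ∀ i, t (1 + i) = digit n i) :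
    t = counter n := by
  funext i
  cases i with
  | zero => exact h₀
  | succ i => rw [add_comm, ht, add_comm]; rfl

theorem seq_assoc {P Q R : Prog} {c c' : Store} (h : Run x L (.seq (.seq P Q) R) c c') :
    Run x L (.seq P (.seq Q R)) c c' := by
  cases h with
  | seq h₁ h₂ =>
    cases h₁ with
    | seq h₃ h₄ => exact .seq h₃ (.seq h₄ h₂)

theorem inc (hc : c.pos ≤ x.length + 1) {n : ℕ} (hn : n < 2 ^ L) :
    Run x (L + 1) (.inc r) (c.setTape r (counter n) 0) (c.setTape r (counter (n + 1)) 0) := by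
  obtain ⟨j', t', hrun, hpre, hpost, hle, hleL, hne⟩ :=
    carry (x := x) (L := L + 1) (r := r) hc n 1 (counter n)
      (fun i => by rw [add_comm]; rfl) (by rw [pow_succ]; omega)
  have h0 : t' 0 = .blank := hpre 0 (by omega)
  refine .seq (c' := c.setTape r (counter n) 1) ?_ (seq_assoc (.seq hrun ?_))
  · have := act_setTape (L := L + 1) (r := r) (t := counter n) (h := 0) (f := id) (m := .right) hc
      (show 0 + 1 ≤ L + 1 by omega)
    simpa [Move.apply] using this
  · have := rewind (L := L + 1) (r := r) hc h0 hleL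
      (fun i h₁ h₂ => setTape_counter_nonblank hpost hne i h₁ h₂)
    rwa [← eq_counter h0 hpost]

/-- A borrow turns ones into twos until it meets a two. If it runs into the blanks instead, the last
digit rewritten has to disappear. The bound on `2 ^ j * (n + 2)` keeps also this extra blank within
the cells available. -/
theorem borrow (hc : c.pos ≤ x.length + 1) : ∀ (n j : ℕ) (t : ℕ → Digit),
    (∀ i, t (j + i) = digit (n + 1) i) → 1 ≤ j → 2 ^ j * (n + 2) ≤ 2 ^ L →
    (∀ i, 0 < i → i < j → t i ≠ .blank) →
    ∃ j' t', Run x L (.seq (.loop r (onTape (· = .one)) (.act ⟨r, fun _ => .two, .right, .stay⟩))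
        (.ite r (onTape (· = .two)) (.act ⟨r, fun _ => .one, .left, .stay⟩)
          (.seq (.act ⟨r, id, .left, .stay⟩) (.act ⟨r, fun _ => .blank, .left, .stay⟩))))
        (c.setTape r t j) (c.setTape r t' j') ∧
      (∀ i < j, t' i = t i) ∧ (∀ i, t' (j + i) = digit n i) ∧ j' ≤ L ∧
      (∀ i, 0 < i → i ≤ j' → t' i ≠ .blank) := by
  intro n
  induction n using Nat.strong_induction_on with
  | _ n ih =>
  intro j t ht hj1 hb hnb
  have hj : j + 1 ≤ L := by
    refine le_of_two_pow_mul_le (n := 0) (le_trans ?_ hb)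
    rw [pow_succ, mul_assoc]
    exact Nat.mul_le_mul_left _ (by omega)
  have ht0 : t j = digit (n + 1) 0 := ht 0
  have hsucc : ∀ i, t (j + (i + 1)) = digit (n / 2) i := fun i => by rw [ht]; rfl
  by_cases hn : n % 2 = 0
  · have h1 : t j = .one := by
      rw [ht0]; simp only [digit]; rw [if_neg (by omega), if_pos (by omega)]
    have hloop : ∀ c', Run x L
        (.loop r (onTape (· = .one)) (.act ⟨r, fun _ => .two, .right, .stay⟩))
        (c.setTape r (Function.update t j .two) (j + 1)) c' →
        Run x L (.loop r (onTape (· = .one)) (.act ⟨r, fun _ => .two, .right, .stay⟩))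
        (c.setTape r t j) c' := fun c' h =>
      .loop_true (by simp [Store.setTape, Store.scan, h1])
        (act_setTape (f := fun _ => .two) (m := .right) hc hj) h
    by_cases hn0 : n = 0
    · subst hn0
      have hblank : ∀ i, t (j + (i + 1)) = .blank := fun i => (hsucc i).trans (digit_zero_left i)
      refine ⟨j - 1, Function.update t j .blank, .seq (hloop _ (.loop_false ?_))
        (.ite_false ?_ (.seq (c' := c.setTape r (Function.update t j .two) j) ?_ ?_)), ?_, ?_, by omega, ?_⟩
      · simp [Store.setTape, Store.scan, hblank 0]
      · simp [Store.setTape, Store.scan, hblank 0]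
      · have := act_setTape (r := r) (t := Function.update t j .two) (h := j + 1) (f := id)
          (m := .left) hc (show j ≤ L by omega)
        rw [id, Function.update_eq_self] at this
        exact this
      · have := act_setTape (r := r) (t := Function.update t j .two) (h := j) (f := fun _ => .blank)
          (m := .left) hc (show j - 1 ≤ L by omega)
        simpa [Move.apply] using this
      · intro i hi
        exact Function.update_of_ne (by omega) _ _
      · intro i
        rw [digit_zero_left]
        cases i with
        | zero => simp
        | succ i => rw [Function.update_of_ne (by omega), hblank]
      · intro i h₁ h₂
        rw [Function.update_of_ne (by omega)]
        exact hnb i h₁ (by omega)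
    · obtain ⟨j', t', hrun, hpre, hpost, hleL, hne⟩ := ih (n / 2 - 1) (by omega) (j + 1)
        (Function.update t j .two) (fun i => by
          rw [Function.update_of_ne (by omega), add_assoc, add_comm 1 i, hsucc]
          congr 1; omega) (by omega) (by
            refine le_trans ?_ hb
            rw [pow_succ, mul_assoc]
            exact Nat.mul_le_mul_left _ (by omega)) (by
          intro i h₁ h₂
          by_cases hij : i = j
          · subst hij; simp
          · rw [Function.update_of_ne hij]; exact hnb i h₁ (by omega))
      refine ⟨j', t', ?_, ?_, ?_, hleL, hne⟩
      · cases hrun with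
        | seq h₁ h₂ => exact .seq (hloop _ h₁) h₂
      · intro i hi
        rw [hpre i (by omega), Function.update_of_ne (by omega)]
      · intro i
        cases i with
        | zero =>
          rw [add_zero, hpre j (by omega), Function.update_self]
          simp only [digit]
          rw [if_neg (by omega), if_neg (by omega)]
        | succ i =>
          rw [show j + (i + 1) = j + 1 + i by omega, hpost i]
          simp only [digit]
          congr 1
          omega
  · have h2 : t j = .two := by
      rw [ht0]; simp only [digit]; rw [if_neg (by omega), if_neg (by omega)]
    refine ⟨j - 1, Function.update t j .one, .seq (.loop_false ?_) (.ite_true ?_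
      (act_setTape (f := fun _ => .one) (m := .left) hc (show j - 1 ≤ L by omega))), ?_, ?_, by omega, ?_⟩
    · simp [Store.setTape, Store.scan, h2]
    · simp [Store.setTape, Store.scan, h2]
    · intro i hi
      exact Function.update_of_ne (by omega) _ _
    · intro i
      cases i with
      | zero =>
        rw [add_zero, Function.update_self]
        simp only [digit]
        rw [if_neg (by omega), if_pos (by omega)]
      | succ i =>
        rw [Function.update_of_ne (by omega), hsucc]
        simp only [digit]
        congr 1
        omega
    · intro i h₁ h₂
      rw [Function.update_of_ne (by omega)]
      exact hnb i h₁ (by omega)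

theorem dec (hc : c.pos ≤ x.length + 1) {n : ℕ} (hn : n + 1 < 2 ^ L) :
    Run x (L + 1) (.dec r) (c.setTape r (counter (n + 1)) 0) (c.setTape r (counter n) 0) := by
  obtain ⟨j', t', hrun, hpre, hpost, hleL, hne⟩ :=
    borrow (x := x) (L := L + 1) (r := r) hc n 1 (counter (n + 1))
      (fun i => by rw [add_comm 1 i]; rfl) le_rfl (by rw [pow_succ]; omega) (by omega)
  have h0 : t' 0 = .blank := hpre 0 (by omega)
  refine .seq (c' := c.setTape r (counter (n + 1)) 1) ?_ (seq_assoc (.seq hrun ?_))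
  · have := act_setTape (L := L + 1) (r := r) (t := counter (n + 1)) (h := 0) (f := id)
      (m := .right) hc (show 0 + 1 ≤ L + 1 by omega)
    simpa [Move.apply] using this
  · have := rewind (L := L + 1) (r := r) hc h0 hleL hne
    rwa [← eq_counter h0 hpost]

end Run

/-- The store in which tape `r` holds the number `v r`, and the input head is in cell `p`. -/
def Store.ofRegs (p : ℕ) (v : ℕ → ℕ) : Store := ⟨p, fun r => counter (v r), fun _ => 0⟩

theorem Store.ofRegs_setTape (p : ℕ) (v : ℕ → ℕ) (r n : ℕ) :
    (Store.ofRegs p v).setTape r (counter n) 0 = Store.ofRegs p (Function.update v r n) := by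
  ext i j
  · rfl
  · by_cases h : i = r
    · subst h; simp [Store.setTape, Store.ofRegs]
    · simp [Store.setTape, Store.ofRegs, h]
  · simp [Store.setTape, Store.ofRegs]

namespace Prog

/-- Test whether register `r` is zero. -/
def ifZero (r : ℕ) (p q : Prog) : Prog :=
  .seq (.act ⟨r, id, .right, .stay⟩) <|
    .ite r (onTape (· = .blank)) (.seq (.act ⟨r, id, .left, .stay⟩) p)
      (.seq (.act ⟨r, id, .left, .stay⟩) q)

/-- Repeat while register `r` is not zero. -/
def whilePos (r : ℕ) (p : Prog) : Prog :=
  .seq (.act ⟨r, id, .right, .stay⟩) <|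
    .seq (.loop r (onTape (· ≠ .blank)) (.seq (.act ⟨r, id, .left, .stay⟩)
      (.seq p (.act ⟨r, id, .right, .stay⟩)))) (.act ⟨r, id, .left, .stay⟩)

/-- Do nothing. -/
def skip : Prog := .act .idle

end Prog

/-- Execution on registers that hold numbers below `2 ^ L`, from the position `p` of the input head
and the register contents `v` to `p'` and `v'`. -/
def Exec (x : List Sym) (L : ℕ) (P : Prog) (p : ℕ) (v : ℕ → ℕ) (p' : ℕ) (v' : ℕ → ℕ) : Prop :=
  p ≤ x.length + 1 → Run x (L + 1) P (.ofRegs p v) (.ofRegs p' v')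

namespace Exec

variable {x : List Sym} {L : ℕ} {P Q : Prog} {p p' p'' : ℕ} {v v' v'' : ℕ → ℕ} {r : ℕ}

theorem seq (h₁ : Exec x L P p v p' v') (h₂ : Exec x L Q p' v' p'' v'') :
    Exec x L (.seq P Q) p v p'' v'' :=
  fun hp => .seq (h₁ hp) (h₂ ((h₁ hp).pos_le hp))

theorem inc (h : v r < 2 ^ L) : Exec x L (.inc r) p v p (Function.update v r (v r + 1)) := by
  intro hp
  have := Run.inc (x := x) (L := L) (c := .ofRegs p v) (r := r) hp h
  rwa [Store.ofRegs_setTape, Store.ofRegs_setTape, Function.update_eq_self] at this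

theorem dec {n : ℕ} (hn : v r = n + 1) (h : v r < 2 ^ L) :
    Exec x L (.dec r) p v p (Function.update v r n) := by
  intro hp
  have := Run.dec (x := x) (L := L) (c := .ofRegs p v) (r := r) hp (hn ▸ h)
  rwa [Store.ofRegs_setTape, Store.ofRegs_setTape, ← hn, Function.update_eq_self] at this

/-- Shift the head of tape `r` to the first digit. -/
theorem shift (hp : p ≤ x.length + 1) : ∃ c, Run x (L + 1) (.act ⟨r, id, .right, .stay⟩)
      (.ofRegs p v) c ∧ Run x (L + 1) (.act ⟨r, id, .left, .stay⟩) c (.ofRegs p v) ∧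
      c.pos = p ∧ (c.scan r = .blank ↔ v r = 0) := by
  have h₁ := Run.act_setTape (L := L + 1) (c := .ofRegs p v) (r := r) (t := counter (v r)) (h := 0)
    (f := id) (m := .right) hp (show 0 + 1 ≤ L + 1 by omega)
  have h₂ := Run.act_setTape (L := L + 1) (c := .ofRegs p v) (r := r) (t := counter (v r)) (h := 1)
    (f := id) (m := .left) hp (show 0 ≤ L + 1 by omega)
  simp only [Move.apply, id, Function.update_eq_self, zero_add, Nat.sub_self] at h₁ h₂
  rw [Store.ofRegs_setTape, Function.update_eq_self] at h₁ h₂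
  refine ⟨_, h₁, h₂, rfl, ?_⟩
  simp only [Store.scan, Store.setTape, Function.update_self, counter, digit]
  by_cases hr : v r = 0
  · simp [hr]
  · simp only [hr, if_false, iff_false]
    split <;> simp

theorem ifZero (h₀ : v r = 0 → Exec x L P p v p' v') (h₁ : v r ≠ 0 → Exec x L Q p v p' v') :
    Exec x L (.ifZero r P Q) p v p' v' := by
  intro hp
  obtain ⟨c, hr, hl, hpos, hz⟩ := shift (L := L) (v := v) (r := r) hp
  refine .seq hr ?_
  by_cases h : v r = 0
  · exact .ite_true (by simp [hz.2 h]) (.seq hl (h₀ h hp))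
  · exact .ite_false (by simpa [hz] using h) (.seq hl (h₁ h hp))

theorem whilePos_zero (h : v r = 0) : Exec x L (.whilePos r P) p v p v := by
  intro hp
  obtain ⟨c, hr, hl, hpos, hz⟩ := shift (L := L) (v := v) (r := r) hp
  exact .seq hr (.seq (.loop_false (by simp [hz.2 h])) hl)

theorem whilePos_pos (h : v r ≠ 0) (h₁ : Exec x L P p v p' v')
    (h₂ : Exec x L (.whilePos r P) p' v' p'' v'') : Exec x L (.whilePos r P) p v p'' v'' := by
  intro hp
  obtain ⟨c, hr, hl, hpos, hz⟩ := shift (L := L) (v := v) (r := r) hp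
  have hp' := (h₁ hp).pos_le hp
  cases h₂ hp' with
  | seq h₃ h₄ =>
    cases h₄ with
    | seq h₅ h₆ => exact .seq hr (.seq (.loop_true (by simpa [hz] using h)
        (.seq hl (.seq (h₁ hp) h₃)) h₅) h₆)

theorem skip : Exec x L .skip p v p v := by
  intro hp
  have := Run.act (x := x) (L := L + 1) (e := .idle) (c := .ofRegs p v) (by simp [Action.idle, Move.apply, Store.ofRegs])
  rwa [Store.act_idle hp] at this

/-- Movements of the input head. -/
theorem input {m : Move} :
    Exec x L (.act ⟨0, id, .stay, m⟩) p v (min (m.apply p) (x.length + 1)) v := by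
  intro hp
  have := Run.act (x := x) (L := L + 1) (e := ⟨0, id, .stay, m⟩) (c := .ofRegs p v)
    (by simp [Move.apply, Store.ofRegs])
  convert this using 1
  simp [Store.act, Store.ofRegs, Move.apply]

theorem ite_input {b : InputCell Sym → Bool}
    (h₁ : b (readInput x p) = true → Exec x L P p v p' v')
    (h₂ : b (readInput x p) = false → Exec x L Q p v p' v') :
    Exec x L (.ite 0 (fun y _ => b y) P Q) p v p' v' := by
  intro hp
  cases h : b (readInput x p) with
  | true => exact .ite_true h (h₁ h hp)
  | false => exact .ite_false h (h₂ h hp)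

theorem loop_input_false {b : InputCell Sym → Bool} (h : b (readInput x p) = false) :
    Exec x L (.loop 0 (fun y _ => b y) P) p v p v :=
  fun _ => .loop_false h

theorem loop_input_true {b : InputCell Sym → Bool} (h : b (readInput x p) = true)
    (h₁ : Exec x L P p v p' v') (h₂ : Exec x L (.loop 0 (fun y _ => b y) P) p' v' p'' v'') :
    Exec x L (.loop 0 (fun y _ => b y) P) p v p'' v'' :=
  fun hp => .loop_true h (h₁ hp) (h₂ ((h₁ hp).pos_le hp))

end Exec

end Braid

namespace Braid

/-! ### Functions computed by register programs -/

/-- An instance of the reachability problem. -/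
structure Problem where
  N : ℕ
  S : ℕ
  machine : BraidTM N S
  target : Fin N

namespace Problem

def input (I : Problem) : List Sym := encodeInstance I.machine I.target

/-- The number of bits of the registers. -/
def width (I : Problem) : ℕ := 2 ^ (I.N ^ 2 + 2 * I.N + 10) * max 1 (Nat.log 2 I.S) ^ 2

/-- All numbers in registers are below this bound. -/
def cap (I : Problem) : ℕ := 2 ^ I.width

end Problem

abbrev Exec' (I : Problem) (P : Prog) (p : ℕ) (v : ℕ → ℕ) (p' : ℕ) (v' : ℕ → ℕ) : Prop :=
  Exec I.input I.width P p v p' v'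

namespace Prog

/-- Set register `r` to zero. -/
def clear (r : ℕ) : Prog := whilePos r (dec r)

/-- Copy register `i` to register `j`, with auxiliary register `t`. -/
def copy (i j t : ℕ) : Prog :=
  .seq (clear j) <| .seq (clear t) <|
    .seq (whilePos i (.seq (dec i) (.seq (inc j) (inc t)))) (whilePos t (.seq (dec t) (inc i)))

/-- Copy the `w` registers from `s` on to those from `m` on, with auxiliary register `t`. -/
def copyBlock (s m t : ℕ) : ℕ → Prog
  | 0 => skip
  | w + 1 => .seq (copyBlock s m t w) (copy (s + w) (m + w) t)

end Prog

namespace Exec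

variable {x : List Sym} {L : ℕ} {p : ℕ} {v v' : ℕ → ℕ}

theorem clear {r : ℕ} (h : v r < 2 ^ L) :
    Exec x L (.clear r) p v p (Function.update v r 0) := by
  obtain ⟨n, hn⟩ : ∃ n, v r = n := ⟨_, rfl⟩
  induction n generalizing v with
  | zero =>
    rw [← hn, Function.update_eq_self]
    exact whilePos_zero hn
  | succ n ih =>
    have := ih (v := Function.update v r n) (by simp; omega) (by simp)
    rw [Function.update_idem] at this
    exact whilePos_pos (by omega) (dec hn h) this

/-- Registers are read destructively. Emptying `i` into two registers at once leaves a second copy,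
from which `restore` refills `i`. -/
theorem transfer {i j t : ℕ} (hij : i ≠ j) (hit : i ≠ t) (hjt : j ≠ t) (n : ℕ) (hn : v i = n)
    (h : v i < 2 ^ L) (hj : v j + n < 2 ^ L) (ht : v t + n < 2 ^ L) :
    Exec x L (.whilePos i (.seq (.dec i) (.seq (.inc j) (.inc t)))) p v p
      (Function.update (Function.update (Function.update v i 0) j (v j + n)) t (v t + n)) := by
  induction n generalizing v with
  | zero =>
    have : Function.update (Function.update (Function.update v i 0) j (v j + 0)) t (v t + 0) = v := by
      funext k
      by_cases hk : k = t
      · subst hk; simp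
      by_cases hk' : k = j
      · subst hk'; simp [hk]
      by_cases hk'' : k = i
      · subst hk''; simp [hk, hk', hn]
      simp [hk, hk', hk'']
    rw [this]
    exact whilePos_zero hn
  | succ n ih =>
    refine whilePos_pos (by omega) (.seq (.dec hn h) (.seq (.inc ?_) (.inc ?_))) ?_
    · rw [Function.update_of_ne hij.symm]; omega
    · rw [Function.update_of_ne hjt.symm, Function.update_of_ne hit.symm]; omega
    · refine (congrArg (Exec x L _ p _ p) ?_).mp (ih (v := Function.update (Function.update
        (Function.update v i n) j (Function.update v i n j + 1)) t (Function.update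
        (Function.update v i n) j (Function.update v i n j + 1) t + 1)) ?_ ?_ ?_ ?_)
      · funext k
        by_cases hk : k = t
        · subst hk; simp [hjt.symm, hit.symm]; omega
        by_cases hk' : k = j
        · subst hk'; simp [hk, hij.symm]; omega
        by_cases hk'' : k = i
        · subst hk''; simp [hk, hk']
        simp [hk, hk', hk'']
      all_goals simp [hjt, hjt.symm, hit, hij, hit.symm, hij.symm]
      all_goals omega

theorem restore {i t : ℕ} (hit : i ≠ t) (n : ℕ) (hn : v t = n)
    (h : v t < 2 ^ L) (hi : v i + n < 2 ^ L) :
    Exec x L (.whilePos t (.seq (.dec t) (.inc i))) p v p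
      (Function.update (Function.update v t 0) i (v i + n)) := by
  induction n generalizing v with
  | zero =>
    have : Function.update (Function.update v t 0) i (v i + 0) = v := by
      funext k
      by_cases hk : k = i
      · subst hk; simp
      by_cases hk' : k = t
      · subst hk'; simp [hk, hn]
      simp [hk, hk']
    rw [this]
    exact whilePos_zero hn
  | succ n ih =>
    refine whilePos_pos (by omega) (.seq (.dec hn h) (.inc ?_)) ?_
    · rw [Function.update_of_ne hit]; omega
    · refine (congrArg (Exec x L _ p _ p) ?_).mp (ih (v := Function.update
        (Function.update v t n) i (Function.update v t n i + 1)) ?_ ?_ ?_)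
      · funext k
        by_cases hk : k = i
        · subst hk; simp [hit]; omega
        by_cases hk' : k = t
        · subst hk'; simp [hk]
        simp [hk, hk']
      all_goals simp [hit, hit.symm]
      all_goals omega

theorem copy {i j t : ℕ} (hij : i ≠ j) (hit : i ≠ t) (hjt : j ≠ t) (h : ∀ k, v k < 2 ^ L) :
    Exec x L (.copy i j t) p v p (Function.update (Function.update v j (v i)) t 0) := by
  have hi := h i
  refine .seq (.clear (h j)) (.seq (.clear ?_) (.seq (.transfer hij hit hjt (v i) ?_ ?_ ?_ ?_)
    ((congrArg (Exec x L _ p _ p) ?_).mp (.restore hit (v i) ?_ ?_ ?_))))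
  · rw [Function.update_of_ne hjt.symm]; exact h t
  · simp [hij, hit]
  · simp [hij, hit]; exact hi
  · simp [hjt]; exact hi
  · simp; exact hi
  · funext k
    by_cases hk : k = i
    · subst hk; simp [hij, hit]
    by_cases hk' : k = t
    · subst hk'; simp [hk]
    by_cases hk'' : k = j
    · subst hk''; simp [hk, hk']
    simp [hk, hk', hk'']
  · simp
  · simp; exact hi
  · simp [hij, hit]; exact hi

theorem copyBlock {s m t : ℕ} : ∀ {w : ℕ} {v : ℕ → ℕ}, (s + w ≤ m ∨ m + w ≤ s) →
    (t < s ∨ s + w ≤ t) → (t < m ∨ m + w ≤ t) → (∀ k, v k < 2 ^ L) →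
    ∃ v', Exec x L (.copyBlock s m t w) p v p v' ∧ (∀ k, v' k < 2 ^ L) ∧
      (∀ i < w, v' (m + i) = v (s + i)) ∧ ∀ k, (k < m ∨ m + w ≤ k) → k ≠ t → v' k = v k
  | 0, v, _, _, _, h => ⟨v, skip, h, fun i hi => absurd hi (Nat.not_lt_zero _), fun _ _ _ => rfl⟩
  | w + 1, v, h₁, h₂, h₃, h => by
    obtain ⟨v', he, hb, hcopy, hkeep⟩ := copyBlock (s := s) (m := m) (t := t) (w := w) (v := v)
      (by omega) (by omega) (by omega) h
    have hc := copy (x := x) (p := p) (i := s + w) (j := m + w) (t := t) (by omega) (by omega)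
      (by omega) hb
    refine ⟨_, he.seq hc, ?_, ?_, ?_⟩
    · intro k
      by_cases hk : k = t
      · subst hk; simp
      by_cases hk' : k = m + w
      · subst hk'; simp [hk, hb]
      simp [hk, hk', hb]
    · intro i hi
      rw [Function.update_of_ne (by omega)]
      by_cases hiw : i = w
      · subst hiw
        rw [Function.update_self, hkeep _ (by omega) (by omega)]
      · rw [Function.update_of_ne (by omega), hcopy i (by omega)]
    · intro k hk hkt
      rw [Function.update_of_ne hkt, Function.update_of_ne (by omega), hkeep k (by omega) hkt]

end Exec

/-- Types whose elements are stored in a fixed number of registers. -/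
class Reg (β : Type) where
  size : ℕ
  enc : β → ℕ → ℕ

namespace Reg

instance : Reg Unit := ⟨0, fun _ _ => 0⟩

instance : Reg ℕ := ⟨1, fun n _ => n⟩

instance {α β : Type} [Reg α] [Reg β] : Reg (α × β) :=
  ⟨size α + size β, fun a i => if i < size α then enc a.1 i else enc a.2 (i - size α)⟩

/-- The registers from `s` on contain `a`. -/
def Fits {α : Type} [Reg α] (v : ℕ → ℕ) (s : ℕ) (a : α) : Prop := ∀ i < size α, v (s + i) = enc a i

variable {α β : Type} [Reg α] [Reg β] {v : ℕ → ℕ} {s : ℕ}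

theorem fits_nat {n : ℕ} : Fits v s n ↔ v s = n := by
  constructor
  · intro h
    exact h 0 Nat.one_pos
  · rintro rfl i hi
    obtain rfl : i = 0 := Nat.lt_one_iff.1 hi
    rfl

theorem fits_prod {a : α × β} : Fits v s a ↔ Fits v s a.1 ∧ Fits v (s + size α) a.2 := by
  constructor
  · intro h
    refine ⟨fun i hi => ?_, fun i hi => ?_⟩
    · have := h i (show i < size α + size β by omega)
      rw [this]
      exact if_pos hi
    · have := h (size α + i) (show _ < size α + size β by omega)
      rw [add_assoc, this]
      refine (if_neg (by omega)).trans ?_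
      rw [Nat.add_sub_cancel_left]
  · rintro ⟨h₁, h₂⟩ i hi
    have hi' : i < size α + size β := hi
    by_cases h : i < size α
    · rw [h₁ i h]
      exact (if_pos h).symm
    · obtain ⟨j, rfl⟩ := Nat.exists_eq_add_of_le (not_lt.1 h)
      have := h₂ j (by omega)
      rw [add_assoc] at this
      rw [this]
      refine Eq.trans ?_ (if_neg (by omega)).symm
      rw [Nat.add_sub_cancel_left]

theorem Fits.congr {v' : ℕ → ℕ} {s' : ℕ} {a : α} (h : Fits v s a)
    (hv : ∀ i < size α, v' (s' + i) = v (s + i)) : Fits v' s' a :=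
  fun i hi => (hv i hi).trans (h i hi)

end Reg

open Reg

/-- `f` is computed by programs that get `a` in the registers from `s` on, where `D I a`, and store
`f I a` in the registers from `m` on, for arbitrary blocks of registers with `s` before `m`. The
registers before `m` are not changed, those after the result may be. -/
def Comp {α β : Type} [Reg α] [Reg β] (D : Problem → α → Prop) (f : Problem → α → β) : Prop :=
  ∀ s m, s + size α ≤ m → ∃ P : Prog, ∀ (I : Problem) (a : α) (p : ℕ) (v : ℕ → ℕ), D I a →
    (∀ i, v i < I.cap) → Fits v s a → ∃ p' v', Exec' I P p v p' v' ∧ (∀ i, v' i < I.cap) ∧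
      (∀ i < m, v' i = v i) ∧ Fits v' m (f I a)

namespace Comp

variable {α β γ : Type} [Reg α] [Reg β] [Reg γ] {D : Problem → α → Prop}

theorem of_eq {f g : Problem → α → β} (hf : Comp D f) (h : ∀ I a, D I a → f I a = g I a) :
    Comp D g := by
  intro s m hm
  obtain ⟨P, hP⟩ := hf s m hm
  exact ⟨P, fun I a p v hD hv hs => h I a hD ▸ hP I a p v hD hv hs⟩

theorem mono {D' : Problem → α → Prop} {f : Problem → α → β} (hf : Comp D' f)
    (h : ∀ I a, D I a → D' I a) : Comp D f := by
  intro s m hm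
  obtain ⟨P, hP⟩ := hf s m hm
  exact ⟨P, fun I a p v hD hv hs => hP I a p v (h I a hD) hv hs⟩

/-- Copying the block of registers from `s + k` on. -/
theorem project {f : α → β} (k : ℕ) (hk : k + size β ≤ size α)
    (h : ∀ v s a, Fits v s a → Fits v (s + k) (f a)) : Comp D fun _ => f := by
  intro s m hm
  refine ⟨.copyBlock (s + k) m (m + size β) (size β), fun I a p v hD hv hs => ?_⟩
  obtain ⟨v', he, hb, hc, hkeep⟩ := Exec.copyBlock (x := I.input) (L := I.width) (p := p)
    (s := s + k) (m := m) (t := m + size β) (w := size β) (v := v) (by omega) (by omega)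
    (by omega) hv
  exact ⟨p, v', he, hb, fun i hi => hkeep i (by omega) (by omega), (h v s a hs).congr (s' := m) hc⟩

theorem id : Comp D fun _ a => a :=
  project 0 (by omega) fun v s a h => h

theorem fst {D : Problem → α × β → Prop} : Comp D fun _ a => a.1 :=
  project 0 (show _ ≤ size α + size β by omega) fun v s a h => (fits_prod.1 h).1

theorem snd {D : Problem → α × β → Prop} : Comp D fun _ a => a.2 :=
  project (size α) (show _ ≤ size α + size β by omega) fun v s a h => (fits_prod.1 h).2

theorem comp {E : Problem → β → Prop} {g : Problem → β → γ} {f : Problem → α → β}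
    (hg : Comp E g) (hf : Comp D f) (hE : ∀ I a, D I a → E I (f I a)) :
    Comp D fun I a => g I (f I a) := by
  intro s m hm
  -- The final result needs the block at `m`; the intermediate value is therefore computed beyond
  -- it, and the result is copied down at the end.
  obtain ⟨P, hP⟩ := hf s (m + size γ) (by omega)
  obtain ⟨Q, hQ⟩ := hg (m + size γ) (m + size γ + size β) le_rfl
  refine ⟨.seq P (.seq Q (.copyBlock (m + size γ + size β) m
    (m + size γ + size β + size γ) (size γ))), fun I a p v hD hv hs => ?_⟩
  obtain ⟨p₁, v₁, he₁, hb₁, hk₁, hf₁⟩ := hP I a p v hD hv hs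
  obtain ⟨p₂, v₂, he₂, hb₂, hk₂, hf₂⟩ := hQ I _ p₁ v₁ (hE I a hD) hb₁ hf₁
  obtain ⟨v₃, he₃, hb₃, hc₃, hk₃⟩ := Exec.copyBlock (x := I.input) (L := I.width) (p := p₂)
    (s := m + size γ + size β) (m := m) (t := m + size γ + size β + size γ) (w := size γ) (v := v₂)
    (by omega) (by omega) (by omega) hb₂
  refine ⟨p₂, v₃, he₁.seq (he₂.seq he₃), hb₃, fun i hi => ?_, hf₂.congr (s' := m) hc₃⟩
  rw [hk₃ i (by omega) (by omega), hk₂ i (by omega), hk₁ i (by omega)]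

theorem pair {f : Problem → α → β} {g : Problem → α → γ} (hf : Comp D f) (hg : Comp D g) :
    Comp D fun I a => (f I a, g I a) := by
  intro s m hm
  obtain ⟨P, hP⟩ := hf s m hm
  obtain ⟨Q, hQ⟩ := hg s (m + size β) (by omega)
  refine ⟨.seq P Q, fun I a p v hD hv hs => ?_⟩
  obtain ⟨p₁, v₁, he₁, hb₁, hk₁, hf₁⟩ := hP I a p v hD hv hs
  obtain ⟨p₂, v₂, he₂, hb₂, hk₂, hf₂⟩ := hQ I a p₁ v₁ hD hb₁
    (hs.congr fun i hi => hk₁ _ (by omega))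
  refine ⟨p₂, v₂, he₁.seq he₂, hb₂, fun i hi => ?_, fits_prod.2 ⟨?_, hf₂⟩⟩
  · rw [hk₂ i (by omega), hk₁ i hi]
  · exact hf₁.congr fun i hi => hk₂ _ (by omega)

theorem ite {c : Problem → α → ℕ} {f g : Problem → α → β} (hc : Comp D c)
    (hf : Comp (fun I a => D I a ∧ c I a ≠ 0) f) (hg : Comp (fun I a => D I a ∧ c I a = 0) g) :
    Comp D fun I a => if c I a = 0 then g I a else f I a := by
  intro s m hm
  obtain ⟨P, hP⟩ := hc s m hm
  obtain ⟨Q, hQ⟩ := hf s m hm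
  obtain ⟨R, hR⟩ := hg s m hm
  refine ⟨.seq P (.ifZero m R Q), fun I a p v hD hv hs => ?_⟩
  obtain ⟨p₁, v₁, he₁, hb₁, hk₁, hf₁⟩ := hP I a p v hD hv hs
  rw [fits_nat] at hf₁
  have hs₁ : Fits v₁ s a := hs.congr fun i hi => hk₁ _ (by omega)
  by_cases h : c I a = 0
  · obtain ⟨p₂, v₂, he₂, hb₂, hk₂, hf₂⟩ := hR I a p₁ v₁ ⟨hD, h⟩ hb₁ hs₁
    refine ⟨p₂, v₂, he₁.seq (.ifZero (fun _ => he₂) fun h' => absurd (hf₁.trans h) h'), hb₂,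
      fun i hi => by rw [hk₂ i hi, hk₁ i hi], ?_⟩
    simpa only [if_pos h] using hf₂
  · obtain ⟨p₂, v₂, he₂, hb₂, hk₂, hf₂⟩ := hQ I a p₁ v₁ ⟨hD, h⟩ hb₁ hs₁
    refine ⟨p₂, v₂, he₁.seq (.ifZero (fun h' => absurd (hf₁.symm.trans h') h) fun _ => he₂), hb₂,
      fun i hi => by rw [hk₂ i hi, hk₁ i hi], ?_⟩
    simpa only [if_neg h] using hf₂

/-- `a` leads to `b` if `f` is applied as long as `c` is not zero. -/
inductive _root_.Braid.Loops (E : α → Prop) (c : α → ℕ) (f : α → α) : α → α → Prop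
  | halt {a} : E a → c a = 0 → Loops E c f a a
  | step {a b} : E a → c a ≠ 0 → Loops E c f (f a) b → Loops E c f a b

/-- The loop value lives at `m` and the value of the condition directly behind it; `E` is the
invariant, supplied by each stage of the `Loops` derivation, under which the body and the condition
are computable. -/
theorem loop {E : Problem → α → Prop} {c : Problem → α → ℕ} {f g : Problem → α → α}
    (hc : Comp E c) (hf : Comp (fun I a => E I a ∧ c I a ≠ 0) f)
    (h : ∀ I a, D I a → Loops (E I) (c I) (f I) a (g I a)) : Comp D g := by
  intro s m hm
  obtain ⟨P, hP⟩ := hc m (m + size α) le_rfl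
  obtain ⟨Q, hQ⟩ := hf m (m + size α) le_rfl
  refine ⟨.seq (.copyBlock s m (m + size α) (size α)) (.seq P (.whilePos (m + size α)
    (.seq Q (.seq (.copyBlock (m + size α) m (m + size α + size α) (size α)) P)))),
    fun I a p v hD hv hs => ?_⟩
  obtain ⟨v₀, he₀, hb₀, hc₀, hk₀⟩ := Exec.copyBlock (x := I.input) (L := I.width) (p := p)
    (s := s) (m := m) (t := m + size α) (w := size α) (v := v) (by omega) (by omega) (by omega) hv
  have key : ∀ a b, Loops (E I) (c I) (f I) a b → E I a ∧ ∀ p v, (∀ i, v i < I.cap) →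
      Fits v m a → v (m + size α) = c I a →
      ∃ p' v', Exec' I (.whilePos (m + size α) (.seq Q (.seq (.copyBlock (m + size α) m
        (m + size α + size α) (size α)) P))) p v p' v' ∧ (∀ i, v' i < I.cap) ∧
      (∀ i < m, v' i = v i) ∧ Fits v' m b := by
    intro a b hab
    induction hab with
    | @halt a hE hz =>
      exact ⟨hE, fun p v hv hs hc => ⟨p, v, .whilePos_zero (hc.trans hz), hv, fun _ _ => rfl, hs⟩⟩
    | @step a b hE hz _ ih =>
      refine ⟨hE, fun p v hv hs hc => ?_⟩
      obtain ⟨p₂, v₂, he₂, hb₂, hk₂, hf₂⟩ := hQ I a p v ⟨hE, hz⟩ hv hs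
      obtain ⟨v₃, he₃, hb₃, hc₃, hk₃⟩ := Exec.copyBlock (x := I.input) (L := I.width) (p := p₂)
        (s := m + size α) (m := m) (t := m + size α + size α) (w := size α) (v := v₂)
        (by omega) (by omega) (by omega) hb₂
      have hs₃ : Fits v₃ m (f I a) := hf₂.congr (s' := m) hc₃
      obtain ⟨p₁, v₁, he₁, hb₁, hk₁, hf₁⟩ := hP I _ p₂ v₃ ih.1 hb₃ hs₃
      rw [fits_nat] at hf₁
      obtain ⟨p₄, v₄, he₄, hb₄, hk₄, hf₄⟩ := ih.2 p₁ v₁ hb₁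
        (hs₃.congr fun i hi => hk₁ _ (by omega)) hf₁
      refine ⟨p₄, v₄, .whilePos_pos (by rwa [hc]) (he₂.seq (he₃.seq he₁)) he₄, hb₄,
        fun i hi => ?_, hf₄⟩
      rw [hk₄ i hi, hk₁ i (by omega), hk₃ i (by omega) (by omega), hk₂ i (by omega)]
  obtain ⟨hE, key⟩ := key _ _ (h I a hD)
  have hs₀ : Fits v₀ m a := hs.congr (s' := m) hc₀
  obtain ⟨p₁, v₁, he₁, hb₁, hk₁, hf₁⟩ := hP I a p v₀ hE hb₀ hs₀
  rw [fits_nat] at hf₁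
  obtain ⟨p', v', he, hb, hk, hf⟩ := key p₁ v₁ hb₁ (hs₀.congr fun i hi => hk₁ _ (by omega)) hf₁
  exact ⟨p', v', he₀.seq (he₁.seq he), hb,
    fun i hi => by rw [hk i hi, hk₁ i (by omega), hk₀ i (by omega) (by omega)], hf⟩

end Comp

end Braid

/-! ### Arithmetic, logical connectives and bounded quantifiers on registers -/

namespace Braid

open Reg

theorem Problem.lt_cap_of_le (I : Problem) {n : ℕ} (h : n ≤ 1000) : n < I.cap := by
  refine lt_of_le_of_lt h (lt_of_lt_of_le (show 1000 < 2 ^ 10 by norm_num) ?_)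
  refine Nat.pow_le_pow_right (by omega) ?_
  have h₁ : 2 ^ 10 ≤ 2 ^ (I.N ^ 2 + 2 * I.N + 10) := Nat.pow_le_pow_right (by omega) (by omega)
  have h₂ : 1 ≤ max 1 (Nat.log 2 I.S) ^ 2 := Nat.one_le_pow _ _ (by omega)
  have h₃ := Nat.mul_le_mul h₁ h₂
  rw [Problem.width]
  omega

namespace Comp

variable {α β γ : Type} [Reg α] [Reg β] [Reg γ] {D : Problem → α → Prop}

theorem left {f : Problem → α → β × γ} (hf : Comp D f) : Comp D fun I a => (f I a).1 :=
  (fst (D := fun _ _ => True)).comp hf fun _ _ _ => trivial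

theorem right {f : Problem → α → β × γ} (hf : Comp D f) : Comp D fun I a => (f I a).2 :=
  (snd (D := fun _ _ => True)).comp hf fun _ _ _ => trivial

theorem zero : Comp D fun _ _ => 0 := by
  intro s m hm
  refine ⟨.clear m, fun I a p v hD hv hs => ⟨p, _, .clear (hv m), fun i => ?_, fun i hi => ?_, ?_⟩⟩
  · by_cases h : i = m
    · subst h; simpa using (Nat.zero_le _).trans_lt (hv i)
    · simpa [h] using hv i
  · exact Function.update_of_ne (by omega) _ _
  · simp [fits_nat]

theorem succ {f : Problem → α → ℕ} (hf : Comp D f) (h : ∀ I a, D I a → f I a + 1 < I.cap) :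
    Comp D fun I a => f I a + 1 := by
  intro s m hm
  obtain ⟨P, hP⟩ := hf s m hm
  refine ⟨.seq P (.inc m), fun I a p v hD hv hs => ?_⟩
  obtain ⟨p₁, v₁, he₁, hb₁, hk₁, hf₁⟩ := hP I a p v hD hv hs
  rw [fits_nat] at hf₁
  refine ⟨p₁, _, he₁.seq (.inc (hb₁ m)), fun i => ?_, fun i hi => ?_, ?_⟩
  · by_cases hi : i = m
    · subst hi; simpa [hf₁] using h I a hD
    · simpa [hi] using hb₁ i
  · rw [Function.update_of_ne (by omega), hk₁ i hi]
  · simp [fits_nat, hf₁]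

theorem pred {f : Problem → α → ℕ} (hf : Comp D f) : Comp D fun I a => f I a - 1 := by
  intro s m hm
  obtain ⟨P, hP⟩ := hf s m hm
  refine ⟨.seq P (.ifZero m .skip (.dec m)), fun I a p v hD hv hs => ?_⟩
  obtain ⟨p₁, v₁, he₁, hb₁, hk₁, hf₁⟩ := hP I a p v hD hv hs
  rw [fits_nat] at hf₁
  refine ⟨p₁, Function.update v₁ m (f I a - 1), he₁.seq (.ifZero (fun h => ?_) fun h => ?_),
    fun i => ?_, fun i hi => ?_, ?_⟩
  · rw [← hf₁, h, Nat.zero_sub, ← h, Function.update_eq_self]; exact .skip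
  · exact .dec (by omega) (hb₁ m)
  · by_cases hi : i = m
    · subst hi
      have := hb₁ i
      rw [Function.update_self]
      omega
    · simpa [hi] using hb₁ i
  · rw [Function.update_of_ne (by omega), hk₁ i hi]
  · simp [fits_nat]

theorem const (n : ℕ) (hn : n ≤ 1000 := by norm_num) : Comp D fun _ _ => n := by
  induction n with
  | zero => exact zero
  | succ n ih => exact (ih (by omega)).succ fun I a _ => I.lt_cap_of_le hn

/-- Repeat `F` as often as `c` says. -/
theorem iterate {E : Problem → α × β → Prop} {F : Problem → α × β → β} {c : Problem → α → ℕ}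
    {b : Problem → α → β} (hF : Comp E F) (hc : Comp D c) (hb : Comp D b)
    (h : ∀ I a, D I a → ∀ j < c I a, E I (a, (fun y => F I (a, y))^[j] (b I a))) :
    Comp D fun I a => (fun y => F I (a, y))^[c I a] (b I a) := by
  -- The loop value consists of the number of rounds left, the unchanged parameter, and the current
  -- iterate.
  have h₁ : Comp D fun I a => (c I a, (a, b I a)) := hc.pair (id.pair hb)
  have h₂ : Comp (fun I s => ∃ a, D I a ∧ s = (c I a, (a, b I a)))
      fun I (s : ℕ × (α × β)) => (0, (s.2.1, (fun y => F I (s.2.1, y))^[s.1] s.2.2)) := by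
    refine loop (E := fun I s => ∀ j < s.1, E I (s.2.1, (fun y => F I (s.2.1, y))^[j] s.2.2))
      (c := fun _ s => s.1) (f := fun I s => (s.1 - 1, (s.2.1, F I s.2))) fst
      ((pred fst).pair (snd.left.pair
        (hF.comp snd fun I s hs => hs.1 0 (Nat.pos_of_ne_zero hs.2)))) ?_
    rintro I _ ⟨a, ha, rfl⟩
    have hE := h I a ha
    generalize b I a = y at hE
    generalize c I a = n at hE
    induction n generalizing y with
    | zero => exact .halt (fun j hj => absurd hj (Nat.not_lt_zero j)) rfl
    | succ n ih =>
      exact .step hE (Nat.succ_ne_zero n) (ih _ fun j hj => hE (j + 1) (by omega))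
  exact (h₂.comp h₁ fun I a ha => ⟨a, ha, rfl⟩).right.right

variable {f g : Problem → α → ℕ}

theorem add (hf : Comp D f) (hg : Comp D g) (h : ∀ I a, D I a → f I a + g I a < I.cap) :
    Comp D fun I a => f I a + g I a := by
  have hit : ∀ (j y : ℕ), (fun y => y + 1)^[j] y = y + j := fun j y => by
    rw [Nat.succ_iterate]
  refine (iterate (E := fun I s => s.2 + 1 < I.cap) (F := fun _ s => s.2 + 1)
    (snd.succ fun I s hs => hs) hg hf fun I a ha j hj => ?_).of_eq fun I a _ => hit _ _
  have := h I a ha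
  simp only [hit]
  omega

theorem mul (hf : Comp D f) (hg : Comp D g) (h : ∀ I a, D I a → f I a * g I a < I.cap) :
    Comp D fun I a => f I a * g I a := by
  have hit : ∀ (j k : ℕ), (fun y => y + k)^[j] 0 = k * j := fun j k => by
    induction j with
    | zero => rfl
    | succ j ih => rw [Function.iterate_succ_apply', ih]; ring
  refine (iterate (E := fun I s => D I s.1 ∧ s.2 + f I s.1 < I.cap) (F := fun I s => s.2 + f I s.1)
    (snd.add (hf.comp fst fun I s hs => hs.1) fun I s hs => hs.2) hg zero
    fun I a ha j hj => ⟨ha, ?_⟩).of_eq fun I a _ => hit (g I a) (f I a)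
  have h₁ := h I a ha
  have h₂ : f I a * (j + 1) ≤ f I a * g I a := Nat.mul_le_mul_left _ hj
  simp only [hit]
  rw [mul_add] at h₂
  omega

theorem sub (hf : Comp D f) (hg : Comp D g) : Comp D fun I a => f I a - g I a := by
  have hit : ∀ (j y : ℕ), (fun y => y - 1)^[j] y = y - j := fun j y => by
    induction j with
    | zero => rfl
    | succ j ih => rw [Function.iterate_succ_apply', ih]; omega
  exact (iterate (E := fun I s => True) (F := fun _ s => s.2 - 1)
    (pred snd) hg hf fun I a ha j hj => trivial).of_eq fun I a _ => hit _ _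

theorem two_pow (hf : Comp D f) (h : ∀ I a, D I a → 2 ^ f I a < I.cap) :
    Comp D fun I a => 2 ^ f I a := by
  have hit : ∀ (j : ℕ), (fun y => y + y)^[j] 1 = 2 ^ j := fun j => by
    induction j with
    | zero => rfl
    | succ j ih => rw [Function.iterate_succ_apply', ih]; ring
  refine (iterate (E := fun I s => s.2 + s.2 < I.cap) (F := fun _ s => s.2 + s.2)
    (snd.add snd fun I s hs => hs) hf (const 1) fun I a ha j hj => ?_).of_eq fun I a _ => hit _
  have h₁ := h I a ha
  have h₂ : 2 ^ (j + 1) ≤ 2 ^ f I a := Nat.pow_le_pow_right (by omega) hj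
  simp only [hit]
  rw [pow_succ] at h₂
  omega

end Comp

open Classical in
/-- Predicates that are decided by register programs. -/
def Dec {α : Type} [Reg α] (D : Problem → α → Prop) (φ : Problem → α → Prop) : Prop :=
  Comp D fun I a => if φ I a then 1 else 0

namespace Dec

variable {α β : Type} [Reg α] [Reg β] {D : Problem → α → Prop} {φ ψ : Problem → α → Prop}
  {f g : Problem → α → ℕ}

theorem of_iff (hφ : Dec D φ) (h : ∀ I a, D I a → (φ I a ↔ ψ I a)) : Dec D ψ :=
  Comp.of_eq hφ fun I a hD => by rw [propext (h I a hD)]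

theorem mono {D' : Problem → α → Prop} (hφ : Dec D' φ) (h : ∀ I a, D I a → D' I a) : Dec D φ :=
  Comp.mono hφ h

theorem comp {E : Problem → β → Prop} {φ : Problem → β → Prop} {f : Problem → α → β}
    (hφ : Dec E φ) (hf : Comp D f) (hE : ∀ I a, D I a → E I (f I a)) :
    Dec D fun I a => φ I (f I a) :=
  Comp.comp hφ hf hE

theorem ne_zero (hf : Comp D f) : Dec D fun I a => f I a ≠ 0 :=
  (Comp.ite hf (Comp.const 1) (Comp.const 0)).of_eq fun I a _ => by
    by_cases h : f I a = 0 <;> simp [h]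

open Classical in
theorem ite {f g : Problem → α → β} (hφ : Dec D φ) (hf : Comp (fun I a => D I a ∧ φ I a) f)
    (hg : Comp (fun I a => D I a ∧ ¬ φ I a) g) :
    Comp D fun I a => if φ I a then f I a else g I a :=
  (Comp.ite hφ (hf.mono fun I a h => ⟨h.1, by simpa using h.2⟩)
    (hg.mono fun I a h => ⟨h.1, by simpa using h.2⟩)).of_eq fun I a _ => by
      by_cases h : φ I a <;> simp [h]

theorem not (hφ : Dec D φ) : Dec D fun I a => ¬ φ I a :=
  (ite hφ (Comp.const 0) (Comp.const 1)).of_eq fun I a _ => by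
    by_cases h : φ I a <;> simp [h]

/-- The second test is evaluated only where the first succeeds, so its precondition may include `φ`.
-/
theorem and (hφ : Dec D φ) (hψ : Dec (fun I a => D I a ∧ φ I a) ψ) :
    Dec D fun I a => φ I a ∧ ψ I a :=
  (ite hφ hψ (Comp.const 0)).of_eq fun I a _ => by
    by_cases h : φ I a <;> by_cases h' : ψ I a <;> simp [h, h']

theorem imp (hφ : Dec D φ) (hψ : Dec (fun I a => D I a ∧ φ I a) ψ) :
    Dec D fun I a => φ I a → ψ I a :=
  (ite hφ hψ (Comp.const 1)).of_eq fun I a _ => by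
    by_cases h : φ I a <;> by_cases h' : ψ I a <;> simp [h, h']

theorem or (hφ : Dec D φ) (hψ : Dec D ψ) : Dec D fun I a => φ I a ∨ ψ I a :=
  (hφ.not.imp (hψ.mono fun I a h => h.1)).of_iff fun I a _ => by tauto

theorem iff (hφ : Dec D φ) (hψ : Dec D ψ) : Dec D fun I a => (φ I a ↔ ψ I a) :=
  ((hφ.imp (hψ.mono fun I a h => h.1)).and
    ((hψ.imp (hφ.mono fun I a h => h.1)).mono fun I a h => h.1)).of_iff fun I a _ => by tauto

theorem lt (hf : Comp D f) (hg : Comp D g) : Dec D fun I a => f I a < g I a :=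
  (ne_zero (hg.sub hf)).of_iff fun I a _ => by omega

theorem le (hf : Comp D f) (hg : Comp D g) : Dec D fun I a => f I a ≤ g I a :=
  (lt hg hf).not.of_iff fun _ _ _ => not_lt

theorem eq (hf : Comp D f) (hg : Comp D g) : Dec D fun I a => f I a = g I a :=
  ((le hf hg).and ((le hg hf).mono fun _ _ h => h.1)).of_iff fun _ _ _ => le_antisymm_iff.symm

open Classical in
/-- Bounded quantification. -/
theorem ex {φ : Problem → α × ℕ → Prop} (hf : Comp D f)
    (hφ : Dec (fun I s => D I s.1 ∧ s.2 < f I s.1) φ) (h : ∀ I a, D I a → f I a < I.cap) :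
    Dec D fun I a => ∃ i < f I a, φ I (a, i) := by
  -- All candidates are tried without an early stop, with a counter and a flag for success so far.
  have hit : ∀ (P : ℕ → Prop) (j : ℕ), (fun y : ℕ × ℕ => (y.1 + 1, if P y.1 then 1 else y.2))^[j]
      (0, 0) = (j, if ∃ i < j, P i then 1 else 0) := fun P j => by
    induction j with
    | zero => simp
    | succ j ih =>
      rw [Function.iterate_succ_apply', ih]
      by_cases hj : P j
      · simp only [hj, if_true, Prod.mk.injEq, true_and]
        rw [if_pos ⟨j, Nat.lt_succ_self j, hj⟩]
      · simp only [hj, if_false, Prod.mk.injEq, true_and]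
        congr 1
        refine propext ⟨fun ⟨i, hi, h⟩ => ⟨i, by omega, h⟩, fun ⟨i, hi, h⟩ => ⟨i, ?_, h⟩⟩
        have : i ≠ j := fun hij => hj (hij ▸ h)
        omega
  have hF : Comp (fun I (s : α × (ℕ × ℕ)) => D I s.1 ∧ s.2.1 < f I s.1)
      fun I s => (s.2.1 + 1, if φ I (s.1, s.2.1) then 1 else s.2.2) := by
    have h₁ : Comp (fun I (s : α × (ℕ × ℕ)) => D I s.1 ∧ s.2.1 < f I s.1) fun _ s => s.2.1 :=
      Comp.snd.left
    refine (h₁.succ fun I s hs => lt_of_le_of_lt hs.2 (h I s.1 hs.1)).pair (ite ?_ (Comp.const 1)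
      Comp.snd.right)
    exact hφ.comp (Comp.fst.pair h₁) fun I s hs => hs
  refine (Comp.iterate hF hf ((Comp.const 0).pair (Comp.const 0))
    fun I a ha j hj => ?_).right.of_eq fun I a _ => ?_
  · exact ⟨ha, (congrArg Prod.fst (hit (fun i => φ I (a, i)) j)).trans_lt hj⟩
  · refine (congrArg Prod.snd (hit (fun i => φ I (a, i)) _)).trans ?_
    dsimp only
    congr

theorem all {φ : Problem → α × ℕ → Prop} (hf : Comp D f)
    (hφ : Dec (fun I s => D I s.1 ∧ s.2 < f I s.1) φ) (h : ∀ I a, D I a → f I a < I.cap) :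
    Dec D fun I a => ∀ i < f I a, φ I (a, i) :=
  (ex hf hφ.not h).not.of_iff fun I a _ => by push Not; rfl

end Dec

namespace Comp

variable {α : Type} [Reg α] {D : Problem → α → Prop} {f g : Problem → α → ℕ}

/-- Count up to `f I a`, keeping quotient and remainder up to date; time is irrelevant here, and
both stay below the cap. -/
theorem divMod (hf : Comp D f) (hg : Comp D g) (hf' : ∀ I a, D I a → f I a < I.cap)
    (hg' : ∀ I a, D I a → 0 < g I a ∧ g I a < I.cap) :
    Comp D fun I a => (f I a / g I a, f I a % g I a) := by
  have hit : ∀ d, 0 < d → ∀ j, (fun y : ℕ × ℕ => if y.2 + 1 = d then (y.1 + 1, 0) else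
      (y.1, y.2 + 1))^[j] (0, 0) = (j / d, j % d) := fun d hd j => by
    induction j with
    | zero => simp
    | succ j ih =>
      rw [Function.iterate_succ_apply', ih]
      have h₁ := Nat.div_add_mod j d
      have h₂ := Nat.mod_lt j hd
      by_cases h : j % d + 1 = d
      · have h₃ : j + 1 = (j / d + 1) * d := by rw [add_mul, one_mul, mul_comm]; omega
        rw [if_pos h, h₃, Nat.mul_div_cancel _ hd, Nat.mul_mod_left]
      · have h₃ : j + 1 = (j % d + 1) + d * (j / d) := by omega
        have h₄ : j % d + 1 < d := by omega
        rw [if_neg h, h₃, Nat.add_mul_div_left _ _ hd, Nat.add_mul_mod_self_left,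
          Nat.div_eq_of_lt h₄, Nat.mod_eq_of_lt h₄, zero_add]
  have h₁ : Comp (fun I (s : α × (ℕ × ℕ)) => D I s.1 ∧ s.2.1 + 1 < I.cap ∧ s.2.2 < g I s.1)
      fun I s => if s.2.2 + 1 = g I s.1 then (s.2.1 + 1, 0) else (s.2.1, s.2.2 + 1) := by
    have hq : Comp (fun I (s : α × (ℕ × ℕ)) => D I s.1 ∧ s.2.1 + 1 < I.cap ∧ s.2.2 < g I s.1)
      fun I s => s.2.1 := snd.left
    have hr : Comp (fun I (s : α × (ℕ × ℕ)) => D I s.1 ∧ s.2.1 + 1 < I.cap ∧ s.2.2 < g I s.1)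
      fun I s => s.2.2 + 1 := snd.right.succ
        fun I s hs => by have := hg' I s.1 hs.1; have := hs.2.2; show s.2.2 + 1 < _; omega
    exact (Dec.ite (Dec.eq hr (hg.comp fst fun I s hs => hs.1))
      (((hq.succ fun I s hs => hs.2.1).pair zero).mono fun I s hs => hs.1)
      ((hq.pair hr).mono fun I s hs => hs.1)).of_eq fun I s _ => by congr
  refine (iterate h₁ hf (zero.pair zero) fun I a ha j hj => ⟨ha, ?_⟩).of_eq
    fun I a ha => hit _ (hg' I a ha).1 _
  rw [hit _ (hg' I a ha).1]
  have h₁ := Nat.div_le_self j (g I a)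
  have h₂ := hf' I a ha
  exact ⟨by show j / g I a + 1 < _; omega, Nat.mod_lt _ (hg' I a ha).1⟩

theorem div (hf : Comp D f) (hg : Comp D g) (hf' : ∀ I a, D I a → f I a < I.cap)
    (hg' : ∀ I a, D I a → 0 < g I a ∧ g I a < I.cap) : Comp D fun I a => f I a / g I a :=
  (divMod hf hg hf' hg').left

theorem mod (hf : Comp D f) (hg : Comp D g) (hf' : ∀ I a, D I a → f I a < I.cap)
    (hg' : ∀ I a, D I a → 0 < g I a ∧ g I a < I.cap) : Comp D fun I a => f I a % g I a :=
  (divMod hf hg hf' hg').right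

end Comp

theorem Dec.testBit {α : Type} [Reg α] {D : Problem → α → Prop} {f g : Problem → α → ℕ}
    (hf : Comp D f) (hg : Comp D g) (hf' : ∀ I a, D I a → f I a < I.cap) :
    Dec D fun I a => (f I a).testBit (g I a) = true := by
  have hit : ∀ j x : ℕ, (fun y => y / 2)^[j] x = x / 2 ^ j := fun j x => by
    induction j with
    | zero => simp
    | succ j ih => rw [Function.iterate_succ_apply', ih, Nat.div_div_eq_div_mul, pow_succ]
  have h₁ : Comp D fun I a => f I a / 2 ^ g I a :=
    (Comp.iterate (E := fun I s => s.2 < I.cap) (F := fun _ s => s.2 / 2)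
      (Comp.div Comp.snd (Comp.const 2) (fun _ _ h => h)
        fun I _ _ => ⟨by omega, I.lt_cap_of_le (by omega)⟩) hg hf
      fun I a ha j _ => by
        simp only [hit]
        exact lt_of_le_of_lt (Nat.div_le_self _ _) (hf' I a ha)).of_eq fun I a _ => hit _ _
  refine (Dec.eq (Comp.mod h₁ (Comp.const 2) (fun I a ha => lt_of_le_of_lt (Nat.div_le_self _ _)
    (hf' I a ha)) fun I _ _ => ⟨by omega, I.lt_cap_of_le (by omega)⟩) (Comp.const 1)).of_iff
    fun I a _ => ?_
  rw [Nat.testBit_eq_decide_div_mod_eq, decide_eq_true_eq]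

end Braid

namespace Braid

open Reg

/-! ### Reachability by Savitch's algorithm -/

/-- `v` is reached from `u` in at most `2 ^ k` steps, through numbers below `n`. -/
def Within (R : ℕ → ℕ → Prop) (n : ℕ) : ℕ → ℕ → ℕ → Prop
  | 0, u, v => u = v ∨ R u v
  | k + 1, u, v => ∃ m < n, Within R n k u m ∧ Within R n k m v

namespace Savitch

/-- The subproblem with the address `p`, a number with `d` digits in base `2 * n`. A digit
`2 * m` stands for the first half of a path through `m`, and `2 * m + 1` for the second half. -/
def ends (n u v : ℕ) : ℕ → ℕ → ℕ × ℕ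
  | 0, _ => (u, v)
  | d + 1, p =>
    if p % (2 * n) % 2 = 0 then ((ends n u v d (p / (2 * n))).1, p % (2 * n) / 2)
    else (p % (2 * n) / 2, (ends n u v d (p / (2 * n))).2)

theorem ends_lt {n u v : ℕ} (hu : u < n) (hv : v < n) :
    ∀ d p, (ends n u v d p).1 < n ∧ (ends n u v d p).2 < n
  | 0, _ => ⟨hu, hv⟩
  | d + 1, p => by
    have h₁ := ends_lt hu hv d (p / (2 * n))
    have h₂ : p % (2 * n) < 2 * n := Nat.mod_lt _ (by omega)
    rw [ends]
    split
    · exact ⟨h₁.1, by show _ / 2 < n; omega⟩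
    · exact ⟨by show _ / 2 < n; omega, h₁.2⟩

/-- One digit of the computation of `ends`, least significant digit first; the value `n` stands
for an end that is not known yet. -/
def scanDigit (n : ℕ) (s : ℕ × (ℕ × ℕ)) : ℕ × (ℕ × ℕ) :=
  (s.1 / (2 * n), if s.1 % (2 * n) % 2 = 0 then
      (s.2.1, if s.2.2 = n then s.1 % (2 * n) / 2 else s.2.2)
    else (if s.2.1 = n then s.1 % (2 * n) / 2 else s.2.1, s.2.2))

/-- Each end of a subproblem is fixed by the deepest digit of the right parity, so the first value
found from the least significant digit on is the valid one. An end that is never found is that of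
the whole problem. -/
theorem scanDigit_iterate {n : ℕ} (hn : 0 < n) (u v : ℕ) : ∀ (d p U V : ℕ),
    (let r := (scanDigit n)^[d] (p, (U, V))
    (if r.2.1 = n then u else r.2.1, if r.2.2 = n then v else r.2.2)) =
      (if U = n then (ends n u v d p).1 else U, if V = n then (ends n u v d p).2 else V)
  | 0, p, U, V => rfl
  | d + 1, p, U, V => by
    have h₂ : p % (2 * n) / 2 ≠ n := by
      have : p % (2 * n) < 2 * n := Nat.mod_lt _ (by omega)
      omega
    rw [Function.iterate_succ_apply]
    by_cases h : p % (2 * n) % 2 = 0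
    · simp only [scanDigit, ends, h, if_true]
      rw [scanDigit_iterate hn u v d]
      by_cases hV : V = n <;> simp [hV, h₂]
    · simp only [scanDigit, ends, h, if_false]
      rw [scanDigit_iterate hn u v d]
      by_cases hU : U = n <;> simp [hU, h₂]

theorem scanDigit_iterate_fst_le (n : ℕ) : ∀ (d : ℕ) (s : ℕ × (ℕ × ℕ)),
    ((scanDigit n)^[d] s).1 ≤ s.1
  | 0, s => le_rfl
  | d + 1, s => by
    rw [Function.iterate_succ_apply]
    exact (scanDigit_iterate_fst_le n d _).trans (Nat.div_le_self _ _)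

open Classical in
/-- A step of the depth-first evaluation. A state consists of a mode (`0`: evaluate, `1`: the result
is true, `2`: the result is false), the level and the address of a subproblem. -/
noncomputable def step (leaf : ℕ → Prop) (n : ℕ) (s : ℕ × (ℕ × ℕ)) : ℕ × (ℕ × ℕ) :=
  if s.1 = 0 then
    if s.2.1 = 0 then (if leaf s.2.2 then 1 else 2, (s.2.1, s.2.2))
    else (0, (s.2.1 - 1, s.2.2 * (2 * n)))
  else if s.1 = 1 then
    if s.2.2 % 2 = 0 then (0, (s.2.1, s.2.2 + 1)) else (1, (s.2.1 + 1, s.2.2 / (2 * n)))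
  else
    if s.2.2 % (2 * n) / 2 + 1 < n then (0, (s.2.1, s.2.2 - s.2.2 % 2 + 2))
    else (2, (s.2.1 + 1, s.2.2 / (2 * n)))

/-- The evaluation stops with a result on the top level. -/
def running (K : ℕ) (s : ℕ × (ℕ × ℕ)) : ℕ := if s.1 ≠ 0 ∧ s.2.1 = K then 0 else 1

/-- At level `j` the address has `K - j` digits in base `2 * n`. It replaces a recursion stack, and
this invariant is the source of the quadratic logarithmic space. -/
def Valid (n K : ℕ) (s : ℕ × (ℕ × ℕ)) : Prop := s.2.1 ≤ K ∧ s.2.2 < (2 * n) ^ (K - s.2.1)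

theorem add_mul_lt {n q p c : ℕ} (hp : p < (2 * n) ^ q) (hc : c < 2 * n) :
    p * (2 * n) + c < (2 * n) ^ (q + 1) := by
  have : (p + 1) * (2 * n) ≤ (2 * n) ^ q * (2 * n) := Nat.mul_le_mul_right _ hp
  rw [pow_succ]
  rw [add_mul, one_mul] at this
  omega

open Classical in
-- The form is continuation passing: whatever the loop does after the result of a subproblem has
-- been delivered, it also does when started on the subproblem. This lets the two recursive calls be
-- chained although the loop has no stack.
theorem loops_call {R : ℕ → ℕ → Prop} {n K u v : ℕ} {leaf : ℕ → Prop} (hn : 0 < n)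
    (hleaf : ∀ p, leaf p ↔ Within R n 0 (ends n u v K p).1 (ends n u v K p).2)
    {out : ℕ × (ℕ × ℕ)} : ∀ (j p : ℕ), j ≤ K → p < (2 * n) ^ (K - j) →
    Loops (Valid n K) (running K) (step leaf n)
      (if Within R n j (ends n u v (K - j) p).1 (ends n u v (K - j) p).2 then 1 else 2, (j, p))
      out → Loops (Valid n K) (running K) (step leaf n) (0, (j, p)) out
  | 0, p, hj, hp, h => by
    refine .step ⟨hj, hp⟩ (by simp [running]) ?_
    simpa [step, hleaf p] using h
  | j + 1, p, hj, hp, h => by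
    have hK : K - j = (K - (j + 1)) + 1 := by omega
    set U := (ends n u v (K - (j + 1)) p).1 with hU
    set V := (ends n u v (K - (j + 1)) p).2 with hV
    have hdiv : ∀ c < 2 * n, (p * (2 * n) + c) / (2 * n) = p := fun c hc => by
      rw [mul_comm, Nat.mul_add_div (by omega), Nat.div_eq_of_lt hc, add_zero]
    have hmod : ∀ c < 2 * n, (p * (2 * n) + c) % (2 * n) = c := fun c hc => by
      rw [mul_comm, Nat.mul_add_mod, Nat.mod_eq_of_lt hc]
    -- The base is even, so the parity of the address shows which half is being evaluated.
    have hpar : ∀ c, (p * (2 * n) + c) % 2 = c % 2 := fun c => by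
      rw [show p * (2 * n) + c = 2 * (p * n) + c by ring, Nat.mul_add_mod]
    have hvalid : ∀ md, ∀ c < 2 * n, Valid n K (md, (j, p * (2 * n) + c)) := fun md c hc => by
      refine ⟨by show j ≤ K; omega, ?_⟩
      show _ < (2 * n) ^ (K - j)
      rw [hK]
      exact add_mul_lt hp hc
    have hrun : ∀ md p', running K (md, (j, p')) ≠ 0 := fun md p' => by
      have : j ≠ K := by omega
      simp [running, this]
    have hfirst : ∀ m < n, ends n u v (K - j) (p * (2 * n) + 2 * m) = (U, m) := fun m hm => by
      rw [hK, ends, hmod _ (by omega), hdiv _ (by omega), if_pos (by omega)]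
      simp [hU]
    have hsecond : ∀ m < n, ends n u v (K - j) (p * (2 * n) + (2 * m + 1)) = (m, V) := fun m hm => by
      rw [hK, ends, hmod _ (by omega), hdiv _ (by omega), if_neg (by omega)]
      rw [show (2 * m + 1) / 2 = m by omega]
    have attempt : ∀ m < n, (¬ (Within R n j U m ∧ Within R n j m V) → ∀ c < 2 * n, c / 2 = m →
          Loops (Valid n K) (running K) (step leaf n) (2, (j, p * (2 * n) + c)) out) →
        Loops (Valid n K) (running K) (step leaf n) (0, (j, p * (2 * n) + 2 * m)) out := by
      intro m hm hfail
      refine loops_call hn hleaf j _ (by omega) (hvalid 0 (2 * m) (by omega)).2 ?_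
      rw [hfirst m hm]
      by_cases h₁ : Within R n j U m
      · rw [if_pos h₁]
        refine .step (hvalid _ _ (by omega)) (hrun _ _) ?_
        simp only [step, hpar, one_ne_zero, if_false, if_true, Nat.mul_mod_right]
        refine loops_call hn hleaf j _ (by omega) (hvalid 0 (2 * m + 1) (by omega)).2 ?_
        rw [add_assoc, hsecond m hm]
        by_cases h₂ : Within R n j m V
        · rw [if_pos h₂]
          refine .step (hvalid _ _ (by omega)) (hrun _ _) ?_
          rw [if_pos ⟨m, hm, h₁, h₂⟩] at h
          simpa [step, hpar, hdiv (2 * m + 1) (by omega), Nat.mul_add_mod] using h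
        · rw [if_neg h₂]
          exact hfail (fun h' => h₂ h'.2) _ (by omega) (by omega)
      · rw [if_neg h₁]
        exact hfail (fun h' => h₁ h'.1) _ (by omega) (by omega)
    -- Induction on the number `i` of midpoints still to come after `m`, given that all earlier ones
    -- have failed.
    have key : ∀ i m, m + i + 1 = n → (∀ m' < m, ¬ (Within R n j U m' ∧ Within R n j m' V)) →
        Loops (Valid n K) (running K) (step leaf n) (0, (j, p * (2 * n) + 2 * m)) out := by
      intro i
      induction i with
      | zero =>
        intro m hm hnot
        refine attempt m (by omega) fun hm' c hc hcm => ?_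
        refine .step (hvalid _ _ hc) (hrun _ _) ?_
        have hno : ¬ Within R n (j + 1) U V := by
          rintro ⟨m', hm'', hw⟩
          rcases Nat.lt_or_ge m' m with hlt | hge
          · exact hnot m' hlt hw
          · obtain rfl : m' = m := by omega
            exact hm' hw
        rw [if_neg hno] at h
        simpa [step, hmod c hc, hdiv c hc, show ¬ c / 2 + 1 < n by omega] using h
      | succ i ih =>
        intro m hm hnot
        refine attempt m (by omega) fun hm' c hc hcm => ?_
        refine .step (hvalid _ _ hc) (hrun _ _) ?_
        have := ih (m + 1) (by omega) (fun m' hm'' => by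
          rcases Nat.lt_or_ge m' m with hlt | hge
          · exact hnot m' hlt
          · obtain rfl : m' = m := by omega
            exact hm')
        have hc' : p * (2 * n) + c - c % 2 + 2 = p * (2 * n) + 2 * (m + 1) := by omega
        simpa [step, hmod c hc, hpar, show c / 2 + 1 < n by omega, hc'] using this
    refine .step ⟨hj, hp⟩ (by simp [running]) ?_
    simpa [step] using key (n - 1) 0 (by omega) (by omega)

end Savitch

theorem Loops.map {α β : Type} {E : α → Prop} {E' : β → Prop} {c : α → ℕ} {c' : β → ℕ}
    {f : α → α} {f' : β → β} {g : α → β} (hE : ∀ a, E a → E' (g a)) (hc : ∀ a, c' (g a) = c a)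
    (hf : ∀ a, f' (g a) = g (f a)) {a b : α} (h : Loops E c f a b) :
    Loops E' c' f' (g a) (g b) := by
  induction h with
  | halt h₁ h₂ => exact .halt (hE _ h₁) ((hc _).trans h₂)
  | step h₁ h₂ _ ih => exact .step (hE _ h₁) (by rwa [hc]) (by rwa [hf])

/-! ### Savitch's search as a register program -/

namespace Dec

open Savitch

variable {α : Type} [Reg α] {D : Problem → α → Prop} {n K u v : Problem → α → ℕ}

theorem comp_ends (hn : Comp D n) (hK : Comp D K) (hu : Comp D u) (hv : Comp D v)
    (h : ∀ I a, D I a → 0 < n I a ∧ 2 * n I a < I.cap) :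
    Comp (fun I (s : α × ℕ) => D I s.1 ∧ s.2 < I.cap)
      fun I s => ends (n I s.1) (u I s.1) (v I s.1) (K I s.1) s.2 := by
  have hF : Comp (fun I (s : (α × ℕ) × (ℕ × (ℕ × ℕ))) => D I s.1.1 ∧ s.2.1 < I.cap)
      fun I s => scanDigit (n I s.1.1) s.2 := by
    have hn' : Comp (fun I (s : (α × ℕ) × (ℕ × (ℕ × ℕ))) => D I s.1.1 ∧ s.2.1 < I.cap)
        fun I s => n I s.1.1 := hn.comp Comp.fst.left fun I s hs => hs.1
    have h2n := Comp.mul (Comp.const 2) hn' fun I s hs => (h I s.1.1 hs.1).2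
    have hb : ∀ I (s : (α × ℕ) × (ℕ × (ℕ × ℕ))), D I s.1.1 ∧ s.2.1 < I.cap →
        0 < 2 * n I s.1.1 ∧ 2 * n I s.1.1 < I.cap := fun I s hs => by
      have := h I s.1.1 hs.1; omega
    have hmod := Comp.mod Comp.snd.left h2n (fun I s hs => hs.2) hb
    have hmod_lt : ∀ I (s : (α × ℕ) × (ℕ × (ℕ × ℕ))), D I s.1.1 ∧ s.2.1 < I.cap →
        s.2.1 % (2 * n I s.1.1) < I.cap := fun I s hs => (Nat.mod_le _ _).trans_lt hs.2
    have htwo : ∀ I (s : (α × ℕ) × (ℕ × (ℕ × ℕ))), D I s.1.1 ∧ s.2.1 < I.cap →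
        0 < 2 ∧ 2 < I.cap := fun I s _ => ⟨by omega, I.lt_cap_of_le (by omega)⟩
    have hhalf := Comp.div hmod (Comp.const 2) hmod_lt htwo
    refine ((Comp.div Comp.snd.left h2n (fun I s hs => hs.2) hb).pair (ite
      (Dec.eq (Comp.mod hmod (Comp.const 2) hmod_lt htwo) (Comp.const 0))
      (Comp.mono (Comp.snd.right.left.pair
        (ite (Dec.eq Comp.snd.right.right hn')
          (hhalf.mono fun I s hs => hs.1) Comp.snd.right.right)) fun I s hs => hs.1)
      (Comp.mono ((ite (Dec.eq Comp.snd.right.left hn')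
          (hhalf.mono fun I s hs => hs.1) Comp.snd.right.left).pair Comp.snd.right.right)
        fun I s hs => hs.1))).of_eq fun I s hs => ?_
    simp only [scanDigit]
    congr
  have hD : ∀ {γ : Type} [Reg γ] {f : Problem → α → γ}, Comp D f →
      Comp (fun I (s : α × ℕ) => D I s.1 ∧ s.2 < I.cap) fun I s => f I s.1 :=
    fun hf => hf.comp Comp.fst fun I s hs => hs.1
  have hit := Comp.iterate hF (hD hK) (Comp.snd.pair ((hD hn).pair (hD hn)))
    fun I s hs j _ => ⟨hs.1, lt_of_le_of_lt (scanDigit_iterate_fst_le (n I s.1) j _) hs.2⟩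
  refine ((ite (Dec.eq hit.right.left (hD hn)) ((hD hu).mono fun I s hs => hs.1)
    (hit.right.left.mono fun I s hs => hs.1)).pair
    (ite (Dec.eq hit.right.right (hD hn)) ((hD hv).mono fun I s hs => hs.1)
    (hit.right.right.mono fun I s hs => hs.1))).of_eq fun I s hs => ?_
  have := scanDigit_iterate (h I s.1 hs.1).1 (u I s.1) (v I s.1) (K I s.1) s.2 (n I s.1) (n I s.1)
  simp only [if_true] at this
  refine Eq.trans ?_ this
  congr

theorem within {φ : Problem → α × (ℕ × ℕ) → Prop} (hn : Comp D n) (hK : Comp D K) (hu : Comp D u)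
    (hv : Comp D v) (hφ : Dec (fun I s => D I s.1 ∧ s.2.1 < n I s.1 ∧ s.2.2 < n I s.1) φ)
    (h : ∀ I a, D I a → u I a < n I a ∧ v I a < n I a ∧ 2 * n I a < I.cap ∧ K I a + 1 < I.cap ∧
      (2 * n I a) ^ K I a + 2 < I.cap) :
    Dec D fun I a => Within (fun x y => φ I (a, (x, y))) (n I a) (K I a) (u I a) (v I a) := by
  classical
  have hn0 : ∀ I a, D I a → 0 < n I a := fun I a ha => (Nat.zero_le _).trans_lt (h I a ha).1
  have hends := comp_ends hn hK hu hv fun I a ha => ⟨hn0 I a ha, (h I a ha).2.2.1⟩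
  let leaf : Problem → α → ℕ → Prop := fun I a p =>
    Within (fun x y => φ I (a, (x, y))) (n I a) 0 (ends (n I a) (u I a) (v I a) (K I a) p).1
      (ends (n I a) (u I a) (v I a) (K I a) p).2
  have hleaf : Dec (fun I (s : α × ℕ) => D I s.1 ∧ s.2 < I.cap) fun I s => leaf I s.1 s.2 :=
    or (Dec.eq hends.left hends.right) (hφ.comp (Comp.fst.pair hends) fun I s hs =>
      ⟨hs.1, (ends_lt (h I s.1 hs.1).1 (h I s.1 hs.1).2.1 _ _)⟩)
  let E : Problem → α × (ℕ × (ℕ × ℕ)) → Prop := fun I s =>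
    D I s.1 ∧ Valid (n I s.1) (K I s.1) s.2
  -- The slack of two pays for moving on to the next midpoint, which adds at most two to the
  -- address.
  have hpow : ∀ I (s : α × (ℕ × (ℕ × ℕ))), E I s → s.2.2.2 + 2 < I.cap := fun I s hs => by
    have h₁ := (h I s.1 hs.1).2.2.2.2
    have h₂ : (2 * n I s.1) ^ (K I s.1 - s.2.2.1) ≤ (2 * n I s.1) ^ K I s.1 :=
      Nat.pow_le_pow_right (by have := hn0 I s.1 hs.1; omega) (Nat.sub_le _ _)
    have := hs.2.2
    omega
  have hD : ∀ {γ : Type} [Reg γ] {f : Problem → α → γ}, Comp D f →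
      Comp E fun I s => f I s.1 :=
    fun hf => hf.comp Comp.fst fun I s hs => hs.1
  have hmd : Comp E fun _ s => s.2.1 := Comp.snd.left
  have hj : Comp E fun _ s => s.2.2.1 := Comp.snd.right.left
  have hp : Comp E fun _ s => s.2.2.2 := Comp.snd.right.right
  have h2n := Comp.mul (Comp.const 2) (hD hn) fun I s hs => (h I s.1 hs.1).2.2.1
  have hb : ∀ I s, E I s → 0 < 2 * n I s.1 ∧ 2 * n I s.1 < I.cap := fun I s hs => by
    have := h I s.1 hs.1; have := hn0 I s.1 hs.1; omega
  have hp' : ∀ I s, E I s → s.2.2.2 < I.cap := fun I s hs => by have := hpow I s hs; omega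
  have htwo : ∀ I s, E I s → 0 < 2 ∧ 2 < I.cap :=
    fun I s _ => ⟨by omega, I.lt_cap_of_le (by omega)⟩
  have hup : Comp E fun I s => (s.2.2.1 + 1, s.2.2.2 / (2 * n I s.1)) :=
    (hj.succ fun I s hs => by
      have h₁ := (h I s.1 hs.1).2.2.2.1
      have h₂ : s.2.2.1 ≤ K I s.1 := hs.2.1
      omega).pair (hp.div h2n hp' hb)
  have hpar := hp.mod (Comp.const 2) hp' htwo
  have hstep : Comp E fun I s => (s.1, step (leaf I s.1) (n I s.1) s.2) := by
    refine Comp.fst.pair ?_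
    refine (ite (Dec.eq hmd (Comp.const 0)) (ite ((Dec.eq hj (Comp.const 0)).mono fun I s hs => hs.1)
        (Comp.mono ((ite (hleaf.comp (Comp.fst.pair hp) fun I s hs => ⟨hs.1, hp' I s hs⟩)
          (Comp.const 1) (Comp.const 2)).pair (hj.pair hp)) fun I s hs => hs.1.1)
        ((Comp.const 0).pair ((hj.pred.mono fun I s hs => hs.1.1).pair
          (Comp.mul (hp.mono fun I s hs => hs.1.1) (h2n.mono fun I s hs => hs.1.1)
            fun I s hs => ?_))))
      (ite (Dec.eq (hmd.mono fun I s hs => hs.1) (Comp.const 1))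
        (ite ((Dec.eq hpar (Comp.const 0)).mono fun I s hs => hs.1.1)
          (Comp.mono ((Comp.const 0).pair (hj.pair (hp.succ fun I s hs => by
            have := hpow I s hs; omega))) fun I s hs => hs.1.1.1)
          (((Comp.const 1).pair hup).mono fun I s hs => hs.1.1.1))
        (ite (Dec.lt (Comp.succ (Comp.div (hp.mod h2n hp' hb) (Comp.const 2)
            (fun I s hs => (Nat.mod_le _ _).trans_lt (hp' I s hs)) htwo)
            fun I s hs => ?_) (hD hn) |>.mono fun I s hs => hs.1.1)
          (Comp.mono ((Comp.const 0).pair (hj.pair (Comp.add (hp.sub hpar) (Comp.const 2)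
            fun I s hs => ?_))) fun I s hs => hs.1.1.1)
          (((Comp.const 2).pair hup).mono fun I s hs => hs.1.1.1)))).of_eq fun I s hs => ?_
    · have h₁ := (h I s.1 hs.1.1.1).2.2.2.2
      have h₂ := hs.1.1.2
      have h₃ : s.2.2.1 ≠ 0 := hs.2
      have h₄ := add_mul_lt (c := 0) h₂.2 (hb I s hs.1.1).1
      have h₅ : (2 * n I s.1) ^ (K I s.1 - s.2.2.1 + 1) ≤ (2 * n I s.1) ^ K I s.1 :=
        Nat.pow_le_pow_right (hb I s hs.1.1).1 (by have : s.2.2.1 ≤ K I s.1 := h₂.1; omega)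
      omega
    · have h₁ : s.2.2.2 % (2 * n I s.1) / 2 ≤ s.2.2.2 :=
        (Nat.div_le_self _ _).trans (Nat.mod_le _ _)
      have := hpow I s hs
      omega
    · have := hpow I s hs
      omega
    · simp only [step]
      congr
  have hrun : Comp E fun I s => running (K I s.1) s.2 :=
    (ite ((Dec.eq hmd (Comp.const 0)).not.and ((Dec.eq hj (hD hK)).mono fun I s hs => hs.1))
      (Comp.const 0) (Comp.const 1)).of_eq fun I s hs => by
        simp only [running]
        congr
  have hloop : Comp (fun I (s : α × (ℕ × (ℕ × ℕ))) => D I s.1 ∧ s.2 = (0, (K I s.1, 0)))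
      fun I s => (s.1, (if Within (fun x y => φ I (s.1, (x, y))) (n I s.1) (K I s.1) (u I s.1)
        (v I s.1) then 1 else 2, (K I s.1, 0))) := by
    refine Comp.loop hrun (hstep.mono fun I s hs => hs.1) ?_
    rintro I ⟨a, s⟩ ⟨ha, hs⟩
    obtain rfl : s = (0, (K I a, 0)) := hs
    refine Loops.map (E := Valid (n I a) (K I a)) (c := running (K I a))
      (f := step (leaf I a) (n I a)) (g := fun s => (a, s)) (fun s hs => ⟨ha, hs⟩)
      (fun s => rfl) (fun s => rfl) ?_
    refine loops_call (R := fun x y => φ I (a, (x, y))) (u := u I a) (v := v I a) (hn0 I a ha)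
      (fun p => Iff.rfl) _ _ le_rfl ?_ ?_
    · simp
    · simp only [Nat.sub_self, ends]
      refine .halt ⟨le_rfl, by simp⟩ ?_
      simp only [running]
      split <;> simp_all
  have hres := hloop.comp (D := D) (f := fun I a => (a, (0, (K I a, 0))))
    (Comp.id.pair ((Comp.const 0).pair (hK.pair (Comp.const 0)))) fun I a ha => ⟨ha, rfl⟩
  exact (Dec.eq hres.right.left (Comp.const 1)).of_iff fun I a _ => by
    by_cases h : Within (fun x y => φ I (a, (x, y))) (n I a) (K I a) (u I a) (v I a) <;> simp [h]

end Dec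

end Braid

namespace Braid

open Reg

/-! ### Reading the input -/

/-- The input head is at the beginning of the rest `r` of the input. -/
def Rest (x : List Sym) (p : ℕ) (r : List Sym) : Prop :=
  1 ≤ p ∧ p ≤ x.length + 1 ∧ x.drop (p - 1) = r

theorem Rest.start (x : List Sym) : Rest x 1 x := ⟨le_rfl, by omega, rfl⟩

theorem Rest.cons {x r : List Sym} {p : ℕ} {a : Sym} (h : Rest x p (a :: r)) :
    readInput x p = .letter a ∧ Rest x (p + 1) r := by
  obtain ⟨h₁, h₂, h₃⟩ := h
  have hlt : p - 1 < x.length := by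
    by_contra hge
    rw [List.drop_eq_nil_of_le (not_lt.1 hge)] at h₃
    cases h₃
  have hget : x[p - 1]? = some a := by
    rw [← List.head?_drop, h₃]; rfl
  refine ⟨?_, by omega, by omega, ?_⟩
  · rw [readInput, if_neg (by omega), hget]
  · have : x.drop (p - 1 + 1) = r := by rw [← List.drop_drop, h₃]; rfl
    rwa [Nat.sub_add_cancel h₁] at this

theorem Rest.nil {x : List Sym} {p : ℕ} (h : Rest x p []) : readInput x p = .rightEnd := by
  obtain ⟨h₁, h₂, h₃⟩ := h
  have hget : x[p - 1]? = none := by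
    rw [← List.head?_drop, h₃]; rfl
  rw [readInput, if_neg (by omega), hget]

def InputCell.isLeft {A : Type} : InputCell A → Bool
  | .leftEnd => true
  | _ => false

def InputCell.isRight {A : Type} : InputCell A → Bool
  | .rightEnd => true
  | _ => false

def InputCell.isOne : InputCell Sym → Bool
  | .letter .one => true
  | _ => false

def InputCell.isBit : InputCell Sym → Bool
  | .letter .one => true
  | .letter .zero => true
  | _ => false

namespace Prog

/-- Move the input head to the first letter. -/
def goStart : Prog :=
  .seq (.loop 0 (fun y _ => !y.isLeft) (.act ⟨0, id, .stay, .left⟩)) (.act ⟨0, id, .stay, .right⟩)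

def goRight : Prog := .act ⟨0, id, .stay, .right⟩

/-- Read a binary number into register `r`. The register `w` holds the weight of the digit; `t`
and `t'` are auxiliary. -/
def readBits (r w t t' : ℕ) : Prog :=
  .loop 0 (fun y _ => y.isBit) <|
    .seq (.ite 0 (fun y _ => y.isOne) (whilePos w (.seq (dec w) (.seq (inc r) (inc t))))
      (whilePos w (.seq (dec w) (inc t)))) <|
    .seq (whilePos t (.seq (dec t) (.seq (inc w) (inc t')))) <|
    .seq (whilePos t' (.seq (dec t') (inc w))) goRight

def readNumber (r w t t' : ℕ) : Prog :=
  .seq (clear r) <| .seq (clear w) <| .seq (inc w) <| .seq (clear t) <| .seq (clear t') <|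
    .seq (readBits r w t t') goRight

/-- Add the difference of the registers `f` and `t` to register `g`. -/
def addDiff (f t g : ℕ) : Prog :=
  .seq (whilePos t (.seq (dec t) (ifZero f (inc g) (dec f)))) (whilePos f (.seq (dec f) (inc g)))

end Prog

theorem bound_update {v : ℕ → ℕ} {c r n : ℕ} (h : ∀ i, v i < c) (hn : n < c) (i : ℕ) :
    Function.update v r n i < c := by
  by_cases hi : i = r
  · subst hi; rwa [Function.update_self]
  · rw [Function.update_of_ne hi]; exact h i

namespace Exec

variable {x : List Sym} {L p : ℕ} {v : ℕ → ℕ}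

theorem goRight {r : List Sym} {a : Sym} (h : Rest x p (a :: r)) :
    Exec x L .goRight p v (p + 1) v := by
  have := input (x := x) (L := L) (p := p) (v := v) (m := .right)
  rwa [Move.apply, min_eq_left h.cons.2.2.1] at this

theorem goStart : Exec x L .goStart p v 1 v := by
  have h₁ : ∀ p, Exec x L (.loop 0 (fun y _ => !y.isLeft) (.act ⟨0, id, .stay, .left⟩)) p v 0 v := by
    intro p
    induction p with
    | zero => exact loop_input_false (b := fun y => !y.isLeft) rfl
    | succ p ih =>
      intro hp
      refine loop_input_true (b := fun y => !y.isLeft) (p' := p) ?_ ?_ ih hp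
      · simp only [readInput, Nat.succ_ne_zero, if_false]
        cases x[p + 1 - 1]? <;> rfl
      · have := input (x := x) (L := L) (p := p + 1) (v := v) (m := .left)
        rwa [Move.apply, Nat.add_sub_cancel, min_eq_left (by omega)] at this
  refine .seq (h₁ p) ?_
  have := input (x := x) (L := L) (p := 0) (v := v) (m := .right)
  rwa [Move.apply, min_eq_left (by omega)] at this

/-- The number with the given binary digits, least significant digit first. -/
def _root_.Braid.bitsValue : List Bool → ℕ
  | [] => 0
  | b :: l => b.toNat + 2 * bitsValue l

/-- Each bit adds the weight to `r` or not, and the weight is then doubled by moving it to `t`, from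
there to `w` and `t'`, and from `t'` to `w` again. The weight is doubled also after the last bit,
hence the hypothesis on `2 ^ bs.length`. -/
theorem readBits {r w t t' : ℕ} (hrw : r ≠ w) (hrt : r ≠ t) (hrt' : r ≠ t') (hwt : w ≠ t)
    (hwt' : w ≠ t') (htt' : t ≠ t') {rest : List Sym} : ∀ (bs : List Bool) {p : ℕ} {v : ℕ → ℕ},
    Rest x p (bs.map (fun b => if b then Sym.one else Sym.zero) ++ .comma :: rest) →
    (∀ i, v i < 2 ^ L) → v t = 0 → v t' = 0 → v r + v w * bitsValue bs < 2 ^ L →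
    v w * 2 ^ bs.length < 2 ^ L →
    ∃ v', Exec x L (.readBits r w t t') p v (p + bs.length) v' ∧ (∀ i, v' i < 2 ^ L) ∧
      v' r = v r + v w * bitsValue bs ∧
      ∀ k, k ≠ r → k ≠ w → k ≠ t → k ≠ t' → v' k = v k
  | [], p, v, hx, hv, _, _, _, _ =>
    ⟨v, loop_input_false (b := InputCell.isBit) (by rw [hx.cons.1]; rfl), hv, rfl,
      fun _ _ _ _ _ => rfl⟩
  | b :: bs, p, v, hx, hv, ht, ht', hr, hw => by
    obtain ⟨hread, hx'⟩ := hx.cons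
    simp only [bitsValue, List.length_cons] at hr hw
    have hw2 : v w * 2 < 2 ^ L := by
      refine lt_of_le_of_lt (Nat.mul_le_mul_left _ ?_) hw
      rw [pow_succ]
      have := Nat.one_le_two_pow (n := bs.length)
      omega
    have hb : b.toNat ≤ b.toNat + 2 * bitsValue bs := Nat.le_add_right _ _
    have hr2 : v r + v w * b.toNat < 2 ^ L :=
      lt_of_le_of_lt (Nat.add_le_add_left (Nat.mul_le_mul_left _ hb) _) hr
    have hvw := hv w
    set v₁ := Function.update (Function.update (Function.update v w 0) r (v r + v w * b.toNat)) t
      (v w) with hv₁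
    have h₁ : Exec x L (.ite 0 (fun y _ => y.isOne)
        (.whilePos w (.seq (.dec w) (.seq (.inc r) (.inc t))))
        (.whilePos w (.seq (.dec w) (.inc t)))) p v p v₁ := by
      refine ite_input (b := InputCell.isOne) ?_ ?_
      · intro h
        have hbt : b = true := by
          cases b with
          | true => rfl
          | false => rw [hread] at h; cases h
        subst hbt
        have := transfer (x := x) (p := p) (L := L) (v := v) hrw.symm hwt hrt _ rfl hvw
          (by simpa using hr2) (by rw [ht]; omega)
        simpa [hv₁, ht] using this
      · intro h
        have hbt : b = false := by
          cases b with
          | false => rfl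
          | true => rw [hread] at h; cases h
        subst hbt
        have := restore (x := x) (p := p) (L := L) (v := v) hwt.symm _ rfl hvw (by rw [ht]; omega)
        convert this using 1
        rw [hv₁, ht, Nat.zero_add]
        simp only [Bool.toNat_false, Nat.mul_zero, Nat.add_zero]
        congr 1
        funext k
        by_cases hk : k = r
        · subst hk; simp [hrw]
        · simp [hk]
    have e₁w : v₁ w = 0 := by simp [hv₁, hwt, hrw.symm]
    have e₁t : v₁ t = v w := by simp [hv₁]
    have e₁t' : v₁ t' = 0 := by simp [hv₁, htt'.symm, hrt'.symm, hwt'.symm, ht']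
    have e₁r : v₁ r = v r + v w * b.toNat := by simp [hv₁, hrt]
    set v₂ := Function.update (Function.update (Function.update v₁ t 0) w (v₁ w + v w)) t'
      (v₁ t' + v w) with hv₂
    have h₂ : Exec x L (.whilePos t (.seq (.dec t) (.seq (.inc w) (.inc t')))) p v₁ p v₂ :=
      transfer hwt.symm htt' hwt' (v w) e₁t (by rwa [e₁t]) (by rw [e₁w]; omega) (by rw [e₁t']; omega)
    have e₂w : v₂ w = v w := by simp [hv₂, hwt', e₁w]
    have e₂t' : v₂ t' = v w := by simp [hv₂, e₁t']
    set v₃ := Function.update (Function.update v₂ t' 0) w (v₂ w + v w) with hv₃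
    have h₃ : Exec x L (.whilePos t' (.seq (.dec t') (.inc w))) p v₂ p v₃ :=
      restore hwt' (v w) e₂t' (by rwa [e₂t']) (by rw [e₂w]; omega)
    have e₃w : v₃ w = v w * 2 := by simp [hv₃, e₂w]; omega
    have e₃t : v₃ t = 0 := by simp [hv₃, hv₂, hwt.symm, htt']
    have e₃t' : v₃ t' = 0 := by simp [hv₃, hwt'.symm]
    have e₃r : v₃ r = v r + v w * b.toNat := by simp [hv₃, hv₂, hrw, hrt, hrt', e₁r]
    have b₃ : ∀ i, v₃ i < 2 ^ L := by
      have b₁ : ∀ i, v₁ i < 2 ^ L := bound_update (bound_update (bound_update hv (by omega)) hr2) hvw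
      have b₂ : ∀ i, v₂ i < 2 ^ L := bound_update (bound_update (bound_update b₁ (by omega))
        (by rw [e₁w]; omega)) (by rw [e₁t']; omega)
      exact bound_update (bound_update b₂ (by omega)) (by rw [e₂w]; omega)
    obtain ⟨v', he, hb', hres, hkeep⟩ := readBits hrw hrt hrt' hwt hwt' htt' bs hx' b₃ e₃t e₃t'
      (by rw [e₃r, e₃w]; refine lt_of_eq_of_lt ?_ hr; ring)
      (by rw [e₃w]; refine lt_of_eq_of_lt ?_ hw; ring)
    refine ⟨v', ?_, hb', ?_, ?_⟩
    · have hbit : InputCell.isBit (readInput x p) = true := by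
        rw [hread]; cases b <;> rfl
      have := loop_input_true (b := InputCell.isBit) hbit (h₁.seq (h₂.seq (h₃.seq (goRight hx)))) he
      rwa [show p + 1 + bs.length = p + (bs.length + 1) by omega] at this
    · rw [hres, e₃r, e₃w, bitsValue]; ring
    · intro k hkr hkw hkt hkt'
      rw [hkeep k hkr hkw hkt hkt']
      simp [hv₃, hv₂, hv₁, hkr, hkw, hkt, hkt']

theorem _root_.Braid.bitsValue_bits (n : ℕ) : bitsValue n.bits = n := by
  have h : ∀ l : List Bool, bitsValue l = Nat.ofDigits 2 (l.map fun b => cond b 1 0) := by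
    intro l
    induction l with
    | nil => rfl
    | cons b l ih =>
      rw [bitsValue, ih, List.map_cons, Nat.ofDigits_cons]
      cases b <;> simp
  rw [h, ← Nat.digits_two_eq_bits, Nat.ofDigits_digits]

theorem _root_.Braid.two_pow_bits_length (n : ℕ) : 2 ^ n.bits.length ≤ 2 * n + 1 := by
  rw [Nat.size_eq_bits_len]
  rcases h : n.size with - | s
  · omega
  · have : 2 ^ s ≤ n := Nat.lt_size.1 (by omega)
    rw [pow_succ]
    omega

theorem readNumber {r w t t' : ℕ} (hrw : r ≠ w) (hrt : r ≠ t) (hrt' : r ≠ t') (hwt : w ≠ t)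
    (hwt' : w ≠ t') (htt' : t ≠ t') {rest : List Sym} {n : ℕ}
    (hx : Rest x p (encodeNat n ++ rest)) (hv : ∀ i, v i < 2 ^ L) (hn : 2 * n + 1 < 2 ^ L) :
    ∃ p' v', Exec x L (.readNumber r w t t') p v p' v' ∧ (∀ i, v' i < 2 ^ L) ∧ v' r = n ∧
      Rest x p' rest ∧ ∀ k, k ≠ r → k ≠ w → k ≠ t → k ≠ t' → v' k = v k := by
  have hx' : Rest x p (n.bits.map (fun b => if b then Sym.one else Sym.zero) ++ .comma :: rest) := by
    simpa [encodeNat] using hx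
  set v₁ := Function.update (Function.update (Function.update (Function.update
    (Function.update v r 0) w 0) w 1) t 0) t' 0 with hv₁
  have b₁ : ∀ i, v₁ i < 2 ^ L := bound_update (bound_update (bound_update (bound_update
    (bound_update hv (by omega)) (by omega)) (by omega)) (by omega)) (by omega)
  have h₁ : Exec x L (.seq (.clear r) <| .seq (.clear w) <| .seq (.inc w) <|
      .seq (.clear t) (.clear t')) p v p v₁ := by
    have b0 : 0 < 2 ^ L := by omega
    have := bound_update (r := r) hv b0
    refine .seq (clear (hv r)) (.seq (clear (bound_update hv b0 _)) (.seq (p' := p)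
      (v' := Function.update (Function.update (Function.update v r 0) w 0) w 1) ?_
      (.seq (clear ?_) (clear ?_))))
    · have := inc (x := x) (L := L) (p := p) (v := Function.update (Function.update v r 0) w 0)
        (r := w) (by simp)
      simpa using this
    · exact bound_update (bound_update this b0) (by omega) _
    · exact bound_update (bound_update (bound_update this b0) (by omega)) b0 _
  have e₁r : v₁ r = 0 := by simp [hv₁, hrt, hrw, hrt']
  have e₁w : v₁ w = 1 := by simp [hv₁, hwt, hwt']
  have e₁t : v₁ t = 0 := by simp [hv₁, htt']
  have e₁t' : v₁ t' = 0 := by simp [hv₁]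
  have hpow := two_pow_bits_length n
  obtain ⟨v₂, h₂, b₂, hr, hk⟩ := readBits (L := L) hrw hrt hrt' hwt hwt' htt' n.bits hx' b₁ e₁t e₁t'
    (by rw [e₁r, e₁w, bitsValue_bits]; omega) (by rw [e₁w]; omega)
  have hx₂ : ∀ (l : List Sym) {p : ℕ}, Rest x p (l ++ .comma :: rest) →
      Rest x (p + l.length) (.comma :: rest) := by
    intro l
    induction l with
    | nil => exact fun h => h
    | cons a l ih =>
      intro p h
      have := ih h.cons.2
      rwa [List.length_cons, show p + (l.length + 1) = p + 1 + l.length by omega]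
  have hx₃ := hx₂ _ hx'
  rw [List.length_map] at hx₃
  refine ⟨p + n.bits.length + 1, v₂, ?_, b₂, ?_, hx₃.cons.2, ?_⟩
  · intro hp
    cases h₁ hp with
    | seq a₁ a =>
      cases a with
      | seq a₂ a =>
        cases a with
        | seq a₃ a =>
          cases a with
          | seq a₄ a₅ =>
            exact .seq a₁ (.seq a₂ (.seq a₃ (.seq a₄ (.seq a₅ (.seq (h₂ hp)
              (goRight hx₃ hx₃.2.1))))))
  · rw [hr, e₁r, e₁w, bitsValue_bits]; omega
  · intro k hkr hkw hkt hkt'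
    rw [hk k hkr hkw hkt hkt']
    simp [hv₁, hkr, hkw, hkt, hkt']

theorem addDiff {f t g : ℕ} (hft : f ≠ t) (hfg : f ≠ g) (htg : t ≠ g) (hv : ∀ i, v i < 2 ^ L)
    (hg : v g + (v t - v f) + (v f - v t) < 2 ^ L) :
    ∃ v', Exec x L (.addDiff f t g) p v p v' ∧ (∀ i, v' i < 2 ^ L) ∧
      v' g = v g + (v t - v f) + (v f - v t) ∧ ∀ k, k ≠ f → k ≠ t → k ≠ g → v' k = v k := by
  have key : ∀ n (v : ℕ → ℕ), (∀ i, v i < 2 ^ L) → v t = n → v g + (v t - v f) < 2 ^ L →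
      ∃ v', Exec x L (.whilePos t (.seq (.dec t) (.ifZero f (.inc g) (.dec f)))) p v p v' ∧
        (∀ i, v' i < 2 ^ L) ∧ v' g = v g + (v t - v f) ∧ v' f = v f - v t ∧
        ∀ k, k ≠ f → k ≠ t → k ≠ g → v' k = v k := by
    intro n
    induction n with
    | zero =>
      intro v hv hn _
      exact ⟨v, whilePos_zero hn, hv, by simp [hn], by simp [hn], fun _ _ _ _ => rfl⟩
    | succ n ih =>
      intro v hv hn hg
      have hvt := hv t
      by_cases hf : v f = 0
      · obtain ⟨v', he, hb, h₁, h₂, h₃⟩ := ih (Function.update (Function.update v t n) g (v g + 1))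
          (bound_update (bound_update hv (by omega)) (by omega)) (by simp [htg])
          (by simp [htg, hfg, hft]; omega)
        refine ⟨v', whilePos_pos (by omega) (.seq (dec hn hvt) (ifZero (fun _ => ?_) fun h => ?_)) he,
          hb, ?_, ?_, ?_⟩
        · have := inc (x := x) (p := p) (L := L) (v := Function.update v t n) (r := g)
            (bound_update hv (by omega) g)
          rwa [Function.update_of_ne htg.symm] at this
        · rw [Function.update_of_ne hft] at h; exact absurd hf h
        · rw [h₁]; simp [htg, hfg, hft]; omega
        · rw [h₂]; simp [htg, hfg, hft]; omega
        · intro k hk₁ hk₂ hk₃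
          rw [h₃ k hk₁ hk₂ hk₃]; simp [hk₂, hk₃]
      · obtain ⟨c, hc⟩ := Nat.exists_eq_succ_of_ne_zero hf
        have hvf := hv f
        obtain ⟨v', he, hb, h₁, h₂, h₃⟩ := ih (Function.update (Function.update v t n) f c)
          (bound_update (bound_update hv (by omega)) (by omega)) (by simp [hft.symm])
          (by simp [hft.symm, hfg.symm, htg.symm]; omega)
        refine ⟨v', whilePos_pos (by omega) (.seq (dec hn hvt) (ifZero (fun h => ?_) fun h => ?_)) he,
          hb, ?_, ?_, ?_⟩
        · rw [Function.update_of_ne hft] at h; exact absurd h hf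
        · refine dec ?_ (bound_update hv (by omega) f)
          rw [Function.update_of_ne hft]; exact hc
        · rw [h₁]; simp [hft.symm, hfg.symm, htg.symm]; omega
        · rw [h₂]; simp [hft.symm]; omega
        · intro k hk₁ hk₂ hk₃
          rw [h₃ k hk₁ hk₂ hk₃]; simp [hk₁, hk₂]
  obtain ⟨v₁, he, hb, h₁, h₂, h₃⟩ := key (v t) v hv rfl (by omega)
  refine ⟨_, .seq he (restore hfg.symm (v₁ f) rfl (hb f) (by omega)),
    bound_update (bound_update hb ((Nat.zero_le _).trans_lt (hv 0))) (by omega), ?_, ?_⟩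
  · rw [Function.update_self, h₁, h₂]
  · intro k hk₁ hk₂ hk₃
    rw [Function.update_of_ne hk₃, Function.update_of_ne hk₁, h₃ k hk₁ hk₂ hk₃]

end Exec

end Braid

/-! ### Searching the instruction list on the input tape -/

namespace Braid

open Reg

namespace Prog

/-- Read `k + 1` binary numbers; the last one remains in register `r`. -/
def readAfter (r w t t' : ℕ) : ℕ → Prog
  | 0 => readNumber r w t t'
  | k + 1 => .seq (readNumber r w t t') (readAfter r w t t' k)

/-- Read `k` binary numbers and count in register `m + 1` by how much they differ from the numbers
in the registers from `s` on. The registers from `m + 2` to `m + 7` are auxiliary. -/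
def readFields (m : ℕ) : ℕ → ℕ → Prog
  | _, 0 => skip
  | s, k + 1 => .seq (.seq (readNumber (m + 2) (m + 3) (m + 4) (m + 5))
      (.seq (copy s (m + 6) (m + 7)) (addDiff (m + 2) (m + 6) (m + 1)))) (readFields m (s + 1) k)

/-- Read rows of `k` numbers each, and set register `m` to one if one of the rows consists of the
numbers in the registers from `s` on. -/
def readRows (s m k : ℕ) : Prog :=
  .loop 0 (fun y _ => !y.isRight) <| .seq (clear (m + 1)) <| .seq (readFields m s k) <|
    .seq goRight (ifZero (m + 1) (.seq (clear m) (inc m)) skip)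

end Prog

namespace Exec

variable {x : List Sym} {L p : ℕ} {v : ℕ → ℕ}

theorem readAfter {r w t t' : ℕ} (hrw : r ≠ w) (hrt : r ≠ t) (hrt' : r ≠ t') (hwt : w ≠ t)
    (hwt' : w ≠ t') (htt' : t ≠ t') {rest : List Sym} {n : ℕ} (hn : 2 * n + 1 < 2 ^ L) :
    ∀ {ns : List ℕ} {p : ℕ} {v : ℕ → ℕ},
    Rest x p (ns.flatMap encodeNat ++ encodeNat n ++ rest) → (∀ i, v i < 2 ^ L) →
    (∀ k ∈ ns, 2 * k + 1 < 2 ^ L) →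
    ∃ p' v', Exec x L (.readAfter r w t t' ns.length) p v p' v' ∧ (∀ i, v' i < 2 ^ L) ∧ v' r = n ∧
      Rest x p' rest ∧ ∀ k, k ≠ r → k ≠ w → k ≠ t → k ≠ t' → v' k = v k
  | [], p, v, hx, hv, _ => readNumber hrw hrt hrt' hwt hwt' htt' hx hv hn
  | a :: ns, p, v, hx, hv, hns => by
    obtain ⟨p₁, v₁, he, hb, -, hx', hk⟩ := readNumber (x := x) (L := L) (n := a) hrw hrt hrt' hwt hwt'
      htt' (rest := ns.flatMap encodeNat ++ encodeNat n ++ rest) (by simpa using hx) hv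
      (hns a (by simp))
    obtain ⟨p₂, v₂, he', hb', hr, hx'', hk'⟩ := readAfter hrw hrt hrt' hwt hwt' htt' hn hx' hb
      fun k h => hns k (by simp [h])
    exact ⟨p₂, v₂, he.seq he', hb', hr, hx'', fun k h₁ h₂ h₃ h₄ =>
      (hk' k h₁ h₂ h₃ h₄).trans (hk k h₁ h₂ h₃ h₄)⟩

theorem readFields {m W : ℕ} (hW : 2 * W < 2 ^ L) {rest : List Sym} :
    ∀ {ns : List ℕ} {s p : ℕ} {v : ℕ → ℕ}, s + ns.length ≤ m →
    Rest x p (ns.flatMap encodeNat ++ rest) → (∀ i, v i < 2 ^ L) → (∀ n ∈ ns, n < W) →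
    (∀ j < ns.length, v (s + j) < W) → v (m + 1) + ns.length * W < 2 ^ L →
    ∃ p' v', Exec x L (.readFields m s ns.length) p v p' v' ∧ (∀ i, v' i < 2 ^ L) ∧
      Rest x p' rest ∧ (v' (m + 1) = 0 ↔ v (m + 1) = 0 ∧ ∀ j < ns.length, ns[j]? = some (v (s + j))) ∧
      ∀ k, (k ≤ m ∨ m + 8 ≤ k) → v' k = v k
  | [], s, p, v, _, hx, hv, _, _, _ => ⟨p, v, skip, hv, hx, by simp, fun _ _ => rfl⟩
  | n :: ns, s, p, v, hs, hx, hv, hns, hvs, hg => by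
    simp only [List.length_cons] at hs hg hvs
    have hnW : n < W := hns n (by simp)
    obtain ⟨p₁, v₁, he₁, hb₁, hr₁, hx₁, hk₁⟩ := readNumber (x := x) (L := L) (n := n) (r := m + 2)
      (w := m + 3) (t := m + 4) (t' := m + 5) (by omega) (by omega) (by omega) (by omega) (by omega)
      (by omega) (rest := ns.flatMap encodeNat ++ rest) (by simpa using hx) hv (by omega)
    have he₂ := copy (x := x) (p := p₁) (i := s) (j := m + 6) (t := m + 7) (by omega) (by omega)
      (by omega) hb₁
    set v₂ := Function.update (Function.update v₁ (m + 6) (v₁ s)) (m + 7) 0 with hv₂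
    have hb₂ : ∀ i, v₂ i < 2 ^ L := bound_update (bound_update hb₁ (hb₁ s)) (by omega)
    have e₁ : v₂ (m + 1) = v (m + 1) := by
      simp [hv₂, hk₁ (m + 1)]
    have e₂ : v₂ (m + 2) = n := by simp [hv₂, hr₁]
    have hs0 : v₁ s = v s := hk₁ s (by omega) (by omega) (by omega) (by omega)
    have e₃ : v₂ (m + 6) = v s := by simp [hv₂, hs0]
    have hsW : v s < W := hvs 0 (by omega)
    have hmul : (ns.length + 1) * W = ns.length * W + W := by ring
    obtain ⟨v₃, he₃, hb₃, hr₃, hk₃⟩ := addDiff (x := x) (p := p₁) (f := m + 2) (t := m + 6)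
      (g := m + 1) (by omega) (by omega) (by omega) hb₂ (by rw [e₁, e₂, e₃]; omega)
    rw [e₁, e₂, e₃] at hr₃
    have hk : ∀ k, (k ≤ m ∨ m + 8 ≤ k) → v₃ k = v k := fun k hk => by
      rw [hk₃ k (by omega) (by omega) (by omega), hv₂, Function.update_of_ne (by omega),
        Function.update_of_ne (by omega), hk₁ k (by omega) (by omega) (by omega) (by omega)]
    obtain ⟨p₄, v₄, he₄, hb₄, hx₄, hr₄, hk₄⟩ := readFields (m := m) hW (ns := ns) (s := s + 1)
      (by omega) hx₁ hb₃ (fun k h => hns k (by simp [h]))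
      (fun j hj => by rw [hk _ (by omega)]; have := hvs (j + 1) (by omega)
                      rwa [show s + 1 + j = s + (j + 1) by omega])
      (by rw [hr₃]; omega)
    refine ⟨p₄, v₄, (he₁.seq (he₂.seq he₃)).seq he₄, hb₄, hx₄, ?_, fun k h => ?_⟩
    · rw [hr₄, hr₃]
      constructor
      · rintro ⟨h₀, h⟩
        refine ⟨by omega, fun j hj => ?_⟩
        cases j with
        | zero => simp; omega
        | succ j =>
          have := h j (by simpa using hj)
          rw [hk _ (by simp at hj; omega)] at this
          rw [List.getElem?_cons_succ, this, show s + 1 + j = s + (j + 1) by omega]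
      · rintro ⟨h₀, h⟩
        have := h 0 (by simp)
        simp only [List.getElem?_cons_zero, Option.some.injEq, add_zero] at this
        refine ⟨by omega, fun j hj => ?_⟩
        have := h (j + 1) (by simpa using hj)
        rw [List.getElem?_cons_succ] at this
        rw [this, hk _ (by omega), show s + 1 + j = s + (j + 1) by omega]
    · rw [hk₄ k h, hk k h]

/-- The registers hold one row at a time, and the mismatch counter is reset for each row. The bounds
therefore involve the size of the entries, not the number of rows. -/
theorem readRows {s m k W : ℕ} (hs : s + k ≤ m) (hW : 2 * W < 2 ^ L) (hkW : k * W < 2 ^ L) :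
    ∀ {rows : List (List ℕ)} {p : ℕ} {v : ℕ → ℕ},
    Rest x p (rows.flatMap fun r => r.flatMap encodeNat ++ [.semicolon]) →
    (∀ i, v i < 2 ^ L) → (∀ r ∈ rows, r.length = k ∧ ∀ n ∈ r, n < W) → (∀ j < k, v (s + j) < W) →
    v m ≤ 1 → 1 < 2 ^ L →
    ∃ p' v', Exec x L (.readRows s m k) p v p' v' ∧ (∀ i, v' i < 2 ^ L) ∧ v' m ≤ 1 ∧
      (v' m = 1 ↔ v m = 1 ∨ ∃ r ∈ rows, ∀ j < k, r[j]? = some (v (s + j))) ∧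
      ∀ i < m, v' i = v i
  | [], p, v, hx, hv, _, _, hm, _ =>
    ⟨p, v, loop_input_false (b := fun y => !y.isRight) (by rw [hx.nil]; rfl), hv, hm, by simp,
      fun _ _ => rfl⟩
  | r :: rows, p, v, hx, hv, hr, hvs, hm, h1 => by
    obtain ⟨hrk, hrW⟩ := hr r (by simp)
    have hx' : Rest x p (r.flatMap encodeNat ++
        (.semicolon :: rows.flatMap fun r => r.flatMap encodeNat ++ [.semicolon])) := by
      simpa using hx
    have hb₀ := bound_update (r := m + 1) (n := 0) hv (by omega)
    obtain ⟨p₁, v₁, he₁, hb₁, hx₁, hz₁, hk₁⟩ := readFields (m := m) hW (ns := r) (s := s)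
      (v := Function.update v (m + 1) 0) (by omega) hx' hb₀ hrW
      (fun j hj => by rw [Function.update_of_ne (by omega)]; exact hvs j (by omega))
      (by rw [Function.update_self, hrk]; omega)
    have hcl := clear (x := x) (p := p) (hv (m + 1))
    rw [hrk] at he₁ hz₁
    have hk₁' : ∀ i ≤ m, v₁ i = v i := fun i hi => by
      rw [hk₁ i (by omega), Function.update_of_ne (by omega)]
    have hz : v₁ (m + 1) = 0 ↔ ∀ j < k, r[j]? = some (v (s + j)) := by
      rw [hz₁, Function.update_self]
      refine ⟨fun h j hj => ?_, fun h => ⟨rfl, fun j hj => ?_⟩⟩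
      · have := h.2 j hj
        rwa [Function.update_of_ne (by omega)] at this
      · rw [Function.update_of_ne (by omega)]; exact h j hj
    obtain ⟨v₂, he₂, hb₂, hm₂, hk₂⟩ : ∃ v₂, Exec x L
        (.ifZero (m + 1) (.seq (.clear m) (.inc m)) .skip) (p₁ + 1) v₁ (p₁ + 1) v₂ ∧
        (∀ i, v₂ i < 2 ^ L) ∧ (v₂ m = if v₁ (m + 1) = 0 then 1 else v m) ∧
        ∀ i < m, v₂ i = v₁ i := by
      by_cases h : v₁ (m + 1) = 0
      · refine ⟨Function.update v₁ m 1, ifZero (fun _ => (clear (hb₁ m)).seq ?_)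
          (fun h' => absurd h h'), bound_update hb₁ h1, by simp [h],
          fun i hi => Function.update_of_ne (by omega) _ _⟩
        have := inc (x := x) (L := L) (p := p₁ + 1) (v := Function.update v₁ m 0)
          (r := m) (by simp)
        simpa using this
      · exact ⟨v₁, ifZero (fun h' => absurd h' h) fun _ => skip, hb₁,
          by rw [if_neg h, hk₁' m le_rfl], fun _ _ => rfl⟩
    obtain ⟨p₃, v₃, he₃, hb₃, hm₃, hz₃, hk₃⟩ := readRows hs hW hkW hx₁.cons.2 hb₂
      (fun r' h => hr r' (by simp [h]))
      (fun j hj => by rw [hk₂ _ (by omega), hk₁' _ (by omega)]; exact hvs j hj)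
      (by rw [hm₂]; split <;> omega) h1
    have hread : (!(readInput x p).isRight) = true := by
      obtain ⟨a, l, hal⟩ : ∃ a l, (r.flatMap encodeNat ++
        (.semicolon :: rows.flatMap fun r => r.flatMap encodeNat ++ [Sym.semicolon])) = a :: l := by
        cases h : r.flatMap encodeNat ++
          (.semicolon :: rows.flatMap fun r => r.flatMap encodeNat ++ [Sym.semicolon]) with
        | nil => simp at h
        | cons a l => exact ⟨a, l, rfl⟩
      rw [hal] at hx'
      rw [hx'.cons.1]
      rfl
    refine ⟨p₃, v₃, loop_input_true (b := fun y => !y.isRight) hread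
      (hcl.seq (he₁.seq ((goRight hx₁).seq he₂))) he₃, hb₃, hm₃, ?_, fun i hi => ?_⟩
    · have hvj : ∀ j < k, v₂ (s + j) = v (s + j) := fun j hj => by
        rw [hk₂ _ (by omega), hk₁' _ (by omega)]
      have hrows : (∃ r ∈ rows, ∀ j < k, r[j]? = some (v₂ (s + j))) ↔
          ∃ r ∈ rows, ∀ j < k, r[j]? = some (v (s + j)) := by
        refine exists_congr fun r => and_congr_right fun _ => forall_congr' fun j =>
          forall_congr' fun hj => ?_
        rw [hvj j hj]
      rw [hz₃, hm₂, hrows, List.exists_mem_cons_iff, ← hz]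
      by_cases h : v₁ (m + 1) = 0 <;> simp [h]
    · rw [hk₃ i hi, hk₂ i hi, hk₁' i hi.le]

end Exec

/-! ### The contents of the input -/

namespace Instr

variable {N S : ℕ}

/-- The numbers that encode an instruction. -/
def codes (i : Instr N S) : List ℕ := [i.state, i.read, writeCode i.write, i.move.code, i.next]

theorem encode_eq (i : Instr N S) : i.encode = i.codes.flatMap encodeNat ++ [.semicolon] := by
  simp [encode, codes]

theorem codes_lt (i : Instr N S) : ∀ n ∈ i.codes, n < N + S + 3 := by
  have h₁ := i.state.2
  have h₂ := i.read.2
  have h₃ := i.next.2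
  have h₄ : writeCode i.write < S + 1 := by
    cases i.write with
    | none => exact Nat.succ_pos S
    | some b => exact Nat.succ_lt_succ b.2
  have h₅ : i.move.code < 3 := by cases i.move <;> simp [Move.code]
  intro n hn
  simp only [codes, List.mem_cons, List.not_mem_nil, or_false] at hn
  omega

end Instr

namespace Problem

variable (I : Problem)

theorem input_eq : I.input = [I.N, I.S, I.machine.start, I.machine.blank].flatMap encodeNat ++
    encodeNat I.target ++ .semicolon :: (I.machine.program.map Instr.codes).flatMap
      fun r => r.flatMap encodeNat ++ [.semicolon] := by
  simp only [input, encodeInstance, List.flatMap_map, ← Instr.encode_eq]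
  simp

def logS : ℕ := max 1 (Nat.log 2 I.S)

theorem one_le_logS : 1 ≤ I.logS := le_max_left _ _

theorem S_lt : I.S < 2 ^ (I.logS + 1) :=
  (Nat.lt_pow_succ_log_self (by omega) _).trans_le
    (Nat.pow_le_pow_right (by omega) (Nat.succ_le_succ (le_max_right _ _)))

/-- This explains the exponent in `width`: the first summand pays for the addresses of Savitch's
algorithm, the second for a function on tables. Factors polynomial in `N` are absorbed by `(2 ^ N) ^
2` and the constant `2 ^ 10`. -/
theorem le_width : (I.N + 6) ^ 2 * I.logS ^ 2 + 2 ^ (I.N ^ 2) * I.N ^ 2 + 10 ≤ I.width := by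
  have hN : I.N + 1 ≤ 2 ^ I.N := Nat.lt_two_pow_self
  have ha : 1 ≤ 2 ^ (I.N ^ 2) := Nat.one_le_two_pow
  have hl : 1 ≤ I.logS ^ 2 := Nat.one_le_pow _ _ I.one_le_logS
  have hw : I.width = 1024 * (2 ^ (I.N ^ 2) * (2 ^ I.N) ^ 2 * I.logS ^ 2) := by
    rw [width, logS, pow_add, pow_add, ← pow_mul, mul_comm I.N 2]; ring
  set a := 2 ^ (I.N ^ 2)
  set l := I.logS ^ 2
  set b := (2 ^ I.N) ^ 2
  have hb : (I.N + 1) ^ 2 ≤ b := Nat.pow_le_pow_left hN 2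
  have hc : 1 ≤ a * b * l := Nat.mul_pos (Nat.mul_pos ha (by positivity)) hl
  have h₁ : b * l ≤ a * b * l := Nat.mul_le_mul_right _ (Nat.le_mul_of_pos_left _ ha)
  have h₂ : a * b ≤ a * b * l := Nat.le_mul_of_pos_right _ hl
  have h₃ : (I.N + 6) ^ 2 * l ≤ 36 * (b * l) := by
    rw [← mul_assoc]; exact Nat.mul_le_mul_right _ (by nlinarith)
  have h₄ : a * I.N ^ 2 ≤ a * b := Nat.mul_le_mul_left _ (by nlinarith)
  omega

theorem size_lt_cap : 32 * (I.N + I.S + 3) < I.cap := by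
  have hl := I.one_le_logS
  have hw : I.N + I.logS + 8 ≤ I.width := by
    have := I.le_width
    nlinarith [Nat.zero_le (2 ^ (I.N ^ 2) * I.N ^ 2), Nat.mul_le_mul hl hl,
      Nat.mul_le_mul (Nat.zero_le I.N) hl, Nat.le_mul_of_pos_right (I.N + 6) hl]
  refine lt_of_lt_of_le ?_ (Nat.pow_le_pow_right (by omega) hw)
  have h₁ : I.N < 2 ^ I.N := Nat.lt_two_pow_self
  have h₂ := I.S_lt
  have h₃ : 4 ≤ 2 ^ (I.logS + 1) := by
    rw [pow_succ]; have : 2 ^ 1 ≤ 2 ^ I.logS := Nat.pow_le_pow_right (by omega) hl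
    omega
  have h₄ : 2 ^ (I.N + I.logS + 8) = 128 * (2 ^ I.N * 2 ^ (I.logS + 1)) := by ring
  rw [h₄]
  nlinarith

end Problem

/-- A parameter of the instance is read afresh from the input whenever it is needed, by skipping the
`k` numbers before it. -/
theorem Comp.header {α : Type} [Reg α] {D : Problem → α → Prop} {f : Problem → ℕ}
    {ns : Problem → List ℕ} {rest : Problem → List Sym} (k : ℕ) (hk : ∀ I, (ns I).length = k)
    (h : ∀ I, I.input = (ns I).flatMap encodeNat ++ encodeNat (f I) ++ rest I)
    (hf : ∀ I, f I ≤ I.N + I.S) (hns : ∀ I, ∀ n ∈ ns I, n ≤ I.N + I.S) :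
    Comp D fun I _ => f I := by
  intro s m hm
  refine ⟨.seq .goStart (.readAfter m (m + 1) (m + 2) (m + 3) k), fun I a p v hD hv hs => ?_⟩
  have hb : ∀ n ≤ I.N + I.S, 2 * n + 1 < 2 ^ I.width := fun n hn => by
    have := I.size_lt_cap
    rw [Problem.cap] at this
    omega
  have hx : Rest I.input 1 ((ns I).flatMap encodeNat ++ encodeNat (f I) ++ rest I) :=
    h I ▸ Rest.start I.input
  obtain ⟨p', v', he, hv', hr, -, hkeep⟩ := Exec.readAfter (r := m) (w := m + 1) (t := m + 2)
    (t' := m + 3) (by omega) (by omega) (by omega) (by omega) (by omega) (by omega) (hb _ (hf I))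
    (ns := ns I) hx hv fun n hn => hb n (hns I n hn)
  rw [hk] at he
  exact ⟨p', v', .seq .goStart he, hv', fun i hi => hkeep i (by omega) (by omega) (by omega)
    (by omega), fits_nat.2 hr⟩

namespace Comp

variable {α : Type} [Reg α] {D : Problem → α → Prop}

theorem numStates : Comp D fun I _ => I.N :=
  header (ns := fun _ => []) 0 (fun _ => rfl) (fun I => by rw [I.input_eq]; simp; rfl)
    (fun I => by omega) (by simp)

theorem numSymbols : Comp D fun I _ => I.S :=
  header (ns := fun I => [I.N]) 1 (fun _ => rfl) (fun I => by rw [I.input_eq]; simp; rfl)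
    (fun I => by omega) (by simp)

theorem start : Comp D fun I _ => (I.machine.start : ℕ) :=
  header (ns := fun I => [I.N, I.S]) 2 (fun _ => rfl) (fun I => by rw [I.input_eq]; simp; rfl)
    (fun I => by have := I.machine.start.2; omega) (by simp)

theorem blank : Comp D fun I _ => (I.machine.blank : ℕ) :=
  header (ns := fun I => [I.N, I.S, I.machine.start]) 3 (fun _ => rfl)
    (fun I => by rw [I.input_eq]; simp; rfl)
    (fun I => by have := I.machine.blank.2; omega)
    (fun I => by have := I.machine.start.2; simp; omega)

theorem target : Comp D fun I _ => (I.target : ℕ) :=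
  header (ns := fun I => [I.N, I.S, I.machine.start, I.machine.blank]) 4 (fun _ => rfl)
    (fun I => I.input_eq)
    (fun I => by have := I.target.2; omega)
    (fun I => by have := I.machine.start.2; have := I.machine.blank.2; simp; omega)

end Comp

/-- Looking up an instruction. -/
theorem Dec.program {α : Type} [Reg α] {D : Problem → α → Prop} {f₁ f₂ f₃ f₄ f₅ : Problem → α → ℕ}
    (h₁ : Comp D f₁) (h₂ : Comp D f₂) (h₃ : Comp D f₃) (h₄ : Comp D f₄) (h₅ : Comp D f₅)
    (h : ∀ I a, D I a → f₁ I a < I.N ∧ f₂ I a < I.S ∧ f₃ I a ≤ I.S ∧ f₄ I a < 3 ∧ f₅ I a < I.N) :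
    Dec D fun I a => ∃ i ∈ I.machine.program,
      i.codes = [f₁ I a, f₂ I a, f₃ I a, f₄ I a, f₅ I a] := by
  refine Dec.comp (E := fun I (a : ℕ × (ℕ × (ℕ × (ℕ × ℕ)))) => a.1 < I.N ∧ a.2.1 < I.S ∧
    a.2.2.1 ≤ I.S ∧ a.2.2.2.1 < 3 ∧ a.2.2.2.2 < I.N)
    (φ := fun I a => ∃ i ∈ I.machine.program,
      i.codes = [a.1, a.2.1, a.2.2.1, a.2.2.2.1, a.2.2.2.2])
    (f := fun I a => (f₁ I a, (f₂ I a, (f₃ I a, (f₄ I a, f₅ I a))))) ?_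
    (h₁.pair (h₂.pair (h₃.pair (h₄.pair h₅)))) h
  intro s m hm
  -- Skip the five numbers of the header and the semicolon, then compare every instruction with the
  -- five registers from `s` on.
  refine ⟨.seq .goStart (.seq (.readAfter (m + 2) (m + 3) (m + 4) (m + 5) 4)
    (.seq .goRight (.seq (.clear m) (.readRows s m 5)))), fun I a p v hD hv hs => ?_⟩
  have hsm : s + 5 ≤ m := hm
  simp only [fits_prod, fits_nat] at hs
  obtain ⟨e₀, e₁, e₂, e₃, e₄⟩ := hs
  change v (s + 1) = _ at e₁
  change v (s + 1 + 1) = _ at e₂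
  change v (s + 1 + 1 + 1) = _ at e₃
  change v (s + 1 + 1 + 1 + 1) = _ at e₄
  have hcap := I.size_lt_cap
  have hb : ∀ n ≤ I.N + I.S, 2 * n + 1 < 2 ^ I.width := fun n hn => by
    rw [Problem.cap] at hcap
    omega
  have hst := I.machine.start.2
  have hbl := I.machine.blank.2
  have hta := I.target.2
  have hx : ∀ y, I.input = y → Rest I.input 1 y := fun y hy => hy ▸ Rest.start _
  obtain ⟨p₁, v₁, he₁, hb₁, -, hx₁, hk₁⟩ := Exec.readAfter (r := m + 2) (w := m + 3) (t := m + 4)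
    (t' := m + 5) (by omega) (by omega) (by omega) (by omega) (by omega) (by omega)
    (hb I.target (by omega)) (hx _ I.input_eq) hv
    fun n hn => hb n (by simp at hn; omega)
  have hk : ∀ i < m, Function.update v₁ m 0 i = v i := fun i hi => by
    rw [Function.update_of_ne (by omega), hk₁ i (by omega) (by omega) (by omega) (by omega)]
  obtain ⟨p₂, v₂, he₂, hb₂, hm₂, hz₂, hk₂⟩ := Exec.readRows (s := s) (m := m) (k := 5)
    (W := I.N + I.S + 3) (L := I.width) hsm (by rw [Problem.cap] at hcap; omega)
    (by rw [Problem.cap] at hcap; omega) hx₁.cons.2 (v := Function.update v₁ m 0)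
    (bound_update hb₁ (by rw [Problem.cap] at hcap; omega))
    (fun r hr => by
      obtain ⟨i, -, rfl⟩ := List.mem_map.1 hr
      exact ⟨rfl, i.codes_lt⟩)
    (fun j hj => by
      rw [hk _ (by omega)]
      obtain ⟨d₁, d₂, d₃, d₄, d₅⟩ := hD
      interval_cases j
      · show v s < _; omega
      · show v (s + 1) < _; omega
      · show v (s + 1 + 1) < _; omega
      · show v (s + 1 + 1 + 1) < _; omega
      · show v (s + 1 + 1 + 1 + 1) < _; omega)
    (by simp) (by rw [Problem.cap] at hcap; omega)
  refine ⟨p₂, v₂, .seq .goStart (he₁.seq ((Exec.goRight hx₁).seq ((Exec.clear (hb₁ m)).seq he₂))),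
    hb₂, fun i hi => by rw [hk₂ i hi, hk i hi], fits_nat.2 ?_⟩
  have hiff : v₂ m = 1 ↔ ∃ i ∈ I.machine.program,
      i.codes = [a.1, a.2.1, a.2.2.1, a.2.2.2.1, a.2.2.2.2] := by
    rw [hz₂, Function.update_self]
    simp only [zero_ne_one, false_or, List.mem_map, exists_exists_and_eq_and]
    refine exists_congr fun i => and_congr_right fun _ => ?_
    rw [← e₀, ← e₁, ← e₂, ← e₃, ← e₄]
    constructor
    · intro h
      have h₀ := h 0 (by omega)
      have h₁ := h 1 (by omega)
      have h₂ := h 2 (by omega)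
      have h₃ := h 3 (by omega)
      have h₄ := h 4 (by omega)
      rw [hk _ (by omega)] at h₀ h₁ h₂ h₃ h₄
      simp only [Instr.codes, List.getElem?_cons_zero, List.getElem?_cons_succ,
        Option.some.injEq] at h₀ h₁ h₂ h₃ h₄
      rw [Instr.codes, h₀, h₁, h₂, h₃, h₄]
      rfl
    · intro h j hj
      rw [hk _ (by omega), h]
      interval_cases j <;> rfl
  dsimp only
  by_cases h : v₂ m = 1
  · rw [if_pos (hiff.1 h), h]
  · rw [if_neg (fun h' => h (hiff.2 h'))]; omega

end Braid

namespace Braid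

open Reg Relation

/-! ### Savitch's recursion and reachability in finite graphs -/

/-- The vertices that are reached from `u` in at most `l` steps. -/
def ball {V : Type} (R : V → V → Prop) (u : V) : ℕ → Set V
  | 0 => {u}
  | l + 1 => ball R u l ∪ {v | ∃ w ∈ ball R u l, R w v}

section Ball

variable {V : Type} {R : V → V → Prop} {u v : V}

theorem ball_mono (R : V → V → Prop) (u : V) : Monotone (ball R u) :=
  monotone_nat_of_le_succ fun _ => Set.subset_union_left

theorem mem_ball_add {a : ℕ} : ∀ {b : ℕ} {v : V}, v ∈ ball R u (a + b) →
    ∃ m ∈ ball R u a, v ∈ ball R m b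
  | 0, v, h => ⟨v, h, rfl⟩
  | b + 1, v, h => by
    rcases h with h | ⟨w, hw, hR⟩
    · obtain ⟨m, hm, hv⟩ := mem_ball_add h
      exact ⟨m, hm, Or.inl hv⟩
    · obtain ⟨m, hm, hw⟩ := mem_ball_add hw
      exact ⟨m, hm, Or.inr ⟨w, hw, hR⟩⟩

/-- Once two consecutive balls have the same size they are equal, and then all later ones are equal
too; since the sizes are bounded by the number of vertices, this happens by that radius. -/
theorem mem_ball_card [Fintype V] (h : ReflTransGen R u v) : v ∈ ball R u (Fintype.card V) := by
  have hstep : ∀ l, ball R u l = ball R u (l + 1) → ball R u (l + 1) = ball R u (l + 2) := by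
    intro l hl
    change _ = ball R u (l + 1) ∪ {v | ∃ w ∈ ball R u (l + 1), R w v}
    rw [← hl]
    exact hl
  have hcard : ∀ l, (ball R u l).ncard = (ball R u (l + 1)).ncard →
      ball R u l = ball R u (l + 1) := fun l hl =>
    Set.eq_of_subset_of_ncard_le (ball_mono R u (Nat.le_succ l)) hl.ge (Set.toFinite _)
  have hmono : Monotone fun l => (ball R u l).ncard := fun a b hab =>
    Set.ncard_le_ncard (ball_mono R u hab) (Set.toFinite _)
  have hle : ∀ l, (ball R u l).ncard ≤ Fintype.card V := fun l => by
    rw [← Nat.card_eq_fintype_card, ← Set.ncard_univ]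
    exact Set.ncard_le_ncard (Set.subset_univ _) (Set.toFinite _)
  have hstab : ∀ {n}, Fintype.card V ≤ n → _ := Nat.stabilises_of_monotone hmono hle fun l hl => by
    simp only [← hstep l (hcard l hl)]
  obtain ⟨l, hl⟩ : ∃ l, v ∈ ball R u l := by
    clear hstab
    induction h with
    | refl => exact ⟨0, rfl⟩
    | tail _ hR ih =>
      obtain ⟨l, hl⟩ := ih
      exact ⟨l + 1, Or.inr ⟨_, hl, hR⟩⟩
  have h₁ := hstab (le_max_right l (Fintype.card V))
  have h₂ : ball R u (Fintype.card V) = ball R u (max l (Fintype.card V)) :=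
    Set.eq_of_subset_of_ncard_le (ball_mono R u (le_max_right _ _)) (le_of_eq h₁) (Set.toFinite _)
  rw [h₂]
  exact ball_mono R u (le_max_left _ _) hl

/-- Reachability in a graph whose vertices are numbered by `c`. -/
theorem within_iff [Fintype V] {R' : ℕ → ℕ → Prop} {n k : ℕ} {c : V → ℕ}
    (hc : Function.Injective c) (hlt : ∀ v, c v < n) (hsurj : ∀ m < n, ∃ v, c v = m)
    (hR : ∀ u v, R' (c u) (c v) ↔ R u v) (hcard : Fintype.card V ≤ 2 ^ k) :
    Within R' n k (c u) (c v) ↔ ReflTransGen R u v := by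
  constructor
  · clear hcard
    induction k generalizing u v with
    | zero =>
      rintro (h | h)
      · rw [hc h]
      · exact .single ((hR _ _).1 h)
    | succ k ih =>
      rintro ⟨m, hm, h₁, h₂⟩
      obtain ⟨w, rfl⟩ := hsurj m hm
      exact (ih h₁).trans (ih h₂)
  · intro h
    have := ball_mono R u hcard (mem_ball_card h)
    clear hcard h
    induction k generalizing u v with
    | zero =>
      rcases this with h | ⟨w, h, hw⟩
      · exact Or.inl (congrArg c h.symm)
      · obtain rfl : w = u := h
        exact Or.inr ((hR _ _).2 hw)
    | succ k ih =>
      rw [show 2 ^ (k + 1) = 2 ^ k + 2 ^ k by ring] at this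
      obtain ⟨m, h₁, h₂⟩ := mem_ball_add this
      exact ⟨c m, hlt m, ih h₁, ih h₂⟩

end Ball

/-! ### Nodes as numbers -/

theorem mul_add_lt {a b n m : ℕ} (ha : a < m) (hb : b < n) : a * n + b < m * n := by
  have := Nat.mul_le_mul_right n (Nat.succ_le_of_lt ha)
  rw [Nat.succ_mul] at this
  omega

theorem mul_add_mod {a b n : ℕ} (hb : b < n) : (a * n + b) % n = b := by
  rw [Nat.add_comm, Nat.add_mul_mod_self_right, Nat.mod_eq_of_lt hb]

theorem mul_add_div {a b n : ℕ} (hb : b < n) : (a * n + b) / n = a := by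
  rw [Nat.add_comm, Nat.add_mul_div_right _ _ (by omega), Nat.div_eq_of_lt hb, zero_add]

theorem mul_add_inj {n a a' : ℕ} {b b' : Fin n} (h : a * n + b = a' * n + b') : a = a' ∧ b = b' := by
  have h₁ := congrArg (· / n) h
  have h₂ := congrArg (· % n) h
  simp only [mul_add_div b.2, mul_add_div b'.2] at h₁
  simp only [mul_add_mod b.2, mul_add_mod b'.2] at h₂
  exact ⟨h₁, Fin.ext h₂⟩

/-- The number of a node. -/
def nodeCode (N S k a p : ℕ) : ℕ := (k * S + a) * N + p

theorem nodeCode_lt {N S k a p : ℕ} (hk : k < 6) (ha : a < S) (hp : p < N) :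
    nodeCode N S k a p < 6 * S * N :=
  mul_add_lt (mul_add_lt hk ha) hp

namespace Node

variable {N S : ℕ}

/-- The first component of the number of a node. -/
def kind (X : Node N S) : ℕ := 2 * X.place.code + X.dirty.toNat

theorem kind_lt (X : Node N S) : X.kind < 6 := by
  rcases X with ⟨_ | _ | _, _ | _, a, p⟩ <;> simp [kind, Move.code]

def code (X : Node N S) : ℕ := nodeCode N S X.kind X.sym X.state

theorem code_lt (X : Node N S) : X.code < 6 * S * N := nodeCode_lt X.kind_lt X.sym.2 X.state.2

theorem code_mod (X : Node N S) : X.code % N = X.state := mul_add_mod X.state.2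

theorem code_sym (X : Node N S) : X.code / N % S = X.sym := by
  rw [code, nodeCode, mul_add_div X.state.2, mul_add_mod X.sym.2]

theorem code_kind (X : Node N S) : X.code / N / S = X.kind := by
  rw [code, nodeCode, mul_add_div X.state.2, mul_add_div X.sym.2]

theorem code_dirty (X : Node N S) : X.code / N / S % 2 = X.dirty.toNat := by
  rw [code_kind, kind]
  cases X.dirty <;> simp

theorem code_place (X : Node N S) : X.code / N / S / 2 = X.place.code := by
  rw [code_kind, kind]
  cases X.dirty
  · simp
  · simp only [Bool.toNat_true]
    omega

theorem code_injective : Function.Injective (code : Node N S → ℕ) := by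
  intro X Y h
  have h₁ := X.code_mod
  have h₂ := X.code_sym
  have h₃ := X.code_kind
  rw [h] at h₁ h₂ h₃
  rw [code_mod] at h₁
  rw [code_sym] at h₂
  rw [code_kind] at h₃
  rcases X with ⟨m, d, a, p⟩
  rcases Y with ⟨m', d', a', p'⟩
  obtain rfl : p' = p := Fin.ext h₁
  obtain rfl : a' = a := Fin.ext h₂
  cases m <;> cases m' <;> cases d <;> cases d' <;> simp_all [kind, Move.code]

theorem exists_code {x : ℕ} (hx : x < 6 * S * N) : ∃ X : Node N S, X.code = x := by
  have hN : 0 < N := Nat.pos_of_ne_zero fun h => by simp [h] at hx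
  have hS : 0 < S := Nat.pos_of_ne_zero fun h => by simp [h] at hx
  have hk : x / N / S < 6 := by
    rw [Nat.div_lt_iff_lt_mul hS, Nat.div_lt_iff_lt_mul hN]; exact hx
  have hx' : x = nodeCode N S (x / N / S) (x / N % S) (x % N) := by
    rw [nodeCode, Nat.div_add_mod', Nat.div_add_mod']
  generalize x / N / S = k at hk hx'
  obtain ⟨m, d, hmd⟩ : ∃ (m : Move) (d : Bool), 2 * m.code + d.toNat = k := by
    interval_cases k
    exacts [⟨.left, false, rfl⟩, ⟨.left, true, rfl⟩, ⟨.stay, false, rfl⟩, ⟨.stay, true, rfl⟩,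
      ⟨.right, false, rfl⟩, ⟨.right, true, rfl⟩]
  refine ⟨⟨m, d, ⟨_, Nat.mod_lt (x / N) hS⟩, ⟨_, Nat.mod_lt x hN⟩⟩, ?_⟩
  rw [code, kind, hmd]
  exact hx'.symm

noncomputable instance : Fintype (Node N S) :=
  Fintype.ofInjective (fun X : Node N S => (⟨X.code, X.code_lt⟩ : Fin (6 * S * N)))
    fun _ _ h => code_injective (Fin.mk.inj_iff.1 h)

theorem card_le : Fintype.card (Node N S) ≤ 6 * S * N := by
  simpa using Fintype.card_le_of_injective
    (fun X : Node N S => (⟨X.code, X.code_lt⟩ : Fin (6 * S * N)))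
    fun _ _ h => code_injective (Fin.mk.inj_iff.1 h)

end Node

/-! ### Relations as numbers -/

/-- The relation whose truth values are the binary digits of `t`. -/
def tableOf (N t : ℕ) : Table N := fun p q => t.testBit (p * N + q) = true

theorem exists_testBit (n : ℕ) (P : ℕ → Prop) :
    ∃ t < 2 ^ n, ∀ i < n, t.testBit i = true ↔ P i := by
  classical
  exact ⟨Nat.ofBits fun i : Fin n => decide (P i), Nat.ofBits_lt_two_pow _, fun i hi => by simp [hi]⟩

theorem exists_tableOf {N : ℕ} (X : Table N) : ∃ t < 2 ^ (N * N), tableOf N t = X := by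
  obtain ⟨t, ht, h⟩ := exists_testBit (N * N) fun i => ∃ p q : Fin N, i = p * N + q ∧ X p q
  refine ⟨t, ht, ?_⟩
  funext p q
  refine propext ((h _ (mul_add_lt p.2 q.2)).trans ⟨?_, fun hX => ⟨p, q, rfl, hX⟩⟩)
  rintro ⟨p', q', he, hX⟩
  obtain ⟨hp, rfl⟩ := mul_add_inj he
  rwa [Fin.ext hp]

theorem tableOf_injOn {N t t' : ℕ} (ht : t < 2 ^ (N * N)) (ht' : t' < 2 ^ (N * N))
    (h : tableOf N t = tableOf N t') : t = t' := by
  refine Nat.eq_of_testBit_eq fun i => ?_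
  by_cases hi : i < N * N
  · have hN : 0 < N := Nat.pos_of_ne_zero fun h => by simp [h] at hi
    have := congrFun (congrFun h ⟨i / N, by rwa [Nat.div_lt_iff_lt_mul hN]⟩) ⟨i % N, Nat.mod_lt _ hN⟩
    simp only [tableOf, Nat.div_add_mod', eq_iff_iff] at this
    exact Bool.eq_iff_iff.2 this
  · have : 2 ^ (N * N) ≤ 2 ^ i := Nat.pow_le_pow_right (by omega) (not_lt.1 hi)
    rw [Nat.testBit_eq_false_of_lt (by omega), Nat.testBit_eq_false_of_lt (by omega)]

/-- `e` contains the values of the function `E` on relations. -/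
def Represents (N e : ℕ) (E : Table N → Table N) : Prop :=
  ∀ t < 2 ^ (N * N), ∀ p q : Fin N, e.testBit ((t * N + p) * N + q) = true ↔ E (tableOf N t) p q

/-- With the next lemma, quantifying over all functions on tables is the same as quantifying over
bounded numbers. Injectivity of the numbering of tables makes the function well defined. -/
theorem exists_represents_of_number (N e : ℕ) : ∃ E : Table N → Table N, Represents N e E := by
  refine ⟨fun X p q => ∃ t < 2 ^ (N * N), tableOf N t = X ∧
    e.testBit ((t * N + p) * N + q) = true, fun t ht p q => ⟨fun h => ⟨t, ht, rfl, h⟩, ?_⟩⟩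
  rintro ⟨t', ht', h, he⟩
  rwa [tableOf_injOn ht ht' h.symm]

theorem exists_represents_of_function {N : ℕ} (E : Table N → Table N) :
    ∃ e < 2 ^ (2 ^ (N * N) * N * N), Represents N e E := by
  obtain ⟨e, he, h⟩ := exists_testBit (2 ^ (N * N) * N * N) fun i =>
    ∃ t, ∃ p q : Fin N, i = (t * N + p) * N + q ∧ E (tableOf N t) p q
  refine ⟨e, he, fun t ht p q =>
    (h _ (mul_add_lt (mul_add_lt ht p.2) q.2)).trans ⟨?_, fun hX => ⟨t, p, q, rfl, hX⟩⟩⟩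
  rintro ⟨t', p', q', hi, hE⟩
  obtain ⟨hp, rfl⟩ := mul_add_inj hi
  obtain ⟨rfl, rfl⟩ := mul_add_inj hp
  exact hE

end Braid

namespace Braid

open Reg Relation

/-! ### The reachability criterion in terms of numbers -/

/-- An exponent `k` with `n ≤ 2 ^ k`, found by repeated doubling. -/
def depth (n : ℕ) : ℕ := ((fun y : ℕ × ℕ => if y.2 < n then (y.1 + 1, y.2 + y.2) else y)^[n] (0, 1)).1

/-- The last clause says that the doubling never pauses before `n` is reached; as `n < 2 ^ n`, it
has been reached after `n` rounds. -/
theorem depth_iterate {n : ℕ} (hn : 0 < n) (j : ℕ) :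
    ∃ k ≤ j, (fun y : ℕ × ℕ => if y.2 < n then (y.1 + 1, y.2 + y.2) else y)^[j] (0, 1) = (k, 2 ^ k) ∧
      2 ^ k < 2 * n ∧ (2 ^ k < n → k = j) := by
  induction j with
  | zero => exact ⟨0, le_rfl, rfl, by omega, fun _ => rfl⟩
  | succ j ih =>
    obtain ⟨k, hk, he, h₁, h₂⟩ := ih
    rw [Function.iterate_succ_apply', he]
    by_cases h : 2 ^ k < n
    · refine ⟨k + 1, by omega, ?_, ?_, fun _ => by rw [h₂ h]⟩
      · rw [if_pos h, pow_succ, mul_two]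
      · rw [pow_succ]; omega
    · exact ⟨k, by omega, by rw [if_neg h], h₁, fun h' => absurd h' h⟩

theorem depth_spec {n : ℕ} (hn : 0 < n) : n ≤ 2 ^ depth n ∧ 2 ^ depth n < 2 * n := by
  obtain ⟨k, hk, he, h₁, h₂⟩ := depth_iterate hn n
  rw [depth, he]
  refine ⟨not_lt.1 fun h => ?_, h₁⟩
  have h₃ := h₂ h
  have h₄ : k < 2 ^ k := Nat.lt_two_pow_self
  dsimp only at h
  omega

namespace BraidTM

variable {N S : ℕ}

/-- The relation `Edge` on the numbers of nodes. -/
def EdgeCode (B : BraidTM N S) (T : Fin N) (t : ℕ) (ψ : ℕ → ℕ → ℕ → Prop) (x y : ℕ) : Prop :=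
  (x / N / S / 2 = 1 ∧ ∃ w < S + 1,
    ((∃ i ∈ B.program, i.codes = [x % N, x / N % S, w, y / N / S / 2, y % N]) ∨
      (x % N = T ∧ w = 0 ∧ y / N / S / 2 = 0 ∧ y % N = T)) ∧
    ((w = 0 ∧ y / N % S = x / N % S ∧ y / N / S % 2 = x / N / S % 2) ∨
      (w = y / N % S + 1 ∧ y / N / S % 2 = 0))) ∨
  (x / N / S / 2 = 0 ∧ y / N / S / 2 = 1 ∧ y / N / S % 2 = x / N / S % 2 ∧ y / N % S = x / N % S ∧
    t.testBit (x % N * N + y % N) = true) ∨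
  -- The kind of a node is `2 * place + dirty`: `4` is right and clean, `3` is on the cell and
  -- dirty. Likewise, `2` is on the cell and clean, `5` is right and dirty, and `0` and `1` are
  -- left.
  (x / N / S = 4 ∧ y / N / S = 3 ∧ y / N % S = x / N % S ∧ ψ (x / N % S) (x % N) (y % N))

theorem _root_.Braid.Move.code_injective : Function.Injective Move.code := by
  intro m m' h
  cases m <;> cases m' <;> first | rfl | cases h

theorem _root_.Braid.writeCode_injective : Function.Injective (writeCode (S := S)) := by
  rintro (_ | a) (_ | b) h
  · rfl
  · simp [writeCode] at h
  · simp [writeCode] at h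
  · have : (a : ℕ) = b := by simpa [writeCode] using h
    rw [Fin.ext this]

theorem _root_.Braid.Instr.codes_inj {i i' : Instr N S} (h : i.codes = i'.codes) : i = i' := by
  rcases i with ⟨p, a, w, m, q⟩
  rcases i' with ⟨p', a', w', m', q'⟩
  simp only [Instr.codes, List.cons.injEq, and_true] at h
  obtain ⟨h₁, h₂, h₃, h₄, h₅⟩ := h
  rw [Fin.ext h₁, Fin.ext h₂, writeCode_injective h₃, Move.code_injective h₄, Fin.ext h₅]

theorem can_iff {B : BraidTM N S} {T p : Fin N} {a : Fin S} {w : Option (Fin S)} {m : Move}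
    {q : Fin N} : ((∃ i ∈ B.program, i.codes = [(p : ℕ), (a : ℕ), writeCode w, m.code, (q : ℕ)]) ∨
      ((p : ℕ) = T ∧ writeCode w = 0 ∧ m.code = 0 ∧ (q : ℕ) = T)) ↔ B.Can T p a w m q := by
  refine or_congr ⟨?_, fun h => ⟨_, h, rfl⟩⟩ ?_
  · rintro ⟨i, hi, h⟩
    rwa [← Instr.codes_inj (i' := ⟨p, a, w, m, q⟩) h]
  · rw [Fin.ext_iff, Fin.ext_iff, ← writeCode_injective.eq_iff (a := w),
      ← Move.code_injective.eq_iff (a := m)]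
    rfl

theorem edgeCode_iff {B : BraidTM N S} {T : Fin N} {t : ℕ} {ψ : ℕ → ℕ → ℕ → Prop} (X Y : Node N S) :
    B.EdgeCode T t ψ X.code Y.code ↔
      B.Edge T (tableOf N t) (fun a q q' => ψ a q q') X Y := by
  simp only [EdgeCode, Node.code_mod, Node.code_sym, Node.code_dirty, Node.code_place]
  simp only [Node.code_kind]
  rcases X with ⟨m, d, a, p⟩
  rcases Y with ⟨m', d', a', p'⟩
  have hstay : ∀ m : Move, m.code = 1 ↔ m = .stay := fun m => Move.code_injective.eq_iff (b := .stay)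
  have hleft : ∀ m : Move, m.code = 0 ↔ m = .left := fun m => Move.code_injective.eq_iff (b := .left)
  dsimp only
  constructor
  · rintro (⟨hm, w, hw, hc, hw'⟩ | ⟨hm, hm', hd, ha, ht⟩ | ⟨h, h', ha, hψ⟩)
    · obtain rfl := (hstay m).1 hm
      rcases hw' with ⟨rfl, ha, hd⟩ | ⟨rfl, hd⟩
      · obtain rfl := Fin.ext ha
        have := Edge.instr (X := tableOf N t) (Y := fun a q q' => ψ a q q') d
          (can_iff (w := none).1 hc)
        have hdd : d' = d := by revert hd; cases d <;> cases d' <;> simp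
        simpa [hdd] using this
      · have := Edge.instr (X := tableOf N t) (Y := fun a q q' => ψ a q q') d
          (can_iff (w := some a').1 hc)
        have hdd : d' = false := by revert hd; cases d' <;> simp
        simpa [hdd] using this
    · obtain rfl := (hleft m).1 hm
      obtain rfl := (hstay m').1 hm'
      obtain rfl := Fin.ext ha
      have hdd : d' = d := by revert hd; cases d <;> cases d' <;> simp
      rw [hdd]
      exact .back _ _ ht
    · obtain rfl := Fin.ext ha
      cases m <;> cases d <;> simp [Node.kind, Move.code] at h
      cases m' <;> cases d' <;> simp [Node.kind, Move.code] at h'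
      exact .excursion hψ
  · rintro (⟨d, hc⟩ | ⟨d, a, ht⟩ | hψ)
    · rename_i w
      refine .inl ⟨rfl, writeCode w, ?_, can_iff.2 hc, ?_⟩
      · cases w with
        | none => exact Nat.succ_pos S
        | some b => exact Nat.succ_lt_succ b.2
      · cases w <;> simp [writeCode]
    · exact .inr (.inl ⟨rfl, rfl, rfl, rfl, ht⟩)
    · exact .inr (.inr ⟨rfl, rfl, rfl, hψ⟩)

theorem within_edgeCode_iff {B : BraidTM N S} {T : Fin N} {t : ℕ} {ψ : ℕ → ℕ → ℕ → Prop}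
    {X Y : Node N S} : Within (B.EdgeCode T t ψ) (6 * S * N) (depth (6 * S * N)) X.code Y.code ↔
      ReflTransGen (B.Edge T (tableOf N t) fun a q q' => ψ a q q') X Y :=
  within_iff Node.code_injective Node.code_lt (fun _ => Node.exists_code) edgeCode_iff
    (Node.card_le.trans (depth_spec ((Nat.zero_le _).trans_lt X.code_lt)).1)

/-- The function `extend` on numbers. -/
def ExtendCode (B : BraidTM N S) (T : Fin N) (t a q q' : ℕ) : Prop :=
  Within (B.EdgeCode T t fun _ _ _ => False) (6 * S * N) (depth (6 * S * N))
    (nodeCode N S 3 a q) (nodeCode N S 5 a q')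

theorem extendCode_iff {B : BraidTM N S} {T : Fin N} {t : ℕ} {a : Fin S} {q q' : Fin N} :
    B.ExtendCode T t a q q' ↔ B.extend T (tableOf N t) a q q' :=
  within_edgeCode_iff (X := ⟨.stay, true, a, q⟩) (Y := ⟨.right, true, a, q'⟩)

/-- `e` applied to the extension of the relation with number `t` by the symbol `a`. -/
def ExcursionCode (B : BraidTM N S) (T : Fin N) (e t a q q' : ℕ) : Prop :=
  ∃ t' < 2 ^ (N * N), (∀ r < N, ∀ r' < N, t'.testBit (r * N + r') = true ↔ B.ExtendCode T t a r r') ∧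
    e.testBit ((t' * N + q) * N + q') = true

/-- The extended table is not computed but guessed: its number `t'` is searched for, and verified
entry by entry through `ExtendCode`. -/
theorem excursionCode_iff {B : BraidTM N S} {T : Fin N} {e t : ℕ} {E : Table N → Table N}
    (hE : Represents N e E) {a : Fin S} {q q' : Fin N} :
    B.ExcursionCode T e t a q q' ↔ E (B.extend T (tableOf N t) a) q q' := by
  constructor
  · rintro ⟨t', ht', h, he⟩
    have : tableOf N t' = B.extend T (tableOf N t) a := by
      funext r r'
      exact propext ((h r r.2 r' r'.2).trans extendCode_iff)
    rw [← this]
    exact (hE t' ht' q q').1 he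
  · intro h
    obtain ⟨t', ht', he⟩ := exists_tableOf (B.extend T (tableOf N t) a)
    refine ⟨t', ht', fun r hr r' hr' => ?_, (hE t' ht' q q').2 (he ▸ h)⟩
    exact (iff_of_eq (congrFun (congrFun he ⟨r, hr⟩) ⟨r', hr'⟩)).trans
      (extendCode_iff (q := ⟨r, hr⟩) (q' := ⟨r', hr'⟩)).symm

/-- The predicate `Closed` on numbers. -/
def ClosedCode (B : BraidTM N S) (T : Fin N) (e : ℕ) : Prop :=
  ∀ t < 2 ^ (N * N), ∀ p < N, ∀ q < N, ∀ a < S, ∀ d < 2,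
    Within (B.EdgeCode T t (B.ExcursionCode T e t)) (6 * S * N) (depth (6 * S * N))
      (nodeCode N S 2 B.blank p) (nodeCode N S d a q) → e.testBit ((t * N + p) * N + q) = true

theorem closedCode_iff {B : BraidTM N S} {T : Fin N} {e : ℕ} {E : Table N → Table N}
    (hE : Represents N e E) : B.ClosedCode T e ↔ B.Closed T E := by
  have key : ∀ (t : ℕ) (p q : Fin N) (d : Bool) (a : Fin S),
      Within (B.EdgeCode T t (B.ExcursionCode T e t)) (6 * S * N) (depth (6 * S * N))
        (nodeCode N S 2 B.blank p) (nodeCode N S d.toNat a q) ↔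
      ReflTransGen (B.Edge T (tableOf N t) fun a => E (B.extend T (tableOf N t) a))
        ⟨.stay, false, B.blank, p⟩ ⟨.left, d, a, q⟩ := fun t p q d a => by
    have h₁ : (fun a : Fin S => E (B.extend T (tableOf N t) a)) =
        fun (a : Fin S) (q q' : Fin N) => B.ExcursionCode T e t a q q' := by
      funext a q q'
      exact propext (excursionCode_iff hE).symm
    rw [h₁, ← within_edgeCode_iff]
    simp only [Node.code, Node.kind, Move.code, Bool.toNat_false, mul_zero, zero_add, mul_one,
      add_zero]
  constructor
  · intro h X p q d a hX
    obtain ⟨t, ht, rfl⟩ := exists_tableOf X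
    exact (hE t ht p q).1 (h t ht p p.2 q q.2 a a.2 d.toNat d.toNat_lt ((key t p q d a).2 hX))
  · intro h t ht p hp q hq a ha d hd hW
    refine (hE t ht ⟨p, hp⟩ ⟨q, hq⟩).2 (h _ _ _ (d == 1) ⟨a, ha⟩ ((key _ _ _ _ _).1 ?_))
    have : (d == 1).toNat = d := by interval_cases d <;> rfl
    rwa [this]

/-- The second universal quantifier only names the number `t` of the equality table, which exists
and is characterised by its bits. All quantifiers are now bounded by numbers that fit into
registers. -/
theorem canReach_iff_code (B : BraidTM N S) (T : Fin N) : B.CanReach T ↔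
    ∀ e < 2 ^ (2 ^ (N * N) * N * N), B.ClosedCode T e → ∀ t < 2 ^ (N * N),
      (∀ p < N, ∀ q < N, t.testBit (p * N + q) = true ↔ p = q) →
        e.testBit ((t * N + B.start) * N + T) = true := by
  have hid : ∀ t, (∀ p < N, ∀ q < N, t.testBit (p * N + q) = true ↔ p = q) ↔ tableOf N t = Eq := by
    refine fun t => ⟨fun h => ?_, fun h p hp q hq => ?_⟩
    · funext p q
      exact propext ((h p p.2 q q.2).trans Fin.ext_iff.symm)
    · exact (iff_of_eq (congrFun (congrFun h ⟨p, hp⟩) ⟨q, hq⟩)).trans Fin.ext_iff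
  rw [canReach_iff]
  constructor
  · intro h e _ he t ht htid
    obtain ⟨E, hE⟩ := exists_represents_of_number N e
    have := h E ((closedCode_iff hE).1 he)
    rw [← (hid t).1 htid] at this
    exact (hE t ht _ _).2 this
  · intro h E hE
    obtain ⟨e, he, hrep⟩ := exists_represents_of_function E
    obtain ⟨t, ht, htid⟩ := exists_tableOf (Eq : Table N)
    have := h e he ((closedCode_iff hrep).2 hE) t ht ((hid t).2 htid)
    rw [← htid]
    exact (hrep t ht _ _).1 this

end BraidTM

end Braid

namespace Braid

open Reg Relation

/-! ### Deciding the criterion -/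

namespace Problem

variable (I : Problem)

theorem N_pos : 0 < I.N := I.target.pos

theorem S_pos : 0 < I.S := I.machine.blank.pos

/-- The number of nodes. -/
def nodes : ℕ := 6 * I.S * I.N

theorem nodes_pos : 0 < I.nodes := Nat.mul_pos (Nat.mul_pos (by omega) I.S_pos) I.N_pos

theorem lt_cap_of_lt_width {n : ℕ} (h : n < I.width) : 2 ^ n < I.cap :=
  Nat.pow_lt_pow_right (by omega) h

theorem nodes_lt : 2 * I.nodes < 2 ^ (I.N + I.logS + 5) := by
  have h₁ : I.N < 2 ^ I.N := Nat.lt_two_pow_self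
  have h₂ := Nat.mul_lt_mul'' I.S_lt h₁
  have h₃ : 2 ^ (I.N + I.logS + 5) = 16 * (2 ^ (I.logS + 1) * 2 ^ I.N) := by ring
  rw [h₃, nodes, mul_assoc 6]
  omega

theorem square_lt_width : (I.N + I.logS + 5) * (I.N + I.logS + 5) + 9 < I.width := by
  have h₁ := I.le_width
  have h₂ : I.N + I.logS + 5 ≤ (I.N + 6) * I.logS := by nlinarith [I.one_le_logS]
  have h₃ := Nat.mul_le_mul h₂ h₂
  have h₄ : (I.N + 6) ^ 2 * I.logS ^ 2 = (I.N + 6) * I.logS * ((I.N + 6) * I.logS) := by ring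
  omega

theorem depth_le : depth I.nodes ≤ I.N + I.logS + 5 :=
  ((Nat.pow_lt_pow_iff_right (by omega)).1
    ((depth_spec I.nodes_pos).2.trans I.nodes_lt)).le

/-- Both the bit length of the base `2 * I.nodes` and the recursion depth are at most `A = I.N +
I.logS + 5`, so an address needs at most about `A * A` bits. -/
theorem savitch_lt : 2 * I.nodes < I.cap ∧ depth I.nodes + 1 < I.cap ∧
    (2 * I.nodes) ^ depth I.nodes + 2 < I.cap := by
  have hw := I.square_lt_width
  have hd := I.depth_le
  set A := I.N + I.logS + 5 with hA
  have hA5 : 5 ≤ A := by omega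
  have hAA : A ≤ A * A := Nat.le_mul_of_pos_left _ (by omega)
  refine ⟨I.nodes_lt.trans (I.lt_cap_of_lt_width (by omega)), ?_, ?_⟩
  · have : A + 1 < 2 ^ (A + 1) := Nat.lt_two_pow_self
    have := I.lt_cap_of_lt_width (show A + 1 < I.width by omega)
    omega
  · have h₁ : (2 * I.nodes) ^ depth I.nodes ≤ 2 ^ (A * A) := by
      rw [pow_mul]
      exact (Nat.pow_le_pow_left I.nodes_lt.le _).trans
        (Nat.pow_le_pow_right (Nat.pos_of_ne_zero (by positivity)) hd)
    have h₂ := I.lt_cap_of_lt_width (show A * A + 2 < I.width by omega)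
    have h₃ : 2 ^ (A * A + 2) = 4 * 2 ^ (A * A) := by ring
    have h₄ : 1 ≤ 2 ^ (A * A) := Nat.one_le_two_pow
    omega

theorem nodes_lt_cap : I.nodes < I.cap := by
  have := I.savitch_lt.1
  omega

theorem N_lt_cap : I.N < I.cap := by
  have := I.size_lt_cap
  omega

theorem S_lt_cap : I.S + 1 < I.cap := by
  have := I.size_lt_cap
  omega

/-- The range of the search for closed functions; this is what forces space exponential in a
polynomial of `N`, independently of `S`. -/
theorem functions_lt : 2 ^ (2 ^ (I.N * I.N) * I.N * I.N) < I.cap := by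
  refine I.lt_cap_of_lt_width ?_
  have := I.le_width
  rw [sq I.N, ← mul_assoc (2 ^ _)] at this
  omega

theorem triples_lt : 2 ^ (I.N * I.N) * I.N * I.N < I.cap :=
  Nat.lt_two_pow_self.trans I.functions_lt

theorem pairs_le : 2 ^ (I.N * I.N) * I.N ≤ 2 ^ (I.N * I.N) * I.N * I.N :=
  Nat.le_mul_of_pos_right _ I.N_pos

theorem tables_lt : 2 ^ (I.N * I.N) < I.cap :=
  ((Nat.le_mul_of_pos_right _ I.N_pos).trans I.pairs_le).trans_lt I.triples_lt

theorem square_lt : I.N * I.N < I.cap := Nat.lt_two_pow_self.trans I.tables_lt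

end Problem

theorem Dec.conj {α : Type} [Reg α] {D φ ψ : Problem → α → Prop} (hφ : Dec D φ) (hψ : Dec D ψ) :
    Dec D fun I a => φ I a ∧ ψ I a :=
  hφ.and (hψ.mono fun _ _ h => h.1)

namespace Comp

variable {α : Type} [Reg α] {D : Problem → α → Prop} {f g h : Problem → α → ℕ}

theorem mulAdd (hf : Comp D f) (hg : Comp D g) (hh : Comp D h)
    (hb : ∀ I a, D I a → f I a * g I a + h I a < I.cap) : Comp D fun I a => f I a * g I a + h I a :=
  (hf.mul hg fun I a ha => (Nat.le_add_right _ _).trans_lt (hb I a ha)).add hh hb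

theorem nodes : Comp D fun I _ => I.nodes :=
  ((const 6).mul numSymbols fun I _ _ => by have := I.size_lt_cap; omega).mul numStates
    fun I _ _ => I.nodes_lt_cap

theorem depth : Comp D fun I _ => Braid.depth I.nodes := by
  have h₁ : Comp (fun I (s : α × (ℕ × ℕ)) => s.2.1 + 1 < I.cap ∧ s.2.2 < 2 * I.nodes)
      fun I s => if s.2.2 < I.nodes then (s.2.1 + 1, s.2.2 + s.2.2) else s.2 :=
    (Dec.ite (Dec.lt snd.right nodes)
      ((snd.left.succ fun I s hs => hs.1.1).pair
        (snd.right.add snd.right fun I s hs => by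
          have : s.2.2 < I.nodes := hs.2
          have := I.savitch_lt.1
          omega)) (snd.mono fun _ _ h => h)).of_eq fun I s _ => by congr
  refine (iterate h₁ nodes ((const 0).pair (const 1)) fun I a ha j hj => ?_).left
  obtain ⟨k, hk, he, h₂, -⟩ := depth_iterate I.nodes_pos j
  have := I.nodes_lt_cap
  dsimp only
  rw [he]
  exact ⟨by show k + 1 < _; omega, h₂⟩

theorem nodeCode (hf : Comp D f) (hg : Comp D g) (hh : Comp D h)
    (hb : ∀ I a, D I a → f I a < 6 ∧ g I a < I.S ∧ h I a < I.N) :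
    Comp D fun I a => Braid.nodeCode I.N I.S (f I a) (g I a) (h I a) := by
  have h₁ : ∀ I a, D I a → f I a * I.S + g I a < 6 * I.S := fun I a ha =>
    mul_add_lt (hb I a ha).1 (hb I a ha).2.1
  exact (hf.mulAdd numSymbols hg fun I a ha => by
      have := h₁ I a ha; have := I.size_lt_cap; omega).mulAdd numStates hh
    fun I a ha => (mul_add_lt (h₁ I a ha) (hb I a ha).2.2).trans I.nodes_lt_cap

end Comp

namespace Dec

variable {α : Type} [Reg α] {D : Problem → α → Prop}

/-- The excursion predicate `ψ` is an arbitrary decidable one. This allows nesting: for the outer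
search `ψ` itself runs the inner searches of `ExtendCode`. -/
theorem edgeCode {t : Problem → α → ℕ} {ψ : Problem → α × (ℕ × (ℕ × ℕ)) → Prop}
    (ht : Comp D t) (htc : ∀ I a, D I a → t I a < I.cap)
    (hψ : Dec (fun I s => D I s.1 ∧ s.2.1 < I.S ∧ s.2.2.1 < I.N ∧ s.2.2.2 < I.N) ψ) :
    Dec (fun I (s : α × (ℕ × ℕ)) => D I s.1 ∧ s.2.1 < I.nodes ∧ s.2.2 < I.nodes) fun I s =>
      I.machine.EdgeCode I.target (t I s.1) (fun a q q' => ψ I (s.1, (a, (q, q')))) s.2.1 s.2.2 := by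
  let E : Problem → α × (ℕ × ℕ) → Prop :=
    fun I s => D I s.1 ∧ s.2.1 < I.nodes ∧ s.2.2 < I.nodes
  have hN : ∀ I (s : α × (ℕ × ℕ)), E I s → 0 < I.N ∧ I.N < I.cap :=
    fun I _ _ => ⟨I.N_pos, I.N_lt_cap⟩
  have hS : ∀ I (s : α × (ℕ × ℕ)), E I s → 0 < I.S ∧ I.S < I.cap :=
    fun I _ _ => ⟨I.S_pos, by have := I.S_lt_cap; omega⟩
  have h2 : ∀ I (s : α × (ℕ × ℕ)), E I s → 0 < 2 ∧ 2 < I.cap :=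
    fun I _ _ => ⟨by omega, I.lt_cap_of_le (by omega)⟩
  have split : ∀ {x : Problem → α × (ℕ × ℕ) → ℕ}, Comp E x → (∀ I s, E I s → x I s < I.nodes) →
      Comp E (fun I s => x I s % I.N) ∧ Comp E (fun I s => x I s / I.N % I.S) ∧
      Comp E (fun I s => x I s / I.N / I.S) ∧ Comp E (fun I s => x I s / I.N / I.S % 2) ∧
      Comp E (fun I s => x I s / I.N / I.S / 2) := by
    intro x hx hxn
    have h₀ : ∀ I s, E I s → x I s < I.cap := fun I s hs => (hxn I s hs).trans I.nodes_lt_cap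
    have h₁ : ∀ I s, E I s → x I s / I.N < I.cap := fun I s hs =>
      (Nat.div_le_self _ _).trans_lt (h₀ I s hs)
    have h₂ : ∀ I s, E I s → x I s / I.N / I.S < I.cap := fun I s hs =>
      (Nat.div_le_self _ _).trans_lt (h₁ I s hs)
    have c₁ := hx.div Comp.numStates h₀ hN
    have c₂ := c₁.div Comp.numSymbols h₁ hS
    exact ⟨hx.mod Comp.numStates h₀ hN, c₁.mod Comp.numSymbols h₁ hS, c₂,
      c₂.mod (Comp.const 2) h₂ h2, c₂.div (Comp.const 2) h₂ h2⟩
  obtain ⟨xp, xa, xk, xd, xm⟩ := split (x := fun _ s => s.2.1) Comp.snd.left fun I s hs => hs.2.1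
  obtain ⟨yp, ya, yk, yd, ym⟩ := split (x := fun _ s => s.2.2) Comp.snd.right fun I s hs => hs.2.2
  have lift : ∀ {x : Problem → α × (ℕ × ℕ) → ℕ}, Comp E x →
      Comp (fun I (s : (α × (ℕ × ℕ)) × ℕ) => E I s.1 ∧ s.2 < I.S + 1) fun I s => x I s.1 :=
    fun hx => hx.comp Comp.fst fun I s hs => hs.1
  have hw : Comp (fun I (s : (α × (ℕ × ℕ)) × ℕ) => E I s.1 ∧ s.2 < I.S + 1) fun _ s => s.2 :=
    Comp.snd
  have hplace : ∀ {I : Problem} {y : ℕ}, y < I.nodes → y / I.N / I.S / 2 < 3 := by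
    intro I y hy
    rw [Nat.div_lt_iff_lt_mul (by omega), Nat.div_lt_iff_lt_mul I.S_pos,
      Nat.div_lt_iff_lt_mul I.N_pos]
    exact hy
  have one : ∀ {γ : Type} [Reg γ] {D' : Problem → γ → Prop}, Comp D' fun _ _ => 1 :=
    Comp.const 1
  have nil : ∀ {γ : Type} [Reg γ] {D' : Problem → γ → Prop}, Comp D' fun _ _ => 0 :=
    Comp.zero
  have instr : Dec E fun I s => ∃ w < I.S + 1, ((∃ i ∈ I.machine.program,
      i.codes = [s.2.1 % I.N, s.2.1 / I.N % I.S, w, s.2.2 / I.N / I.S / 2, s.2.2 % I.N]) ∨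
        (s.2.1 % I.N = I.target ∧ w = 0 ∧ s.2.2 / I.N / I.S / 2 = 0 ∧ s.2.2 % I.N = I.target)) ∧
      ((w = 0 ∧ s.2.2 / I.N % I.S = s.2.1 / I.N % I.S ∧
          s.2.2 / I.N / I.S % 2 = s.2.1 / I.N / I.S % 2) ∨
        (w = s.2.2 / I.N % I.S + 1 ∧ s.2.2 / I.N / I.S % 2 = 0)) := by
    refine ex (φ := fun I (s : (α × (ℕ × ℕ)) × ℕ) => ((∃ i ∈ I.machine.program, i.codes = [s.1.2.1 % I.N,
        s.1.2.1 / I.N % I.S, s.2, s.1.2.2 / I.N / I.S / 2, s.1.2.2 % I.N]) ∨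
        (s.1.2.1 % I.N = I.target ∧ s.2 = 0 ∧ s.1.2.2 / I.N / I.S / 2 = 0 ∧
          s.1.2.2 % I.N = I.target)) ∧
      ((s.2 = 0 ∧ s.1.2.2 / I.N % I.S = s.1.2.1 / I.N % I.S ∧
          s.1.2.2 / I.N / I.S % 2 = s.1.2.1 / I.N / I.S % 2) ∨
        (s.2 = s.1.2.2 / I.N % I.S + 1 ∧ s.1.2.2 / I.N / I.S % 2 = 0)))
      (Comp.numSymbols.succ fun I _ _ => I.S_lt_cap) ?_ fun I _ _ => I.S_lt_cap
    refine conj (or (program (lift xp) (lift xa) hw (lift ym) (lift yp) fun I s hs => ?_)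
      ((eq (lift xp) Comp.target).conj ((eq hw nil).conj ((eq (lift ym) nil).conj
        (eq (lift yp) Comp.target))))) (or ((eq hw nil).conj ((eq (lift ya) (lift xa)).conj
        (eq (lift yd) (lift xd)))) ((eq hw ((lift ya).succ fun I s hs => ?_)).conj
          (eq (lift yd) nil)))
    · exact ⟨Nat.mod_lt _ I.N_pos, Nat.mod_lt _ I.S_pos, Nat.lt_succ_iff.1 hs.2, hplace hs.1.2.2,
        Nat.mod_lt _ I.N_pos⟩
    · have := Nat.mod_lt (s.1.2.2 / I.N) I.S_pos
      have := I.S_lt_cap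
      omega
  have back : Dec E fun I s => (t I s.1).testBit (s.2.1 % I.N * I.N + s.2.2 % I.N) = true :=
    testBit (f := fun I s => t I s.1) (ht.comp (f := fun _ (s : α × (ℕ × ℕ)) => s.1) Comp.fst fun I s hs => hs.1)
      (xp.mulAdd Comp.numStates yp fun I s _ =>
        (mul_add_lt (Nat.mod_lt _ I.N_pos) (Nat.mod_lt _ I.N_pos)).trans I.square_lt)
      fun I s hs => htc I s.1 hs.1
  have excursion : Dec E fun I s =>
      ψ I (s.1, (s.2.1 / I.N % I.S, (s.2.1 % I.N, s.2.2 % I.N))) :=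
    hψ.comp (Comp.fst.pair (xa.pair (xp.pair yp))) fun I s hs => ⟨hs.1, Nat.mod_lt _ I.S_pos,
      Nat.mod_lt _ I.N_pos, Nat.mod_lt _ I.N_pos⟩
  exact or ((eq xm one).conj instr) (or ((eq xm nil).conj ((eq ym one).conj ((eq yd xd).conj
    ((eq ya xa).conj back)))) ((eq xk (Comp.const 4)).conj ((eq yk (Comp.const 3)).conj
      ((eq ya xa).conj excursion))))

theorem reach {t u v : Problem → α → ℕ} {ψ : Problem → α × (ℕ × (ℕ × ℕ)) → Prop}
    (ht : Comp D t) (htc : ∀ I a, D I a → t I a < I.cap)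
    (hψ : Dec (fun I s => D I s.1 ∧ s.2.1 < I.S ∧ s.2.2.1 < I.N ∧ s.2.2.2 < I.N) ψ)
    (hu : Comp D u) (hv : Comp D v) (h : ∀ I a, D I a → u I a < I.nodes ∧ v I a < I.nodes) :
    Dec D fun I a => Within (I.machine.EdgeCode I.target (t I a) fun b q q' => ψ I (a, (b, (q, q'))))
      I.nodes (Braid.depth I.nodes) (u I a) (v I a) :=
  within (φ := fun I s => I.machine.EdgeCode I.target (t I s.1)
    (fun a q q' => ψ I (s.1, (a, (q, q')))) s.2.1 s.2.2) Comp.nodes Comp.depth hu hv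
    (edgeCode ht htc hψ) fun I a ha => ⟨(h I a ha).1, (h I a ha).2, I.savitch_lt⟩

theorem extendCode {t a q q' : Problem → α → ℕ} (ht : Comp D t) (ha : Comp D a) (hq : Comp D q)
    (hq' : Comp D q') (h : ∀ I s, D I s → t I s < I.cap ∧ a I s < I.S ∧ q I s < I.N ∧ q' I s < I.N) :
    Dec D fun I s => I.machine.ExtendCode I.target (t I s) (a I s) (q I s) (q' I s) :=
  reach (ψ := fun _ _ => False) ht (fun I s hs => (h I s hs).1)
    ((eq (Comp.const 0) (Comp.const 1)).of_iff fun _ _ _ => by simp)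
    (Comp.nodeCode (Comp.const 3) ha hq fun I s hs => ⟨by omega, (h I s hs).2.1, (h I s hs).2.2.1⟩)
    (Comp.nodeCode (Comp.const 5) ha hq' fun I s hs => ⟨by omega, (h I s hs).2.1, (h I s hs).2.2.2⟩)
    fun I s hs => ⟨nodeCode_lt (by omega) (h I s hs).2.1 (h I s hs).2.2.1,
      nodeCode_lt (by omega) (h I s hs).2.1 (h I s hs).2.2.2⟩

end Dec

theorem Comp.numTables {α : Type} [Reg α] {D : Problem → α → Prop} :
    Comp D fun I _ => 2 ^ (I.N * I.N) :=
  (numStates.mul numStates fun I _ _ => I.square_lt).two_pow fun I _ _ => I.tables_lt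

theorem Comp.triple {α : Type} [Reg α] {D : Problem → α → Prop} {t p q : Problem → α → ℕ}
    (ht : Comp D t) (hp : Comp D p) (hq : Comp D q)
    (h : ∀ I a, D I a → t I a < 2 ^ (I.N * I.N) ∧ p I a < I.N ∧ q I a < I.N) :
    Comp D fun I a => (t I a * I.N + p I a) * I.N + q I a := by
  have h₁ : ∀ I a, D I a → t I a * I.N + p I a < 2 ^ (I.N * I.N) * I.N := fun I a ha =>
    mul_add_lt (h I a ha).1 (h I a ha).2.1
  exact (ht.mulAdd numStates hp fun I a ha =>
    ((h₁ I a ha).trans_le I.pairs_le).trans I.triples_lt).mulAdd numStates hq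
    fun I a ha => (mul_add_lt (h₁ I a ha) (h I a ha).2.2).trans I.triples_lt

end Braid

/-! ### The bounded quantifiers of the criterion -/

namespace Braid

open Reg Relation

namespace Dec

variable {α : Type} [Reg α] {D : Problem → α → Prop}

theorem digitTriple {e t p q : Problem → α → ℕ} (he : Comp D e) (ht : Comp D t) (hp : Comp D p)
    (hq : Comp D q) (h : ∀ I a, D I a → e I a < I.cap ∧ t I a < 2 ^ (I.N * I.N) ∧ p I a < I.N ∧
      q I a < I.N) :
    Dec D fun I a => (e I a).testBit ((t I a * I.N + p I a) * I.N + q I a) = true :=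
  testBit he (ht.triple hp hq fun I a ha => (h I a ha).2) fun I a ha => (h I a ha).1

theorem digitPair {t p q : Problem → α → ℕ} (ht : Comp D t) (hp : Comp D p)
    (hq : Comp D q) (h : ∀ I a, D I a → t I a < I.cap ∧ p I a < I.N ∧ q I a < I.N) :
    Dec D fun I a => (t I a).testBit (p I a * I.N + q I a) = true :=
  testBit ht (hp.mulAdd Comp.numStates hq fun I a ha =>
    (mul_add_lt (h I a ha).2.1 (h I a ha).2.2).trans I.square_lt) fun I a ha => (h I a ha).1

theorem excursionCode : Dec (fun I (s : ℕ × (ℕ × (ℕ × (ℕ × ℕ)))) => s.1 < I.cap ∧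
      s.2.1 < 2 ^ (I.N * I.N) ∧ s.2.2.1 < I.S ∧ s.2.2.2.1 < I.N ∧ s.2.2.2.2 < I.N)
    fun I s => I.machine.ExcursionCode I.target s.1 s.2.1 s.2.2.1 s.2.2.2.1 s.2.2.2.2 := by
  refine ex (φ := fun I (s : (ℕ × (ℕ × (ℕ × (ℕ × ℕ)))) × ℕ) => (∀ r < I.N, ∀ r' < I.N, s.2.testBit (r * I.N + r') = true ↔
      I.machine.ExtendCode I.target s.1.2.1 s.1.2.2.1 r r') ∧
      s.1.1.testBit ((s.2 * I.N + s.1.2.2.2.1) * I.N + s.1.2.2.2.2) = true)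
    Comp.numTables (conj ?_ ?_) fun I _ _ => I.tables_lt
  · refine all (φ := fun I (s : ((ℕ × (ℕ × (ℕ × (ℕ × ℕ)))) × ℕ) × ℕ) => ∀ r' < I.N, s.1.2.testBit (s.2 * I.N + r') = true ↔
      I.machine.ExtendCode I.target s.1.1.2.1 s.1.1.2.2.1 s.2 r') Comp.numStates ?_
      fun I _ _ => I.N_lt_cap
    refine all (φ := fun I (s : (((ℕ × (ℕ × (ℕ × (ℕ × ℕ)))) × ℕ) × ℕ) × ℕ) => s.1.1.2.testBit (s.1.2 * I.N + s.2) = true ↔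
      I.machine.ExtendCode I.target s.1.1.1.2.1 s.1.1.1.2.2.1 s.1.2 s.2) Comp.numStates ?_
      fun I _ _ => I.N_lt_cap
    refine iff (digitPair Comp.fst.left.right Comp.fst.right Comp.snd fun I s hs => ?_)
      (extendCode Comp.fst.left.left.right.left Comp.fst.left.left.right.right.left Comp.fst.right
        Comp.snd fun I s hs => ?_)
    · exact ⟨hs.1.1.2.trans I.tables_lt, hs.1.2, hs.2⟩
    · exact ⟨hs.1.1.1.2.1.trans I.tables_lt, hs.1.1.1.2.2.1, hs.1.2, hs.2⟩
  · exact digitTriple Comp.fst.left Comp.snd Comp.fst.right.right.right.left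
      Comp.fst.right.right.right.right fun I s hs => ⟨hs.1.1, hs.2, hs.1.2.2.2⟩

theorem closedCode : Dec (fun I (e : ℕ) => e < I.cap) fun I e => I.machine.ClosedCode I.target e := by
  refine all (φ := fun I (s : ℕ × ℕ) => ∀ p < I.N, ∀ q < I.N, ∀ a < I.S, ∀ d < 2,
    Within (I.machine.EdgeCode I.target s.2 (I.machine.ExcursionCode I.target s.1 s.2))
      I.nodes (depth I.nodes) (nodeCode I.N I.S 2 I.machine.blank p)
      (nodeCode I.N I.S d a q) → s.1.testBit ((s.2 * I.N + p) * I.N + q) = true)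
    Comp.numTables ?_ fun I _ _ => I.tables_lt
  refine all (φ := fun I (s : (ℕ × ℕ) × ℕ) => ∀ q < I.N, ∀ a < I.S, ∀ d < 2,
    Within (I.machine.EdgeCode I.target s.1.2 (I.machine.ExcursionCode I.target s.1.1 s.1.2))
      I.nodes (depth I.nodes) (nodeCode I.N I.S 2 I.machine.blank s.2)
      (nodeCode I.N I.S d a q) → s.1.1.testBit ((s.1.2 * I.N + s.2) * I.N + q) = true)
    Comp.numStates ?_ fun I _ _ => I.N_lt_cap
  refine all (φ := fun I (s : ((ℕ × ℕ) × ℕ) × ℕ) => ∀ a < I.S, ∀ d < 2,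
    Within (I.machine.EdgeCode I.target s.1.1.2 (I.machine.ExcursionCode I.target s.1.1.1 s.1.1.2))
      I.nodes (depth I.nodes) (nodeCode I.N I.S 2 I.machine.blank s.1.2)
      (nodeCode I.N I.S d a s.2) → s.1.1.1.testBit ((s.1.1.2 * I.N + s.1.2) * I.N + s.2) = true)
    Comp.numStates ?_ fun I _ _ => I.N_lt_cap
  refine all (φ := fun I (s : (((ℕ × ℕ) × ℕ) × ℕ) × ℕ) => ∀ d < 2,
    Within (I.machine.EdgeCode I.target s.1.1.1.2
      (I.machine.ExcursionCode I.target s.1.1.1.1 s.1.1.1.2))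
      I.nodes (depth I.nodes) (nodeCode I.N I.S 2 I.machine.blank s.1.1.2)
      (nodeCode I.N I.S d s.2 s.1.2) →
        s.1.1.1.1.testBit ((s.1.1.1.2 * I.N + s.1.1.2) * I.N + s.1.2) = true)
    Comp.numSymbols ?_ fun I _ _ => by have := I.S_lt_cap; omega
  refine all (φ := fun I (s : ((((ℕ × ℕ) × ℕ) × ℕ) × ℕ) × ℕ) =>
    Within (I.machine.EdgeCode I.target s.1.1.1.1.2
      (I.machine.ExcursionCode I.target s.1.1.1.1.1 s.1.1.1.1.2))
      I.nodes (depth I.nodes) (nodeCode I.N I.S 2 I.machine.blank s.1.1.1.2)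
      (nodeCode I.N I.S s.2 s.1.2 s.1.1.2) →
        s.1.1.1.1.1.testBit ((s.1.1.1.1.2 * I.N + s.1.1.1.2) * I.N + s.1.1.2) = true)
    (Comp.const 2) ?_ fun I _ _ => I.lt_cap_of_le (by omega)
  refine imp (reach (ψ := fun I (s : (((((ℕ × ℕ) × ℕ) × ℕ) × ℕ) × ℕ) × (ℕ × (ℕ × ℕ))) => I.machine.ExcursionCode I.target s.1.1.1.1.1.1 s.1.1.1.1.1.2
      s.2.1 s.2.2.1 s.2.2.2) Comp.fst.left.left.left.right (fun I s hs =>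
      hs.1.1.1.1.2.trans I.tables_lt) ?_
    (Comp.nodeCode (Comp.const 2) Comp.blank Comp.fst.left.left.right fun I s hs => ?_)
    (Comp.nodeCode Comp.snd Comp.fst.right Comp.fst.left.right fun I s hs => ?_)
    fun I s hs => ⟨nodeCode_lt ?_ ?_ ?_, nodeCode_lt ?_ ?_ ?_⟩)
    (digitTriple Comp.fst.left.left.left.left Comp.fst.left.left.left.right
      Comp.fst.left.left.right Comp.fst.left.right fun I s hs => ?_)
  · exact excursionCode.comp (f := fun I (s : (((((ℕ × ℕ) × ℕ) × ℕ) × ℕ) × ℕ) × (ℕ × (ℕ × ℕ))) =>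
      (s.1.1.1.1.1.1, (s.1.1.1.1.1.2, (s.2.1, (s.2.2.1, s.2.2.2)))))
      (Comp.fst.left.left.left.left.left.pair (Comp.fst.left.left.left.left.right.pair Comp.snd))
      fun I s hs => ⟨hs.1.1.1.1.1.1, hs.1.1.1.1.1.2, hs.2⟩
  · exact ⟨by omega, I.machine.blank.2, hs.1.1.1.2⟩
  · exact ⟨by have := hs.2; omega, hs.1.2, hs.1.1.2⟩
  · omega
  · exact I.machine.blank.2
  · exact hs.1.1.1.2
  · have := hs.2; omega
  · exact hs.1.2
  · exact hs.1.1.2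
  · exact ⟨hs.1.1.1.1.1.1, hs.1.1.1.1.1.2, hs.1.1.1.1.2, hs.1.1.1.2⟩

theorem canReach : Dec (fun _ (_ : Unit) => True) fun I _ => I.machine.CanReach I.target := by
  refine of_iff ?_ fun I _ _ => (I.machine.canReach_iff_code I.target).symm
  refine all (φ := fun I (s : Unit × ℕ) => I.machine.ClosedCode I.target s.2 → ∀ t < 2 ^ (I.N * I.N),
      (∀ p < I.N, ∀ q < I.N, t.testBit (p * I.N + q) = true ↔ p = q) →
        s.2.testBit ((t * I.N + I.machine.start) * I.N + I.target) = true) ?_ ?_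
    fun I _ _ => I.functions_lt
  · exact ((Comp.numTables.mul Comp.numStates fun I _ _ =>
      I.pairs_le.trans_lt I.triples_lt).mul Comp.numStates fun I _ _ => I.triples_lt).two_pow
      fun I _ _ => I.functions_lt
  refine imp (closedCode.comp Comp.snd fun I s hs => hs.2.trans I.functions_lt) ?_
  refine all (φ := fun I (s : (Unit × ℕ) × ℕ) => (∀ p < I.N, ∀ q < I.N, s.2.testBit (p * I.N + q) = true ↔ p = q) →
        s.1.2.testBit ((s.2 * I.N + I.machine.start) * I.N + I.target) = true) Comp.numTables ?_
    fun I _ _ => I.tables_lt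
  refine imp ?_ (digitTriple Comp.fst.right Comp.snd Comp.start Comp.target fun I s hs =>
    ⟨hs.1.1.1.2.trans I.functions_lt, hs.1.2, I.machine.start.2, I.target.2⟩)
  refine all (φ := fun I (s : ((Unit × ℕ) × ℕ) × ℕ) => ∀ q < I.N, s.1.2.testBit (s.2 * I.N + q) = true ↔ s.2 = q)
    Comp.numStates ?_ fun I _ _ => I.N_lt_cap
  refine all (φ := fun I (s : (((Unit × ℕ) × ℕ) × ℕ) × ℕ) => s.1.1.2.testBit (s.1.2 * I.N + s.2) = true ↔ s.1.2 = s.2)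
    Comp.numStates ?_ fun I _ _ => I.N_lt_cap
  exact iff (digitPair Comp.fst.left.right Comp.fst.right Comp.snd fun I s hs =>
    ⟨hs.1.1.2.trans I.tables_lt, hs.1.2, hs.2⟩) (eq Comp.fst.right Comp.snd)

end Dec

end Braid

/-! ### The deciding machine and its space bound -/

namespace Braid

theorem Store.empty_eq : Store.empty = Store.ofRegs 0 fun _ => 0 := by
  simp only [Store.ofRegs, counter_zero, Store.empty]

theorem SpaceTM.DecidesWithin.mono {A : Type} {M : SpaceTM A} {x : List A} {P : Prop} {s s' : ℕ}
    (h : M.DecidesWithin x P s) (hs : s ≤ s') : M.DecidesWithin x P s' :=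
  ⟨h.1, h.2.trans (by exact_mod_cast hs)⟩

/-- A machine that decides reachability in the space that the registers need. -/
theorem exists_spaceTM : ∃ (M : SpaceTM Sym) (K : ℕ), ∀ I : Problem,
    M.DecidesWithin I.input (I.machine.CanReach I.target) (K * (I.width + 2)) := by
  -- The argument of type `Unit` occupies no registers, so the answer can be put into register `0`.
  obtain ⟨P, hP⟩ := Dec.canReach 0 0 (Nat.le_refl 0)
  -- The last action moves the head of tape `0` to cell `1`, which is blank exactly if the answer is
  -- zero; this is the acceptance test of `toSpaceTM`.
  obtain ⟨K, hK, hPK⟩ := Prog.exists_below (P := .seq P (.act ⟨0, id, .right, .stay⟩))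
  refine ⟨(P.seq (.act ⟨0, id, .right, .stay⟩)).toSpaceTM K, K, fun I => ?_⟩
  obtain ⟨p', v', he, -, -, hf⟩ := hP I () 0 (fun _ => 0) trivial
    (fun _ => I.lt_cap_of_le (by omega)) fun _ h => absurd h (Nat.not_lt_zero _)
  have hrun := he (by omega)
  obtain ⟨c, hc, -, -, hz⟩ := Exec.shift (x := I.input) (L := I.width) (v := v') (r := 0)
    (hrun.pos_le (by simp [Store.ofRegs]))
  have hd := Prog.decidesWithin_of_run hK hPK (Store.empty_eq ▸ hrun.seq hc)
  rw [Reg.fits_nat] at hf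
  have hiff : c.scan 0 ≠ .blank ↔ I.machine.CanReach I.target := by
    rw [Ne, hz, hf]
    by_cases h : I.machine.CanReach I.target <;> simp [h]
  rwa [propext hiff] at hd

end Braid

theorem theorem4 :
    ∃ (M : Braid.SpaceTM Braid.Sym) (p : Polynomial ℕ),
      ∀ (N S : ℕ) (B : Braid.BraidTM N S) (T : Fin N),
        M.DecidesWithin (Braid.encodeInstance B T) (B.CanReach T)
          (2 ^ (p.eval N) * (max 1 (Nat.log 2 S)) ^ 2) := by
  obtain ⟨M, K, hM⟩ := Braid.exists_spaceTM
  -- As the width is at least one, `K * (width + 2) ≤ 3 * K * width`, and `3 * K ≤ 2 ^ (3 * K)`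
  -- moves the number of tapes into the exponent.
  refine ⟨M, .X ^ 2 + 2 * .X + .C (10 + 3 * K), fun N S B T => (hM ⟨N, S, B, T⟩).mono ?_⟩
  have hK : 3 * K ≤ 2 ^ (3 * K) := Nat.lt_two_pow_self.le
  have hw : 1 ≤ 2 ^ (N ^ 2 + 2 * N + 10) * max 1 (Nat.log 2 S) ^ 2 :=
    Nat.mul_pos (by positivity) (by positivity)
  simp only [Braid.Problem.width, Polynomial.eval_add, Polynomial.eval_mul, Polynomial.eval_pow,
    Polynomial.eval_X, Polynomial.eval_C, Polynomial.eval_ofNat]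
  rw [← add_assoc, pow_add _ _ (3 * K), mul_comm _ (2 ^ (3 * K)), mul_assoc]
  refine le_trans ?_ (Nat.mul_le_mul_right _ hK)
  rw [mul_comm 3, mul_assoc K]
  exact Nat.mul_le_mul_left K (by omega)
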